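/- Let $G$ be a compact connected Lie group and let $H<G$ be a closed connected subgroup such that $G$ acts effectively on the homogeneous space $M=G/H$ and $\dim M\ge 3$. Let $T$ be a symmetric $G$-invariant $(0,2)$-tensor field on $M$. Denote by $\mathcal M$ the manifold of $G$-invariant Riemannian metrics on $M$, considered as an open subset of the finite-dimensional vector space of $G$-invariant symmetric $(0,2)$-tensor fields on $M$, and by $S:\mathcal M\to\mathbb R$ the functional that assigns to $g\in\mathcal M$ its (constant) scalar curvature. Consider the submanifold $$\mathcal M_T=\{g\in\mathcal M : \operatorname{tr}_g T=1\}\subset\mathcal M .$$ Then, for every $g\in\mathcal M_T$, the Ricci curvature of $g$ satisfies $\operatorname{Ric} g=cT$ on $M$ for some $c\in\mathbb R$ if and only if $g$ is a critical point of the restriction $S|_{\mathcal M_T}$. -/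

import Mathlib

open scoped Manifold ContDiff Bundle

noncomputable section

namespace HomogeneousRicci

/-- Euclidean space `ℝⁿ`, the model of an `n`-dimensional manifold. -/
abbrev Model (n : ℕ) : Type := EuclideanSpace ℝ (Fin n)

/-! ### Riemannian curvature of smooth metrics in charts

`M` is a manifold of dimension `n` without boundary. The chart around `x` used below is Mathlib's
preferred chart `extChartAt (𝓡 n) x`, a diffeomorphism from a neighbourhood of `x` onto an open
subset of `ℝⁿ`. Its coordinate fields are `∂₁, …, ∂ₙ`. -/

section Riemannian

variable {n : ℕ} {M : Type*} [TopologicalSpace M] [ChartedSpace (Model n) M]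

variable (M) in
/-- A (0,2)-tensor field on `M`, without any regularity. -/
abbrev TensorField02 : Type _ :=
  ∀ x : M, TangentSpace (𝓡 n) x →L[ℝ] TangentSpace (𝓡 n) x →L[ℝ] ℝ

variable (M) in
/-- Smooth Riemannian metrics on `M`. -/
abbrev RiemMetric [IsManifold (𝓡 n) ∞ M] : Type _ :=
  Bundle.ContMDiffRiemannianMetric (𝓡 n) ∞ (Model n)
    (fun x : M => TangentSpace (𝓡 n) x)

/-- Smoothness of a (0,2)-tensor field, as a section of the bundle of bilinear forms. -/
def IsSmoothTensor [IsManifold (𝓡 n) ∞ M] (T : TensorField02 (n := n) M) : Prop :=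
  ContMDiff (𝓡 n) ((𝓡 n).prod 𝓘(ℝ, Model n →L[ℝ] Model n →L[ℝ] ℝ)) ∞
    (fun x : M => Bundle.TotalSpace.mk' (Model n →L[ℝ] Model n →L[ℝ] ℝ)
      (E := fun x : M => TangentSpace (𝓡 n) x →L[ℝ] TangentSpace (𝓡 n) x →L[ℝ] ℝ) x (T x))

/-- The `i`-th coordinate field `∂ᵢ` of the chart around `x`, at the point with coordinates `y`. -/
def coordField (x : M) (y : Model n) (i : Fin n) :
    TangentSpace (𝓡 n) ((extChartAt (𝓡 n) x).symm y) :=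
  mfderiv (𝓡 n) (𝓡 n) (extChartAt (𝓡 n) x).symm y (EuclideanSpace.single i (1 : ℝ))

/-- The coordinate 1-forms at the centre of the chart around `x`: `dxⁱ(v)` for `v ∈ T_x M`. -/
def coordForm (x : M) (i : Fin n) (v : TangentSpace (𝓡 n) x) : ℝ :=
  (EuclideanSpace.proj i : Model n →L[ℝ] ℝ) (mfderiv (𝓡 n) (𝓡 n) (extChartAt (𝓡 n) x) x v)

/-- The matrix `B(∂ᵢ, ∂ⱼ)` of a field `B` of bilinear forms, in the chart around `x`, at the point
with coordinates `y`. -/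
def coeff (B : ∀ x : M, TangentSpace (𝓡 n) x → TangentSpace (𝓡 n) x → ℝ)
    (x : M) (y : Model n) : Matrix (Fin n) (Fin n) ℝ :=
  Matrix.of fun i j =>
    B ((extChartAt (𝓡 n) x).symm y) (coordField x y i) (coordField x y j)

/-- The partial derivative `∂f/∂yⁱ`. -/
def partialDeriv (i : Fin n) (f : Model n → ℝ) (y : Model n) : ℝ :=
  fderiv ℝ f y (EuclideanSpace.single i (1 : ℝ))

variable [IsManifold (𝓡 n) ∞ M]

/-- The coefficients `gᵢⱼ` of the metric `g` in the chart around `x`. -/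
def metricCoeff (g : RiemMetric (n := n) M) (x : M) (y : Model n) : Matrix (Fin n) (Fin n) ℝ :=
  coeff (fun z v w => g.inner z v w) x y

/-- The Christoffel symbols
`Γᵏᵢⱼ = ½ ∑ₗ gᵏˡ (∂ᵢ gⱼₗ + ∂ⱼ gᵢₗ - ∂ₗ gᵢⱼ)` of `g` in the chart around `x`. -/
def christoffel (g : RiemMetric (n := n) M) (x : M) (k i j : Fin n) (y : Model n) : ℝ :=
  (1 / 2 : ℝ) * ∑ l, (metricCoeff g x y)⁻¹ k l *
    (partialDeriv i (fun z => metricCoeff g x z j l) y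
      + partialDeriv j (fun z => metricCoeff g x z i l) y
      - partialDeriv l (fun z => metricCoeff g x z i j) y)

/-- The Ricci coefficients
`Rᵢⱼ = ∑ₖ (∂ₖ Γᵏᵢⱼ - ∂ⱼ Γᵏᵢₖ) + ∑ₖₗ (Γᵏₖₗ Γˡᵢⱼ - Γᵏⱼₗ Γˡᵢₖ)` of `g` in the chart around `x`. -/
def ricciCoeff (g : RiemMetric (n := n) M) (x : M) (i j : Fin n) (y : Model n) : ℝ :=
  (∑ k, (partialDeriv k (christoffel g x k i j) y - partialDeriv j (christoffel g x k i k) y))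
    + ∑ k, ∑ l, (christoffel g x k k l y * christoffel g x l i j y
        - christoffel g x k j l y * christoffel g x l i k y)

/-- The Ricci curvature of `g`: at `x` it is `∑ᵢⱼ Rᵢⱼ dxⁱ ⊗ dxʲ`, in the chart around `x`. -/
def ricci (g : RiemMetric (n := n) M) (x : M) (v w : TangentSpace (𝓡 n) x) : ℝ :=
  ∑ i, ∑ j, ricciCoeff g x i j (extChartAt (𝓡 n) x x) * coordForm x i v * coordForm x j w

/-- The trace `tr_g B = ∑ᵢⱼ gⁱʲ Bᵢⱼ` at `x` of a field `B` of bilinear forms. -/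
def metricTrace (g : RiemMetric (n := n) M)
    (B : ∀ x : M, TangentSpace (𝓡 n) x → TangentSpace (𝓡 n) x → ℝ) (x : M) : ℝ :=
  ∑ i, ∑ j, (metricCoeff g x (extChartAt (𝓡 n) x x))⁻¹ i j *
    coeff B x (extChartAt (𝓡 n) x x) i j

/-- The scalar curvature of `g` at `x`, the trace of the Ricci curvature. -/
def scalarCurvature (g : RiemMetric (n := n) M) (x : M) : ℝ :=
  metricTrace g (ricci g) x

end Riemannian

/-! ### Invariant tensors and metrics on the homogeneous space `G ⧸ H` -/

section Homogeneous

variable {n : ℕ} {G : Type*} [Group G] [TopologicalSpace G] {H : Subgroup G}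
  [ChartedSpace (Model n) (G ⧸ H)]

/-- `G`-invariance of a (0,2)-tensor field: every translation of `G ⧸ H` preserves it. -/
def IsInvariant (T : TensorField02 (n := n) (G ⧸ H)) : Prop :=
  ∀ (a : G) (x : G ⧸ H) (v w : TangentSpace (𝓡 n) x),
    T (a • x) (mfderiv (𝓡 n) (𝓡 n) (fun z : G ⧸ H => a • z) x v)
        (mfderiv (𝓡 n) (𝓡 n) (fun z : G ⧸ H => a • z) x w) = T x v w

variable [IsManifold (𝓡 n) ∞ (G ⧸ H)]

variable (n H) in
/-- The set `𝓜` of `G`-invariant Riemannian metrics on `G ⧸ H`. -/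
def invariantMetrics : Set (RiemMetric (n := n) (G ⧸ H)) :=
  {g | IsInvariant (n := n) (H := H) g.inner}

/-- The set `𝓜_T = {g ∈ 𝓜 | tr_g T = 1}`. -/
def unitTraceMetrics (T : TensorField02 (n := n) (G ⧸ H)) : Set (RiemMetric (n := n) (G ⧸ H)) :=
  {g | g ∈ invariantMetrics n H ∧ ∀ x, metricTrace g (fun z v w => T z v w) x = 1}

/-- The scalar curvature functional `S`. The scalar curvature of an invariant metric is constant,
and `S g` is its value at the coset of the identity. -/
def scalarFunctional (g : RiemMetric (n := n) (G ⧸ H)) : ℝ :=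
  scalarCurvature g ((1 : G) : G ⧸ H)

/-- A smooth curve of metrics. On the set `𝓜`, which is an open subset of the finite-dimensional
space of invariant symmetric tensors, these are the smooth curves in the usual sense, because an
invariant tensor is determined by its value at one point. -/
def IsSmoothCurve (γ : ℝ → RiemMetric (n := n) (G ⧸ H)) : Prop :=
  ∀ (x : G ⧸ H) (v w : TangentSpace (𝓡 n) x), ContDiff ℝ ∞ (fun t => (γ t).inner x v w)

/-- `g` is a critical point of the restriction of `F` to the submanifold `N` of `𝓜`: the
differential of `F` vanishes on the velocity at `g` of every smooth curve that lies in `N` and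
passes through `g`, that is, on every vector tangent to `N` at `g`. -/
def IsCriticalPointOn (F : RiemMetric (n := n) (G ⧸ H) → ℝ)
    (N : Set (RiemMetric (n := n) (G ⧸ H))) (g : RiemMetric (n := n) (G ⧸ H)) : Prop :=
  g ∈ N ∧ ∀ γ : ℝ → RiemMetric (n := n) (G ⧸ H), IsSmoothCurve γ → (∀ t, γ t ∈ N) → γ 0 = g →
    HasDerivAt (fun t => F (γ t)) 0 0

end Homogeneous

end HomogeneousRicci

end

open scoped Manifold ContDiff Bundle Topology

set_option maxSynthPendingDepth 3
set_option linter.unusedSectionVars false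
set_option linter.deprecated false

noncomputable section

/-! Write ⟨·,·⟩ for the inner product that `g` induces on symmetric bilinear forms (`pairB`). Along
a curve of metrics with velocity `h`, the scalar curvature has derivative −⟨h, Ric g⟩ + div W, where
the vector field W is built from the variation of the Levi-Civita connection
(`MetricFamily.hasDerivAt_scal`). For invariant metrics W is an invariant field, and such a field
has zero divergence on a compact homogeneous space (`SmoothAction.divg_eq_zero`). Hence dS(h) = −⟨h,
Ric g⟩, evaluated at the single point `origin H`; in the same way d(tr T)(h) = −⟨h, T⟩.

If Ric g = cT, then dS = c · d(tr T), which vanishes along curves on which tr T is constant.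
Conversely, T does not vanish because its trace is 1, so B = Ric g − cT is orthogonal to T for a
suitable c. The tensor B is smooth, symmetric and invariant, and `SmoothAction.exists_curve`
provides a curve in 𝓜_T whose velocity is a nonzero multiple of B. Criticality gives ⟨B, Ric g⟩ = 0,
hence ⟨B, B⟩ = 0, and B = 0 by positive definiteness (`eq_zero_of_pairB_self`).

The vanishing of the divergence is obtained by a maximum argument, without integration. Let K₁, …,
Kₙ be fundamental vector fields of the action and q = det g(Kᵢ, Kⱼ). An invariant field X commutes
with every Kᵢ, so X q = 2 q div X (`MetricOn.divg_eq_zero_of_isLocalMax`). At a maximum of q over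
the compact space, q is positive and X q = 0, so div X = 0 there, and everywhere by homogeneity.
Positivity requires the Kᵢ to be a frame at the origin, that is, the orbit map must be a submersion;
this holds because it is open and its rank is largest at the identity
(`surjective_of_constant_rank`).

All geometry is done for metrics on open subsets of a vector space. Naturality under local
isometries then serves both for changes of chart and for translations by group elements. -/

namespace HomogeneousRicci

/-! ### Traces and nondegenerate bilinear forms, free of coordinates. -/

section LinearAlgebra

variable {E : Type*} [NormedAddCommGroup E] [NormedSpace ℝ E] [FiniteDimensional ℝ E]
  {F : Type*} [NormedAddCommGroup F] [NormedSpace ℝ F]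

variable (E) in
/-- A basis of `E`. -/
abbrev stdVec (i : Fin (Module.finrank ℝ E)) : E := Module.finBasis ℝ E i

variable (E) in
/-- The dual basis. -/
def stdForm (i : Fin (Module.finrank ℝ E)) : E →L[ℝ] ℝ :=
  LinearMap.toContinuousLinearMap ((Module.finBasis ℝ E).coord i)

variable (E) in
/-- Bilinear forms on `E`. -/
abbrev Bil : Type _ := E →L[ℝ] E →L[ℝ] ℝ

theorem sum_coord_smul (v : E) : ∑ i, stdForm E i v • stdVec E i = v :=
  (Module.finBasis ℝ E).sum_repr v

theorem sum_apply_smul_form (l : E →L[ℝ] ℝ) : ∑ i, l (stdVec E i) • stdForm E i = l := by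
  ext v
  conv_rhs => rw [← sum_coord_smul v]
  simp only [ContinuousLinearMap.sum_apply, ContinuousLinearMap.smul_apply, map_sum, map_smul,
    smul_eq_mul]
  exact Finset.sum_congr rfl fun i _ => mul_comm _ _

/-- Contracting a covector slot with a vector slot does not see on which of the two an endomorphism
acts. This replaces the index shuffling in the derivative and in the naturality of `varField`. -/
theorem sum_contract_comp (m : (E →L[ℝ] ℝ) →L[ℝ] E →L[ℝ] F) (T : E →L[ℝ] E) :
    ∑ i, m (stdForm E i ∘L T) (stdVec E i) = ∑ i, m (stdForm E i) (T (stdVec E i)) := by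
  have h1 : ∀ i, m (stdForm E i ∘L T) (stdVec E i) =
      ∑ j, stdForm E i (T (stdVec E j)) • m (stdForm E j) (stdVec E i) := by
    intro i
    conv_lhs => rw [← sum_apply_smul_form (stdForm E i ∘L T)]
    simp only [map_sum, map_smul, ContinuousLinearMap.sum_apply, ContinuousLinearMap.smul_apply,
      ContinuousLinearMap.comp_apply]
  have h2 : ∀ j, m (stdForm E j) (T (stdVec E j)) =
      ∑ i, stdForm E i (T (stdVec E j)) • m (stdForm E j) (stdVec E i) := by
    intro j
    conv_lhs => rw [← sum_coord_smul (T (stdVec E j))]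
    simp only [map_sum, map_smul]
  simp_rw [h1, h2]
  exact Finset.sum_comm

/-- The trace of an endomorphism. -/
def tr (f : E →L[ℝ] E) : ℝ := LinearMap.trace ℝ E (f : E →ₗ[ℝ] E)

theorem tr_eq_sum_basis {ι : Type*} [Fintype ι] [DecidableEq ι] (B : Module.Basis ι ℝ E)
    (f : E →L[ℝ] E) : tr f = ∑ i, B.coord i (f (B i)) := by
  rw [tr, LinearMap.trace_eq_matrix_trace ℝ B, Matrix.trace]
  simp [LinearMap.toMatrix_apply]

theorem tr_eq_sum (f : E →L[ℝ] E) : tr f = ∑ i, stdForm E i (f (stdVec E i)) :=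
  tr_eq_sum_basis _ f

theorem tr_comp_comm (f g : E →L[ℝ] E) : tr (f ∘L g) = tr (g ∘L f) :=
  LinearMap.trace_mul_comm ℝ (f : E →ₗ[ℝ] E) (g : E →ₗ[ℝ] E)

@[simp] theorem tr_add (f g : E →L[ℝ] E) : tr (f + g) = tr f + tr g := by
  simp [tr]

@[simp] theorem tr_sub (f g : E →L[ℝ] E) : tr (f - g) = tr f - tr g := by
  simp [tr]

@[simp] theorem tr_neg (f : E →L[ℝ] E) : tr (-f) = - tr f := by
  simp [tr]

@[simp] theorem tr_smul (c : ℝ) (f : E →L[ℝ] E) : tr (c • f) = c * tr f := by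
  simp [tr]

variable (E) in
/-- The trace as a continuous linear map. -/
def trL : (E →L[ℝ] E) →L[ℝ] ℝ :=
  LinearMap.toContinuousLinearMap
    { toFun := tr, map_add' := tr_add, map_smul' := fun c f => by simp }

@[simp] theorem trL_apply (f : E →L[ℝ] E) : trL E f = tr f := rfl

theorem tr_conj {L : E →L[ℝ] E} (hL : L.IsInvertible)
    {f g : E →L[ℝ] E} (h : ∀ z, L (f z) = g (L z)) : tr f = tr g := by
  have h1 : f = L.inverse ∘L (g ∘L L) := by
    ext1 z
    simp [← h, hL.inverse_apply_self]
  rw [h1, tr_comp_comm, ContinuousLinearMap.comp_assoc, hL.self_comp_inverse]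
  simp

/-- The trace of a bilinear form `β` with respect to a nondegenerate bilinear form `b`. -/
def trB (b β : Bil E) : ℝ := tr (b.inverse ∘L β)

/-- The pullback of a bilinear form. -/
def pull (L : E →L[ℝ] E) (b : Bil E) : Bil E := b.bilinearComp L L

/-- An isometry commutes with raising an index; `b.inverse` is the sharp map of `b`. -/
theorem inverse_natural {L : E →L[ℝ] E} (hL : L.IsInvertible) {b b' : Bil E}
    (hb : b.IsInvertible) (hb' : b'.IsInvertible) (h : ∀ u v, b u v = b' (L u) (L v))
    (l : E →L[ℝ] ℝ) : L (b.inverse (l ∘L L)) = b'.inverse l := by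
  apply hb'.injective
  rw [hb'.self_apply_inverse]
  ext w
  obtain ⟨v, rfl⟩ := hL.surjective w
  rw [← h, hb.self_apply_inverse]
  rfl

theorem trB_natural {L : E →L[ℝ] E} (hL : L.IsInvertible) {b b' : Bil E}
    (hb : b.IsInvertible) (hb' : b'.IsInvertible) (h : ∀ u v, b u v = b' (L u) (L v))
    {β β' : Bil E} (hβ : ∀ u v, β u v = β' (L u) (L v)) : trB b β = trB b' β' := by
  apply tr_conj hL
  intro z
  have : β z = (β' (L z)) ∘L L := by ext v; simp [hβ]
  simp [this, inverse_natural hL hb hb' h]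

theorem isInvertible_of_pos {b : Bil E} (h : ∀ v, v ≠ 0 → 0 < b v v) : b.IsInvertible := by
  have hinj : Function.Injective b := by
    rw [injective_iff_map_eq_zero]
    intro v hv
    by_contra hne
    have := h v hne
    simp [hv] at this
  have hfr : Module.finrank ℝ E = Module.finrank ℝ (E →L[ℝ] ℝ) := by
    rw [← (LinearMap.toContinuousLinearMap (𝕜 := ℝ) (E := E) (F' := ℝ)).finrank_eq]
    exact (Subspace.dual_finrank_eq (K := ℝ) (V := E)).symm
  let e := LinearEquiv.ofInjectiveOfFinrankEq (b : E →ₗ[ℝ] (E →L[ℝ] ℝ)) hinj hfr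
  exact ⟨e.toContinuousLinearEquiv, by ext; rfl⟩

theorem inverse_symm {b : Bil E} (hb : b.IsInvertible) (hs : ∀ u v, b u v = b v u)
    (l m : E →L[ℝ] ℝ) : l (b.inverse m) = m (b.inverse l) := by
  have h1 : b (b.inverse l) (b.inverse m) = l (b.inverse m) := by rw [hb.self_apply_inverse l]
  have h2 : b (b.inverse m) (b.inverse l) = m (b.inverse l) := by rw [hb.self_apply_inverse m]
  rw [← h1, hs, h2]

/-- `⟨β, β'⟩_b` as a trace. -/
def pairB (b β β' : Bil E) : ℝ := trB b (β ∘L b.inverse ∘L β')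

end LinearAlgebra

/-! ### Christoffel symbols of a metric on an open subset of a vector space. -/

section LocalGeometry

variable {E : Type*} [NormedAddCommGroup E] [NormedSpace ℝ E] [FiniteDimensional ℝ E]

/-- Bilinear maps `ℝⁿ × ℝⁿ → ℝⁿ`. -/
abbrev Bimap (E : Type*) [NormedAddCommGroup E] [NormedSpace ℝ E] : Type _ := E →L[ℝ] E →L[ℝ] E

/-- The Christoffel symbols of the first kind, from the derivative `c` of the metric. -/
def chrLow (c : E →L[ℝ] Bil E) : E →L[ℝ] Bil E :=
  (1 / 2 : ℝ) • (c + c.flip -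
    (ContinuousLinearMap.flipₗᵢ ℝ (E) (E) ℝ).toContinuousLinearEquiv.toContinuousLinearMap
      ∘L c.flip)

theorem chrLow_apply (c : E →L[ℝ] Bil E) (u v w : E) :
    chrLow c u v w = (1 / 2) * (c u v w + c v u w - c w u v) := by
  simp [chrLow]

/-- `chrLow` as a continuous linear map. -/
def chrLowL (E : Type*) [NormedAddCommGroup E] [NormedSpace ℝ E] [FiniteDimensional ℝ E] : (E →L[ℝ] Bil E) →L[ℝ] (E →L[ℝ] Bil E) :=
  LinearMap.toContinuousLinearMap
    { toFun := chrLow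
      map_add' := fun c d => by
        ext u v w
        simp only [chrLow_apply, ContinuousLinearMap.add_apply]
        ring
      map_smul' := fun r c => by
        ext u v w
        simp only [chrLow_apply, ContinuousLinearMap.smul_apply, smul_eq_mul, RingHom.id_apply]
        ring }

/-- The Christoffel symbols from the metric `β` and its derivative `c`. -/
def chrOf (β : Bil E) (c : E →L[ℝ] Bil E) : Bimap E :=
  (ContinuousLinearMap.compL ℝ (E) (E →L[ℝ] ℝ) (E) β.inverse) ∘L chrLow c

theorem contDiffAt_inverse_of_isInvertible {β : Bil E} (hβ : β.IsInvertible) :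
    ContDiffAt ℝ ∞ (ContinuousLinearMap.inverse : Bil E → _) β := by
  obtain ⟨e, rfl⟩ := hβ
  exact contDiffAt_map_inverse e

theorem ContDiffOn.chrOf {X : Type*} [NormedAddCommGroup X] [NormedSpace ℝ X] {s : Set X}
    {f : X → Bil E} {c : X → E →L[ℝ] Bil E}
    (hf : ContDiffOn ℝ ∞ f s) (hc : ContDiffOn ℝ ∞ c s) (hi : ∀ x ∈ s, (f x).IsInvertible) :
    ContDiffOn ℝ ∞ (fun x => chrOf (f x) (c x)) s := by
  have h1 : ContDiffOn ℝ ∞ (fun x => (f x).inverse) s := fun x hx =>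
    (contDiffAt_inverse_of_isInvertible (hi x hx)).comp_contDiffWithinAt x (hf x hx)
  have h2 : ContDiffOn ℝ ∞ (fun x => chrLow (c x)) s :=
    (chrLowL E).contDiff.comp_contDiffOn hc
  exact ((ContinuousLinearMap.compL ℝ (E) (E →L[ℝ] ℝ) (E)).contDiff.comp_contDiffOn
    h1).clm_comp h2

/-- The Christoffel symbols of the metric `b`. -/
def chr (b : E → Bil E) (y : E) : Bimap E := chrOf (b y) (fderiv ℝ b y)

/-- `b` is a smooth field of nondegenerate symmetric bilinear forms on the open set `Ω`. -/
structure MetricOn (b : E → Bil E) (Ω : Set (E)) : Prop where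
  isOpen : IsOpen Ω
  smooth : ContDiffOn ℝ ∞ b Ω
  symm : ∀ y ∈ Ω, ∀ u v, b y u v = b y v u
  inv : ∀ y ∈ Ω, (b y).IsInvertible

theorem differentiableAt_of_contDiffOn {X Y : Type*} [NormedAddCommGroup X] [NormedSpace ℝ X]
    [NormedAddCommGroup Y] [NormedSpace ℝ Y] {f : X → Y} {s : Set X} (hs : IsOpen s)
    (hf : ContDiffOn ℝ ∞ f s) {x : X} (hx : x ∈ s) : DifferentiableAt ℝ f x :=
  ((hf x hx).contDiffAt (hs.mem_nhds hx)).differentiableAt (by simp)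

theorem contDiffOn_fderiv {X Y : Type*} [NormedAddCommGroup X] [NormedSpace ℝ X]
    [NormedAddCommGroup Y] [NormedSpace ℝ Y] {f : X → Y} {s : Set X} (hs : IsOpen s)
    (hf : ContDiffOn ℝ ∞ f s) : ContDiffOn ℝ ∞ (fderiv ℝ f) s :=
  hf.fderiv_of_isOpen hs (by simp)

theorem second_symm {X Y : Type*} [NormedAddCommGroup X] [NormedSpace ℝ X]
    [NormedAddCommGroup Y] [NormedSpace ℝ Y] {f : X → Y} {s : Set X} (hs : IsOpen s)
    (hf : ContDiffOn ℝ ∞ f s) {x : X} (hx : x ∈ s) (u v : X) :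
    fderiv ℝ (fderiv ℝ f) x u v = fderiv ℝ (fderiv ℝ f) x v u := by
  have h := ((hf x hx).contDiffAt (hs.mem_nhds hx)).isSymmSndFDerivAt (by simp; exact WithTop.coe_le_coe.2 le_top)
  exact h u v

namespace MetricOn

variable {b : E → Bil E} {Ω : Set (E)} (hb : MetricOn b Ω)
include hb

theorem chr_contDiffOn : ContDiffOn ℝ ∞ (chr b) Ω :=
  ContDiffOn.chrOf hb.smooth (contDiffOn_fderiv hb.isOpen hb.smooth) hb.inv

end MetricOn

end LocalGeometry

/-! ### Metric compatibility and the Ricci form. -/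

section LocalCurvature

variable {E : Type*} [NormedAddCommGroup E] [NormedSpace ℝ E] [FiniteDimensional ℝ E]

theorem fderiv_apply_apply {F G H : Type*} [NormedAddCommGroup F] [NormedSpace ℝ F]
    [NormedAddCommGroup G] [NormedSpace ℝ G] [NormedAddCommGroup H] [NormedSpace ℝ H]
    {c : E → F →L[ℝ] G →L[ℝ] H} {y : E} (hc : DifferentiableAt ℝ c y) {f : E → F} {g : E → G}
    (hf : DifferentiableAt ℝ f y) (hg : DifferentiableAt ℝ g y) (z : E) :
    fderiv ℝ (fun x => c x (f x) (g x)) y z =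
      fderiv ℝ c y z (f y) (g y) + c y (fderiv ℝ f y z) (g y) + c y (f y) (fderiv ℝ g y z) := by
  have h1 : DifferentiableAt ℝ (fun x => c x (f x)) y := hc.clm_apply hf
  rw [fderiv_clm_apply h1 hg, fderiv_clm_apply hc hf]
  simp only [ContinuousLinearMap.add_apply, ContinuousLinearMap.comp_apply,
    ContinuousLinearMap.flip_apply]
  abel

theorem fderiv_apply_const {F G : Type*} [NormedAddCommGroup F] [NormedSpace ℝ F]
    [NormedAddCommGroup G] [NormedSpace ℝ G]
    {c : E → F →L[ℝ] G} {y : E} (hc : DifferentiableAt ℝ c y) (u : F) (z : E) :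
    fderiv ℝ (fun x => c x u) y z = fderiv ℝ c y z u := by
  rw [fderiv_clm_apply hc (differentiableAt_const u)]
  simp

theorem fderiv_apply_const₂ {F G H : Type*} [NormedAddCommGroup F] [NormedSpace ℝ F]
    [NormedAddCommGroup G] [NormedSpace ℝ G] [NormedAddCommGroup H] [NormedSpace ℝ H]
    {c : E → F →L[ℝ] G →L[ℝ] H} {y : E} (hc : DifferentiableAt ℝ c y) (u : F) (v : G) (z : E) :
    fderiv ℝ (fun x => c x u v) y z = fderiv ℝ c y z u v := by
  rw [fderiv_apply_apply hc (differentiableAt_const u) (differentiableAt_const v)]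
  simp

/-- Both sides contract `a` with the tensor `S` of type (2,0), and `S` is symmetric. -/
theorem sum_sharp_swap {F : Type*} [NormedAddCommGroup F] [NormedSpace ℝ F]
    {S : (E →L[ℝ] ℝ) →L[ℝ] E} (hS : ∀ l m : E →L[ℝ] ℝ, l (S m) = m (S l)) (a : E →L[ℝ] E →L[ℝ] F) :
    ∑ i, a (stdVec E i) (S (stdForm E i)) = ∑ i, a (S (stdForm E i)) (stdVec E i) := by
  have h1 : ∀ i, a (stdVec E i) (S (stdForm E i)) =
      ∑ j, stdForm E j (S (stdForm E i)) • a (stdVec E i) (stdVec E j) := fun i => by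
    conv_lhs => rw [← sum_coord_smul (S (stdForm E i))]
    simp only [map_sum, map_smul]
  have h2 : ∀ i, a (S (stdForm E i)) (stdVec E i) =
      ∑ j, stdForm E j (S (stdForm E i)) • a (stdVec E j) (stdVec E i) := fun i => by
    conv_lhs => rw [← sum_coord_smul (S (stdForm E i))]
    simp only [map_sum, map_smul, ContinuousLinearMap.sum_apply, ContinuousLinearMap.smul_apply]
  simp_rw [h1, h2]
  rw [Finset.sum_comm]
  exact Finset.sum_congr rfl fun i _ => Finset.sum_congr rfl fun j _ => by rw [hS]

theorem trB_eq_sum {b : Bil E} (hb : b.IsInvertible) (hs : ∀ u v, b u v = b v u) (β : Bil E) :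
    trB b β = ∑ i, β (stdVec E i) (b.inverse (stdForm E i)) := by
  rw [trB, tr_eq_sum]
  exact Finset.sum_congr rfl fun i _ => inverse_symm hb hs _ _

/-- The endomorphism `z ↦ R(z, u) v` of a connection with Christoffel symbols `Γ`, whose
derivative is `D`. -/
def curvEnd (Γ : Bimap E) (D : E →L[ℝ] Bimap E) (u v : E) : E →L[ℝ] E :=
  (D.flip u).flip v - (D u).flip v + Γ.flip (Γ u v) - (Γ u) ∘L (Γ.flip v)

theorem curvEnd_apply (Γ : Bimap E) (D : E →L[ℝ] Bimap E) (u v z : E) :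
    curvEnd Γ D u v z = D z u v - D u z v + Γ z (Γ u v) - Γ u (Γ z v) := by
  simp [curvEnd]

/-- The Ricci form of a connection with Christoffel symbols `Γ`, whose derivative is `D`. -/
def ricOf (Γ : Bimap E) (D : E →L[ℝ] Bimap E) : Bil E :=
  LinearMap.toContinuousBilinearMap <| LinearMap.mk₂ ℝ (fun u v => tr (curvEnd Γ D u v))
    (fun u u' v => by
      rw [← tr_add]; congr 1; ext z
      simp only [curvEnd_apply, ContinuousLinearMap.add_apply, map_add]; abel)
    (fun c u v => by
      rw [smul_eq_mul, ← tr_smul]; congr 1; ext z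
      simp only [curvEnd_apply, ContinuousLinearMap.smul_apply, map_smul, smul_sub, smul_add])
    (fun u v v' => by
      rw [← tr_add]; congr 1; ext z
      simp only [curvEnd_apply, ContinuousLinearMap.add_apply, map_add]; abel)
    (fun c u v => by
      rw [smul_eq_mul, ← tr_smul]; congr 1; ext z
      simp only [curvEnd_apply, ContinuousLinearMap.smul_apply, map_smul, smul_sub, smul_add])

theorem ricOf_apply (Γ : Bimap E) (D : E →L[ℝ] Bimap E) (u v : E) :
    ricOf Γ D u v = tr (curvEnd Γ D u v) := rfl

/-- The Ricci form of the metric `b`. -/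
def ric (b : E → Bil E) (y : E) : Bil E := ricOf (chr b y) (fderiv ℝ (chr b) y)

theorem chr_apply (b : E → Bil E) (y u v : E) :
    chr b y u v = (b y).inverse (chrLow (fderiv ℝ b y) u v) := rfl

namespace MetricOn

variable {b : E → Bil E} {Ω : Set E} (hb : MetricOn b Ω)
include hb

theorem differentiableAt {y : E} (hy : y ∈ Ω) : DifferentiableAt ℝ b y :=
  differentiableAt_of_contDiffOn hb.isOpen hb.smooth hy

theorem chr_differentiableAt {y : E} (hy : y ∈ Ω) : DifferentiableAt ℝ (chr b) y :=
  differentiableAt_of_contDiffOn hb.isOpen hb.chr_contDiffOn hy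

theorem fderiv_symm {y : E} (hy : y ∈ Ω) (z u v : E) :
    fderiv ℝ b y z u v = fderiv ℝ b y z v u := by
  rw [← fderiv_apply_const₂ (hb.differentiableAt hy), ← fderiv_apply_const₂ (hb.differentiableAt hy)]
  congr 1
  apply Filter.EventuallyEq.fderiv_eq
  filter_upwards [hb.isOpen.mem_nhds hy] with x hx using hb.symm x hx u v

theorem chr_spec {y : E} (hy : y ∈ Ω) (u v w : E) :
    b y (chr b y u v) w =
      (1 / 2) * (fderiv ℝ b y u v w + fderiv ℝ b y v u w - fderiv ℝ b y w u v) := by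
  rw [chr_apply, (hb.inv y hy).self_apply_inverse, chrLow_apply]

theorem ext_form {y : E} (hy : y ∈ Ω) {u v : E} (h : ∀ w, b y u w = b y v w) : u = v :=
  (hb.inv y hy).injective (by ext w; exact h w)

theorem chr_symm {y : E} (hy : y ∈ Ω) (u v : E) : chr b y u v = chr b y v u := by
  apply hb.ext_form hy
  intro w
  rw [hb.chr_spec hy, hb.chr_spec hy, hb.fderiv_symm hy w u v]
  ring

theorem compat {y : E} (hy : y ∈ Ω) (z u v : E) :
    fderiv ℝ b y z u v = b y (chr b y z u) v + b y u (chr b y z v) := by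
  rw [hb.symm y hy u, hb.chr_spec hy, hb.chr_spec hy, hb.fderiv_symm hy z v u]
  ring

theorem fderiv_chr_symm {y : E} (hy : y ∈ Ω) (z u v : E) :
    fderiv ℝ (chr b) y z u v = fderiv ℝ (chr b) y z v u := by
  rw [← fderiv_apply_const₂ (hb.chr_differentiableAt hy),
    ← fderiv_apply_const₂ (hb.chr_differentiableAt hy)]
  congr 1
  apply Filter.EventuallyEq.fderiv_eq
  filter_upwards [hb.isOpen.mem_nhds hy] with x hx using hb.chr_symm hx u v

theorem inverse_contDiffOn : ContDiffOn ℝ ∞ (fun y => (b y).inverse) Ω := fun x hx =>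
  (contDiffAt_inverse_of_isInvertible (hb.inv x hx)).comp_contDiffWithinAt x (hb.smooth x hx)

theorem inverse_differentiableAt {y : E} (hy : y ∈ Ω) :
    DifferentiableAt ℝ (fun y => (b y).inverse) y :=
  differentiableAt_of_contDiffOn hb.isOpen hb.inverse_contDiffOn hy

theorem fderiv_inverse_apply {y : E} (hy : y ∈ Ω) (z : E) (l : E →L[ℝ] ℝ) :
    fderiv ℝ (fun y => (b y).inverse) y z l = - (b y).inverse (fderiv ℝ b y z ((b y).inverse l)) := by
  have h1 : fderiv ℝ (fun x => b x ((b x).inverse l)) y z = 0 := by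
    have : (fun x => b x ((b x).inverse l)) =ᶠ[𝓝 y] fun _ => l := by
      filter_upwards [hb.isOpen.mem_nhds hy] with x hx
      rw [(hb.inv x hx).self_apply_inverse]
    rw [this.fderiv_eq]
    simp
  have hd : DifferentiableAt ℝ (fun x => (b x).inverse l) y :=
    (hb.inverse_differentiableAt hy).clm_apply (differentiableAt_const l)
  rw [fderiv_clm_apply (hb.differentiableAt hy) hd] at h1
  simp only [ContinuousLinearMap.add_apply, ContinuousLinearMap.comp_apply,
    ContinuousLinearMap.flip_apply] at h1
  rw [fderiv_apply_const (hb.inverse_differentiableAt hy)] at h1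
  have h2 := congrArg (b y).inverse h1
  rw [map_add, (hb.inv y hy).inverse_apply_self, map_zero] at h2
  exact eq_neg_of_add_eq_zero_left h2

/-- This is ∇b⁻¹ = 0, a consequence of ∇b = 0. -/
theorem fderiv_inverse_eq_chr {y : E} (hy : y ∈ Ω) (z : E) (l : E →L[ℝ] ℝ) :
    fderiv ℝ (fun y => (b y).inverse) y z l =
      - (b y).inverse (l ∘L chr b y z) - chr b y z ((b y).inverse l) := by
  rw [hb.fderiv_inverse_apply hy]
  apply hb.ext_form hy
  intro w
  have h := hb.inv y hy
  simp only [map_neg, map_sub, h.self_apply_inverse, ContinuousLinearMap.neg_apply,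
    ContinuousLinearMap.sub_apply, ContinuousLinearMap.comp_apply]
  rw [hb.compat hy, h.self_apply_inverse]
  ring

/-- By the Koszul formula, `b ∘ Γ_v` differs from half the derivative of `b` along `v` by an
antisymmetric form, and the trace of an antisymmetric form with respect to the symmetric `b` is
zero. -/
theorem tr_chr {y : E} (hy : y ∈ Ω) (v : E) :
    tr (chr b y v) = (1 / 2) * trB (b y) (fderiv ℝ b y v) := by
  have h := hb.inv y hy
  set a : E →L[ℝ] E →L[ℝ] ℝ := (b y) ∘L (chr b y v) - (1 / 2 : ℝ) • fderiv ℝ b y v with ha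
  have hanti : ∀ z w, a z w = - a w z := by
    intro z w
    simp only [ha, ContinuousLinearMap.sub_apply, ContinuousLinearMap.comp_apply,
      ContinuousLinearMap.smul_apply, smul_eq_mul]
    rw [hb.chr_spec hy, hb.chr_spec hy, hb.fderiv_symm hy v w z]
    ring
  have htr : tr ((b y).inverse ∘L a) = 0 := by
    have h1 : trB (b y) a = trB (b y) a.flip := by
      rw [trB_eq_sum h (hb.symm y hy), trB_eq_sum h (hb.symm y hy)]
      exact sum_sharp_swap (inverse_symm h (hb.symm y hy)) a
    rw [trB, trB] at h1
    have h3 : a.flip = -a := by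
      ext z w
      rw [ContinuousLinearMap.flip_apply, hanti]
      rfl
    rw [h3, ContinuousLinearMap.comp_neg, tr_neg] at h1
    linarith
  have h4 : (b y).inverse ∘L a = chr b y v - (1 / 2 : ℝ) • ((b y).inverse ∘L fderiv ℝ b y v) := by
    ext z
    simp [ha, h.inverse_apply_self]
  rw [h4, tr_sub, tr_smul] at htr
  rw [trB]
  linarith

end MetricOn

end LocalCurvature

/-! ### Symmetry of the Ricci form; transformation of the connection under local isometries. -/

section RicciNatural

variable {E : Type*} [NormedAddCommGroup E] [NormedSpace ℝ E] [FiniteDimensional ℝ E]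

namespace MetricOn

variable {b : E → Bil E} {Ω : Set E} (hb : MetricOn b Ω)
include hb

theorem fderiv_differentiableAt {y : E} (hy : y ∈ Ω) : DifferentiableAt ℝ (fderiv ℝ b) y :=
  differentiableAt_of_contDiffOn hb.isOpen (contDiffOn_fderiv hb.isOpen hb.smooth) hy

/-- Classically, v ↦ tr Γ_v is the differential of log √det b, hence closed. Here `tr_chr` is
differentiated directly: the result is a second derivative of `b` plus the trace of a product of two
endomorphisms, both symmetric in `u` and `v`. -/
theorem fderiv_tr_chr_symm {y : E} (hy : y ∈ Ω) (u v : E) :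
    tr (fderiv ℝ (chr b) y u v) = tr (fderiv ℝ (chr b) y v u) := by
  have key : ∀ u v : E, tr (fderiv ℝ (chr b) y u v) = (1 / 2) *
      (tr ((b y).inverse ∘L fderiv ℝ (fderiv ℝ b) y u v)
        - tr (((b y).inverse ∘L fderiv ℝ b y u) ∘L ((b y).inverse ∘L fderiv ℝ b y v))) := by
    intro u v
    have h1 : tr (fderiv ℝ (chr b) y u v) = fderiv ℝ (fun x => tr (chr b x v)) y u := by
      have h := ((trL E).hasFDerivAt.comp y ((hb.chr_differentiableAt hy).clm_apply
        (differentiableAt_const v)).hasFDerivAt).fderiv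
      have h' := congrArg (fun f => f u) h
      simp only [ContinuousLinearMap.comp_apply, trL_apply] at h'
      rw [fderiv_apply_const (hb.chr_differentiableAt hy)] at h'
      exact h'.symm
    have h2 : (fun x => tr (chr b x v)) =ᶠ[𝓝 y]
        fun x => (1 / 2 : ℝ) * tr ((b x).inverse ∘L fderiv ℝ b x v) := by
      filter_upwards [hb.isOpen.mem_nhds hy] with x hx using hb.tr_chr hx v
    have hd : DifferentiableAt ℝ (fun x => fderiv ℝ b x v) y :=
      (hb.fderiv_differentiableAt hy).clm_apply (differentiableAt_const v)
    have h3 := (((trL E).hasFDerivAt.comp y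
      ((hb.inverse_differentiableAt hy).hasFDerivAt.clm_comp hd.hasFDerivAt)).const_mul
        (1 / 2 : ℝ)).fderiv
    have h4 := congrArg (fun f => f u) h3
    rw [h1, h2.fderiv_eq]
    refine h4.trans ?_
    simp only [ContinuousLinearMap.smul_apply, ContinuousLinearMap.comp_apply,
      ContinuousLinearMap.add_apply, trL_apply, tr_add, smul_eq_mul,
      ContinuousLinearMap.compL_apply, ContinuousLinearMap.flip_apply]
    rw [fderiv_apply_const (hb.fderiv_differentiableAt hy), sub_eq_add_neg, ← tr_neg]
    congr 3
    ext z
    simp only [ContinuousLinearMap.comp_apply, ContinuousLinearMap.neg_apply]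
    rw [hb.fderiv_inverse_apply hy]
  rw [key, key, second_symm hb.isOpen hb.smooth hy u v,
    tr_comp_comm ((b y).inverse ∘L fderiv ℝ b y u)]

/-- The antisymmetric part is the trace of a commutator plus the exterior derivative of v ↦ tr Γ_v;
both vanish. -/
theorem ric_symm {y : E} (hy : y ∈ Ω) (u v : E) : ric b y u v = ric b y v u := by
  have h : curvEnd (chr b y) (fderiv ℝ (chr b) y) u v - curvEnd (chr b y) (fderiv ℝ (chr b) y) v u =
      fderiv ℝ (chr b) y v u - fderiv ℝ (chr b) y u v +
        (chr b y v ∘L chr b y u - chr b y u ∘L chr b y v) := by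
    ext z
    simp only [ContinuousLinearMap.sub_apply, ContinuousLinearMap.add_apply, curvEnd_apply,
      ContinuousLinearMap.comp_apply]
    rw [hb.fderiv_chr_symm hy z u v, hb.fderiv_chr_symm hy u z v, hb.fderiv_chr_symm hy v z u,
      hb.chr_symm hy u v, hb.chr_symm hy z v, hb.chr_symm hy z u]
    abel
  have h2 := congrArg tr h
  rw [tr_add, tr_sub, tr_sub, tr_sub, tr_comp_comm (chr b y v), hb.fderiv_tr_chr_symm hy v u] at h2
  rw [ric, ricOf_apply, ricOf_apply]
  linarith

theorem ric_contDiffOn : ContDiffOn ℝ ∞ (ric b) Ω := by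
  have hc := hb.chr_contDiffOn
  have hd := contDiffOn_fderiv hb.isOpen hc
  rw [contDiffOn_clm_apply]
  intro u
  rw [contDiffOn_clm_apply]
  intro v
  simp only [ric, ricOf_apply, tr_eq_sum, curvEnd_apply]
  refine ContDiffOn.sum fun i _ => (stdForm E i).contDiff.comp_contDiffOn ?_
  fun_prop

end MetricOn

/-- `φ` is a local isometry from `(Ω, b)` to `(Ω', b')`. -/
structure IsometryOn (b b' : E → Bil E) (φ : E → E) (Ω Ω' : Set E) : Prop where
  left : MetricOn b Ω
  right : MetricOn b' Ω'
  smooth : ContDiffOn ℝ ∞ φ Ω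
  maps : Set.MapsTo φ Ω Ω'
  inv : ∀ y ∈ Ω, (fderiv ℝ φ y).IsInvertible
  compat : ∀ y ∈ Ω, ∀ u v, b y u v = b' (φ y) (fderiv ℝ φ y u) (fderiv ℝ φ y v)

namespace IsometryOn

variable {b b' : E → Bil E} {φ : E → E} {Ω Ω' : Set E} (h : IsometryOn b b' φ Ω Ω')
include h

theorem differentiableAt {y : E} (hy : y ∈ Ω) : DifferentiableAt ℝ φ y :=
  differentiableAt_of_contDiffOn h.left.isOpen h.smooth hy

theorem fderiv_differentiableAt {y : E} (hy : y ∈ Ω) : DifferentiableAt ℝ (fderiv ℝ φ) y :=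
  differentiableAt_of_contDiffOn h.left.isOpen (contDiffOn_fderiv h.left.isOpen h.smooth) hy

theorem fderiv_metric {y : E} (hy : y ∈ Ω) (z u v : E) :
    fderiv ℝ b y z u v =
      fderiv ℝ b' (φ y) (fderiv ℝ φ y z) (fderiv ℝ φ y u) (fderiv ℝ φ y v)
      + b' (φ y) (fderiv ℝ (fderiv ℝ φ) y z u) (fderiv ℝ φ y v)
      + b' (φ y) (fderiv ℝ φ y u) (fderiv ℝ (fderiv ℝ φ) y z v) := by
  have hd := h.fderiv_differentiableAt hy
  have hb' := h.right.differentiableAt (h.maps hy)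
  rw [← fderiv_apply_const₂ (h.left.differentiableAt hy)]
  have h1 : (fun x => b x u v) =ᶠ[𝓝 y]
      fun x => (b' (φ x)) (fderiv ℝ φ x u) (fderiv ℝ φ x v) := by
    filter_upwards [h.left.isOpen.mem_nhds hy] with x hx using h.compat x hx u v
  have hcomp : DifferentiableAt ℝ (fun x => b' (φ x)) y := hb'.comp y (h.differentiableAt hy)
  rw [h1.fderiv_eq, fderiv_apply_apply hcomp (hd.clm_apply (differentiableAt_const u))
    (hd.clm_apply (differentiableAt_const v)), fderiv_apply_const hd, fderiv_apply_const hd,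
    fderiv_comp' y hb' (h.differentiableAt hy)]
  rfl

/-- The transformation law of a connection. In the Koszul combination of the three derivatives of
the pulled back metric, all terms with second derivatives of φ cancel except the one in d²φ(u, v).
-/
theorem chr_natural {y : E} (hy : y ∈ Ω) (u v : E) :
    fderiv ℝ φ y (chr b y u v) =
      chr b' (φ y) (fderiv ℝ φ y u) (fderiv ℝ φ y v) + fderiv ℝ (fderiv ℝ φ) y u v := by
  apply h.right.ext_form (h.maps hy)
  intro w'
  obtain ⟨w, rfl⟩ := (h.inv y hy).surjective w'
  have hs := second_symm h.left.isOpen h.smooth hy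
  rw [← h.compat y hy, h.left.chr_spec hy, map_add, ContinuousLinearMap.add_apply,
    h.right.chr_spec (h.maps hy), h.fderiv_metric hy, h.fderiv_metric hy, h.fderiv_metric hy,
    hs v u, hs w u, hs w v, h.right.symm _ (h.maps hy) _ (fderiv ℝ φ y v),
    h.right.symm _ (h.maps hy) (fderiv ℝ φ y u) (fderiv ℝ (fderiv ℝ φ) y v w)]
  ring

end IsometryOn

end RicciNatural

/-! ### Naturality of the Ricci form. -/

section RicciNatural

variable {E : Type*} [NormedAddCommGroup E] [NormedSpace ℝ E] [FiniteDimensional ℝ E]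

namespace IsometryOn

variable {b b' : E → Bil E} {φ : E → E} {Ω Ω' : Set E} (h : IsometryOn b b' φ Ω Ω')
include h

theorem fderiv_chr_natural {y : E} (hy : y ∈ Ω) (z u v : E) :
    fderiv ℝ φ y (fderiv ℝ (chr b) y z u v) =
      fderiv ℝ (chr b') (φ y) (fderiv ℝ φ y z) (fderiv ℝ φ y u) (fderiv ℝ φ y v)
      + chr b' (φ y) (fderiv ℝ (fderiv ℝ φ) y z u) (fderiv ℝ φ y v)
      + chr b' (φ y) (fderiv ℝ φ y u) (fderiv ℝ (fderiv ℝ φ) y z v)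
      + fderiv ℝ (fderiv ℝ (fderiv ℝ φ)) y z u v
      - fderiv ℝ (fderiv ℝ φ) y z (chr b y u v) := by
  have hd := h.fderiv_differentiableAt hy
  have hd2 : DifferentiableAt ℝ (fderiv ℝ (fderiv ℝ φ)) y :=
    differentiableAt_of_contDiffOn h.left.isOpen (contDiffOn_fderiv h.left.isOpen
      (contDiffOn_fderiv h.left.isOpen h.smooth)) hy
  have hc := h.left.chr_differentiableAt hy
  have hc' := h.right.chr_differentiableAt (h.maps hy)
  have h1 : (fun x => fderiv ℝ φ x (chr b x u v)) =ᶠ[𝓝 y] fun x =>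
      (chr b' (φ x)) (fderiv ℝ φ x u) (fderiv ℝ φ x v) + fderiv ℝ (fderiv ℝ φ) x u v := by
    filter_upwards [h.left.isOpen.mem_nhds hy] with x hx using h.chr_natural hx u v
  have h2 := congrArg (fun f : E →L[ℝ] E => f z) h1.fderiv_eq
  have hcuv : DifferentiableAt ℝ (fun x => chr b x u v) y :=
    (hc.clm_apply (differentiableAt_const u)).clm_apply (differentiableAt_const v)
  have hcomp : DifferentiableAt ℝ (fun x => chr b' (φ x)) y := hc'.comp y (h.differentiableAt hy)
  have hu : DifferentiableAt ℝ (fun x => fderiv ℝ φ x u) y :=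
    hd.clm_apply (differentiableAt_const u)
  have hv : DifferentiableAt ℝ (fun x => fderiv ℝ φ x v) y :=
    hd.clm_apply (differentiableAt_const v)
  have h3 : DifferentiableAt ℝ (fun x => (chr b' (φ x)) (fderiv ℝ φ x u) (fderiv ℝ φ x v)) y :=
    (hcomp.clm_apply hu).clm_apply hv
  have h4 : DifferentiableAt ℝ (fun x => fderiv ℝ (fderiv ℝ φ) x u v) y :=
    (hd2.clm_apply (differentiableAt_const u)).clm_apply (differentiableAt_const v)
  have e1 : fderiv ℝ (fun x => fderiv ℝ φ x (chr b x u v)) y z =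
      fderiv ℝ (fderiv ℝ φ) y z (chr b y u v) + fderiv ℝ φ y (fderiv ℝ (chr b) y z u v) := by
    rw [fderiv_clm_apply hd hcuv]
    simp only [ContinuousLinearMap.add_apply, ContinuousLinearMap.comp_apply,
      ContinuousLinearMap.flip_apply]
    rw [fderiv_apply_const₂ hc]
    abel
  have e2 : fderiv ℝ (fun x => (chr b' (φ x)) (fderiv ℝ φ x u) (fderiv ℝ φ x v) +
      fderiv ℝ (fderiv ℝ φ) x u v) y z =
      fderiv ℝ (chr b') (φ y) (fderiv ℝ φ y z) (fderiv ℝ φ y u) (fderiv ℝ φ y v)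
      + chr b' (φ y) (fderiv ℝ (fderiv ℝ φ) y z u) (fderiv ℝ φ y v)
      + chr b' (φ y) (fderiv ℝ φ y u) (fderiv ℝ (fderiv ℝ φ) y z v)
      + fderiv ℝ (fderiv ℝ (fderiv ℝ φ)) y z u v := by
    rw [fderiv_fun_add h3 h4, ContinuousLinearMap.add_apply, fderiv_apply_apply hcomp hu hv,
      fderiv_apply_const hd, fderiv_apply_const hd, fderiv_apply_const₂ hd2,
      fderiv_comp' y hc' (h.differentiableAt hy)]
    rfl
  rw [e1, e2] at h2
  rw [← h2]
  abel

/-- The inhomogeneous terms of the transformation law cancel because d²φ and d³φ are symmetric, so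
curvature is a tensor although Γ is not. -/
theorem curvEnd_natural {y : E} (hy : y ∈ Ω) (u v z : E) :
    fderiv ℝ φ y (curvEnd (chr b y) (fderiv ℝ (chr b) y) u v z) =
      curvEnd (chr b' (φ y)) (fderiv ℝ (chr b') (φ y)) (fderiv ℝ φ y u) (fderiv ℝ φ y v)
        (fderiv ℝ φ y z) := by
  have hs := second_symm h.left.isOpen h.smooth hy
  have hs3 := second_symm h.left.isOpen (contDiffOn_fderiv h.left.isOpen h.smooth) hy
  simp only [curvEnd_apply, map_add, map_sub, h.fderiv_chr_natural hy, h.chr_natural hy]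
  rw [hs z u, hs3 z u]
  abel

theorem ric_natural {y : E} (hy : y ∈ Ω) (u v : E) :
    ric b y u v = ric b' (φ y) (fderiv ℝ φ y u) (fderiv ℝ φ y v) :=
  tr_conj (h.inv y hy) fun z => h.curvEnd_natural hy u v z

end IsometryOn

end RicciNatural

/-! ### Divergence of vector fields and its naturality. -/

section Divergence

variable {E : Type*} [NormedAddCommGroup E] [NormedSpace ℝ E] [FiniteDimensional ℝ E]

/-- The covariant derivative `z ↦ ∇_z X` of a vector field. -/
def cov (b : E → Bil E) (X : E → E) (y : E) : E →L[ℝ] E := fderiv ℝ X y + (chr b y).flip (X y)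

theorem cov_apply (b : E → Bil E) (X : E → E) (y z : E) :
    cov b X y z = fderiv ℝ X y z + chr b y z (X y) := by
  simp [cov]

/-- The divergence of a vector field. -/
def divg (b : E → Bil E) (X : E → E) (y : E) : ℝ := tr (cov b X y)

namespace IsometryOn

variable {b b' : E → Bil E} {φ : E → E} {Ω Ω' : Set E} (h : IsometryOn b b' φ Ω Ω')
include h

theorem divg_natural {X X' : E → E} (hX : ContDiffOn ℝ ∞ X Ω) (hX' : ContDiffOn ℝ ∞ X' Ω')
    (hn : ∀ y ∈ Ω, fderiv ℝ φ y (X y) = X' (φ y)) {y : E} (hy : y ∈ Ω) :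
    divg b X y = divg b' X' (φ y) := by
  refine tr_conj (h.inv y hy) fun z => ?_
  have hXd := differentiableAt_of_contDiffOn h.left.isOpen hX hy
  have hXd' := differentiableAt_of_contDiffOn h.right.isOpen hX' (h.maps hy)
  have h1 : (fun x => fderiv ℝ φ x (X x)) =ᶠ[𝓝 y] fun x => X' (φ x) := by
    filter_upwards [h.left.isOpen.mem_nhds hy] with x hx using hn x hx
  have h2 := congrArg (fun f : E →L[ℝ] E => f z) h1.fderiv_eq
  rw [fderiv_clm_apply (h.fderiv_differentiableAt hy) hXd,
    fderiv_comp' y hXd' (h.differentiableAt hy)] at h2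
  simp only [ContinuousLinearMap.add_apply, ContinuousLinearMap.comp_apply,
    ContinuousLinearMap.flip_apply] at h2
  rw [cov_apply, cov_apply, map_add, h.chr_natural hy, ← h2, hn y hy]
  abel

end IsometryOn

end Divergence

/-! ### The metric trace of the variation of Ricci is a divergence. -/

section Variation

variable {E : Type*} [NormedAddCommGroup E] [NormedSpace ℝ E] [FiniteDimensional ℝ E]

/-- The variation of `curvEnd` in the direction of `A`, whose derivative is `D`. -/
def curvVar (Γ A : Bimap E) (D : E →L[ℝ] Bimap E) (u v : E) : E →L[ℝ] E :=
  (D.flip u).flip v - (D u).flip v + A.flip (Γ u v) + Γ.flip (A u v) -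
    (A u) ∘L (Γ.flip v) - (Γ u) ∘L (A.flip v)

theorem curvVar_apply (Γ A : Bimap E) (D : E →L[ℝ] Bimap E) (u v z : E) :
    curvVar Γ A D u v z = D z u v - D u z v + A z (Γ u v) + Γ z (A u v) -
      A u (Γ z v) - Γ u (A z v) := by
  simp [curvVar]

/-- The variation of the Ricci form. -/
def ricVar (Γ A : Bimap E) (D : E →L[ℝ] Bimap E) : Bil E :=
  LinearMap.toContinuousBilinearMap <| LinearMap.mk₂ ℝ (fun u v => tr (curvVar Γ A D u v))
    (fun u u' v => by
      rw [← tr_add]; congr 1; ext z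
      simp only [curvVar_apply, ContinuousLinearMap.add_apply, map_add]; abel)
    (fun c u v => by
      rw [smul_eq_mul, ← tr_smul]; congr 1; ext z
      simp only [curvVar_apply, ContinuousLinearMap.smul_apply, map_smul, smul_sub, smul_add])
    (fun u v v' => by
      rw [← tr_add]; congr 1; ext z
      simp only [curvVar_apply, ContinuousLinearMap.add_apply, map_add]; abel)
    (fun c u v => by
      rw [smul_eq_mul, ← tr_smul]; congr 1; ext z
      simp only [curvVar_apply, ContinuousLinearMap.smul_apply, map_smul, smul_sub, smul_add])

theorem ricVar_apply (Γ A : Bimap E) (D : E →L[ℝ] Bimap E) (u v : E) :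
    ricVar Γ A D u v = tr (curvVar Γ A D u v) := rfl

/-- The vector field whose divergence is the trace of the variation of the Ricci form. -/
def varField (b : E → Bil E) (A : E → Bimap E) (y : E) : E :=
  ∑ i, A y ((b y).inverse (stdForm E i)) (stdVec E i) - (b y).inverse (trL E ∘L A y)

theorem tr_flip_of_symm {Γ : Bimap E} (h : ∀ u v, Γ u v = Γ v u) (v : E) :
    ∑ k, stdForm E k (Γ (stdVec E k) v) = tr (Γ v) := by
  rw [tr_eq_sum]
  exact Finset.sum_congr rfl fun k _ => by rw [h]

theorem MetricOn.varField_contDiffOn {b : E → Bil E} {Ω : Set E} (hb : MetricOn b Ω)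
    {A : E → Bimap E} (hA : ContDiffOn ℝ ∞ A Ω) : ContDiffOn ℝ ∞ (varField b A) Ω := by
  have hS := hb.inverse_contDiffOn
  refine ContDiffOn.sub (ContDiffOn.sum fun i _ => ?_) ?_
  · exact (hA.clm_apply (hS.clm_apply contDiffOn_const)).clm_apply contDiffOn_const
  · exact hS.clm_apply (contDiffOn_const.clm_comp hA)

/-- The Palatini identity: δRic(u, v) is the trace of z ↦ (∇_z A)(u, v) − (∇_u A)(z, v), and tracing
with the parallel tensor b⁻¹ commutes with ∇, which leaves the divergence of `varField`. The
covariant derivatives are written out in Christoffel symbols. -/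
theorem MetricOn.sum_ricVar {b : E → Bil E} {Ω : Set E} (hb : MetricOn b Ω) {A : E → Bimap E}
    (hA : ContDiffOn ℝ ∞ A Ω) (hs : ∀ y ∈ Ω, ∀ u v, A y u v = A y v u) {y : E} (hy : y ∈ Ω) :
    ∑ i, ricVar (chr b y) (A y) (fderiv ℝ A y) (stdVec E i) ((b y).inverse (stdForm E i)) =
      divg b (varField b A) y := by
  have hAd := differentiableAt_of_contDiffOn hb.isOpen hA hy
  have hSd := hb.inverse_differentiableAt hy
  have hΓ := hb.chr_symm hy
  have hDs : ∀ z u v, fderiv ℝ A y z u v = fderiv ℝ A y z v u := by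
    intro z u v
    rw [← fderiv_apply_const₂ hAd, ← fderiv_apply_const₂ hAd]
    congr 1
    apply Filter.EventuallyEq.fderiv_eq
    filter_upwards [hb.isOpen.mem_nhds hy] with x hx using hs x hx u v
  have hsym := inverse_symm (hb.inv y hy) (hb.symm y hy)
  -- The derivative of b⁻¹ is replaced by Christoffel terms; `sum_contract_comp` (as `h4`) then
  -- moves one Γ_z from the covector to the basis vector.
  have hD : ∀ z, fderiv ℝ (varField b A) y z =
      (∑ i, (fderiv ℝ A y z ((b y).inverse (stdForm E i)) (stdVec E i)
        - A y ((b y).inverse (stdForm E i)) (chr b y z (stdVec E i))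
        - A y (chr b y z ((b y).inverse (stdForm E i))) (stdVec E i)))
      + (b y).inverse ((trL E ∘L A y) ∘L chr b y z)
      + chr b y z ((b y).inverse (trL E ∘L A y))
      - (b y).inverse (trL E ∘L fderiv ℝ A y z) := by
    intro z
    have hSi : ∀ i, DifferentiableAt ℝ (fun x => (b x).inverse (stdForm E i)) y := fun i =>
      hSd.clm_apply (differentiableAt_const _)
    have h1 : ∀ i, DifferentiableAt ℝ
        (fun x => A x ((b x).inverse (stdForm E i)) (stdVec E i)) y := fun i =>
      (hAd.clm_apply (hSi i)).clm_apply (differentiableAt_const _)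
    have h2 : DifferentiableAt ℝ (fun x => trL E ∘L A x) y :=
      (differentiableAt_const _).clm_comp hAd
    have h2' : fderiv ℝ (fun x => trL E ∘L A x) y z = trL E ∘L fderiv ℝ A y z := by
      rw [fderiv_clm_comp (differentiableAt_const _) hAd]
      ext w
      simp
    have h3 : DifferentiableAt ℝ (fun x => (b x).inverse (trL E ∘L A x)) y := hSd.clm_apply h2
    have h4 := sum_contract_comp (A y ∘L (b y).inverse) (chr b y z)
    simp only [ContinuousLinearMap.comp_apply] at h4
    unfold varField
    rw [fderiv_fun_sub (DifferentiableAt.fun_sum fun i _ => h1 i) h3,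
      fderiv_fun_sum fun i _ => h1 i, ContinuousLinearMap.sub_apply, ContinuousLinearMap.sum_apply,
      fderiv_clm_apply hSd h2]
    simp only [ContinuousLinearMap.add_apply, ContinuousLinearMap.comp_apply,
      ContinuousLinearMap.flip_apply, h2']
    have h5 : ∀ i, fderiv ℝ (fun x => A x ((b x).inverse (stdForm E i)) (stdVec E i)) y z =
        fderiv ℝ A y z ((b y).inverse (stdForm E i)) (stdVec E i)
        - A y ((b y).inverse (stdForm E i ∘L chr b y z)) (stdVec E i)
        - A y (chr b y z ((b y).inverse (stdForm E i))) (stdVec E i) := by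
      intro i
      rw [fderiv_apply_apply hAd (hSi i) (differentiableAt_const _), fderiv_apply_const hSd,
        hb.fderiv_inverse_eq_chr hy]
      simp only [fderiv_fun_const, Pi.zero_apply, ContinuousLinearMap.zero_apply, map_zero, map_sub,
        map_neg, ContinuousLinearMap.sub_apply, ContinuousLinearMap.neg_apply]
      abel
    simp_rw [h5]
    rw [Finset.sum_sub_distrib, Finset.sum_sub_distrib, h4, hb.fderiv_inverse_eq_chr hy,
      Finset.sum_sub_distrib, Finset.sum_sub_distrib]
    abel
  set S := (b y).inverse with hS
  set Γ := chr b y with hΓdef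
  have hdiv : divg b (varField b A) y =
      ∑ k, ∑ i, (stdForm E k (fderiv ℝ A y (stdVec E k) (S (stdForm E i)) (stdVec E i))
        - stdForm E k (A y (S (stdForm E i)) (Γ (stdVec E k) (stdVec E i)))
        - stdForm E k (A y (Γ (stdVec E k) (S (stdForm E i))) (stdVec E i)))
      + ∑ k, tr (A y (Γ (stdVec E k) (S (stdForm E k))))
      - ∑ k, tr (fderiv ℝ A y (stdVec E k) (S (stdForm E k)))
      + ∑ i, tr (Γ (A y (S (stdForm E i)) (stdVec E i))) := by
    rw [divg, tr_eq_sum]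
    simp only [cov_apply, hD, map_add, map_sub, map_sum]
    rw [Finset.sum_add_distrib, Finset.sum_sub_distrib, Finset.sum_add_distrib,
      Finset.sum_add_distrib]
    have e1 : ∀ k, stdForm E k (S ((trL E ∘L A y) ∘L Γ (stdVec E k))) =
        tr (A y (Γ (stdVec E k) (S (stdForm E k)))) := fun k => by rw [hsym]; rfl
    have e2 : ∀ k, stdForm E k (S (trL E ∘L fderiv ℝ A y (stdVec E k))) =
        tr (fderiv ℝ A y (stdVec E k) (S (stdForm E k))) := fun k => by rw [hsym]; rfl
    simp_rw [e1, e2]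
    have e3 := tr_flip_of_symm hΓ (varField b A y)
    have e4 := tr_flip_of_symm hΓ (S (trL E ∘L A y))
    rw [e4, e3]
    have e5 : tr (Γ (varField b A y)) = ∑ i, tr (Γ (A y (S (stdForm E i)) (stdVec E i)))
        - tr (Γ (S (trL E ∘L A y))) := by
      have : ∀ w, tr (Γ w) = (trL E ∘L Γ) w := fun w => rfl
      have h6 : varField b A y = ∑ i, A y (S (stdForm E i)) (stdVec E i) - S (trL E ∘L A y) := rfl
      rw [this (varField b A y), h6, map_sub, map_sum]
      rfl
    rw [e5]
    ring
  -- Each of `p1` to `p6` matches one of the six terms of `curvVar` with a term of `hdiv`, using the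
  -- symmetry of Γ, A and DA.
  have p1 : ∑ i, ∑ k, stdForm E k (fderiv ℝ A y (stdVec E k) (stdVec E i) (S (stdForm E i))) =
      ∑ k, ∑ i, stdForm E k (fderiv ℝ A y (stdVec E k) (S (stdForm E i)) (stdVec E i)) := by
    rw [Finset.sum_comm]
    exact Finset.sum_congr rfl fun k _ => Finset.sum_congr rfl fun i _ => by rw [hDs]
  have p2 : ∑ i, ∑ k, stdForm E k (fderiv ℝ A y (stdVec E i) (stdVec E k) (S (stdForm E i))) =
      ∑ k, tr (fderiv ℝ A y (stdVec E k) (S (stdForm E k))) :=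
    Finset.sum_congr rfl fun i _ => tr_flip_of_symm (hDs _) _
  have p3 : ∑ i, ∑ k, stdForm E k (A y (stdVec E k) (Γ (stdVec E i) (S (stdForm E i)))) =
      ∑ k, tr (A y (Γ (stdVec E k) (S (stdForm E k)))) :=
    Finset.sum_congr rfl fun i _ => tr_flip_of_symm (hs y hy) _
  have p4 : ∑ i, ∑ k, stdForm E k (Γ (stdVec E k) (A y (stdVec E i) (S (stdForm E i)))) =
      ∑ i, tr (Γ (A y (S (stdForm E i)) (stdVec E i))) :=
    Finset.sum_congr rfl fun i _ => by rw [tr_flip_of_symm hΓ, hs y hy]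
  have p5 : ∑ i, ∑ k, stdForm E k (A y (stdVec E i) (Γ (stdVec E k) (S (stdForm E i)))) =
      ∑ k, ∑ i, stdForm E k (A y (Γ (stdVec E k) (S (stdForm E i))) (stdVec E i)) := by
    rw [Finset.sum_comm]
    exact Finset.sum_congr rfl fun k _ => Finset.sum_congr rfl fun i _ => by rw [hs y hy]
  have p6 : ∑ i, ∑ k, stdForm E k (Γ (stdVec E i) (A y (stdVec E k) (S (stdForm E i)))) =
      ∑ k, ∑ i, stdForm E k (A y (S (stdForm E i)) (Γ (stdVec E k) (stdVec E i))) := by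
    have e1 : ∀ i, ∑ k, stdForm E k (Γ (stdVec E i) (A y (stdVec E k) (S (stdForm E i)))) =
        tr (A y (S (stdForm E i)) ∘L Γ (stdVec E i)) := fun i => by
      rw [tr_comp_comm, tr_eq_sum]
      exact Finset.sum_congr rfl fun k _ => by rw [hs y hy]; rfl
    rw [Finset.sum_comm (f := fun k i =>
      stdForm E k (A y (S (stdForm E i)) (Γ (stdVec E k) (stdVec E i))))]
    refine Finset.sum_congr rfl fun i _ => ?_
    rw [e1, tr_eq_sum]
    exact Finset.sum_congr rfl fun k _ => by rw [hΓ]; rfl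
  rw [hdiv]
  simp only [ricVar_apply, tr_eq_sum (curvVar _ _ _ _ _), curvVar_apply, map_add, map_sub,
    Finset.sum_add_distrib, Finset.sum_sub_distrib]
  rw [p1, p2, p3, p4, p5, p6]
  ring

end Variation

/-! ### One-parameter families of metrics and the first variation of scalar curvature. -/

section Families

variable {E : Type*} [NormedAddCommGroup E] [NormedSpace ℝ E] [FiniteDimensional ℝ E]
  {Y : Type*} [NormedAddCommGroup Y] [NormedSpace ℝ Y]

theorem fderiv_slice {F : ℝ × E → Y} {t : ℝ} {y : E} (hF : DifferentiableAt ℝ F (t, y)) (z : E) :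
    fderiv ℝ (fun x => F (t, x)) y z = fderiv ℝ F (t, y) (0, z) := by
  have h1 : HasFDerivAt (fun x : E => (t, x)) (ContinuousLinearMap.inr ℝ ℝ E) y :=
    hasFDerivAt_prodMk_right t y
  have h := (HasFDerivAt.comp y hF.hasFDerivAt h1).fderiv
  have h2 := congrArg (fun f : E →L[ℝ] Y => f z) h
  exact h2

theorem hasDerivAt_slice {F : ℝ × E → Y} {t : ℝ} {y : E} (hF : DifferentiableAt ℝ F (t, y)) :
    HasDerivAt (fun s => F (s, y)) (fderiv ℝ F (t, y) (1, 0)) t := by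
  have h1 : HasFDerivAt (fun s : ℝ => (s, y)) (ContinuousLinearMap.inl ℝ ℝ E) t :=
    hasFDerivAt_prodMk_left t y
  exact (HasFDerivAt.comp t hF.hasFDerivAt h1).hasDerivAt

/-- The time derivative and the space derivative commute, by symmetry of the second derivative on `ℝ
× E`. -/
theorem hasDerivAt_fderiv_slice {F : ℝ × E → Y} {Ω : Set E} (hΩ : IsOpen Ω)
    (hF : ContDiffOn ℝ ∞ F (Set.univ ×ˢ Ω)) (t : ℝ) {y : E} (hy : y ∈ Ω) :
    HasDerivAt (fun s => fderiv ℝ (fun x => F (s, x)) y)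
      (fderiv ℝ (fun x => fderiv ℝ F (t, x) (1, 0)) y) t := by
  have ho : IsOpen (Set.univ ×ˢ Ω : Set (ℝ × E)) := isOpen_univ.prod hΩ
  have hm : ∀ s, (s, y) ∈ (Set.univ ×ˢ Ω : Set (ℝ × E)) := fun s => ⟨trivial, hy⟩
  have hd : ∀ s, DifferentiableAt ℝ F (s, y) := fun s => differentiableAt_of_contDiffOn ho hF (hm s)
  have hd2 : DifferentiableAt ℝ (fderiv ℝ F) (t, y) :=
    differentiableAt_of_contDiffOn ho (contDiffOn_fderiv ho hF) (hm t)
  have h1 : (fun s => fderiv ℝ (fun x => F (s, x)) y) =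
      fun s => fderiv ℝ F (s, y) ∘L ContinuousLinearMap.inr ℝ ℝ E := by
    funext s
    ext z
    rw [fderiv_slice (hd s)]
    rfl
  have h2 : fderiv ℝ (fun x => fderiv ℝ F (t, x) (1, 0)) y =
      (fderiv ℝ (fderiv ℝ F) (t, y) (1, 0)) ∘L ContinuousLinearMap.inr ℝ ℝ E := by
    ext z
    have h3 : DifferentiableAt ℝ (fun p => fderiv ℝ F p (1, 0)) (t, y) :=
      hd2.clm_apply (differentiableAt_const _)
    rw [fderiv_slice (F := fun p => fderiv ℝ F p (1, 0)) h3]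
    have h4 := congrArg (fun f => f (0, z)) (fderiv_clm_apply hd2
      (differentiableAt_const ((1 : ℝ), (0 : E))))
    simp only [fderiv_fun_const, Pi.zero_apply, ContinuousLinearMap.comp_zero, zero_add,
      ContinuousLinearMap.flip_apply] at h4
    rw [h4, second_symm ho hF (hm t)]
    rfl
  rw [h1, h2]
  have h5 := (ContinuousLinearMap.compL ℝ E (ℝ × E) Y).flip (ContinuousLinearMap.inr ℝ ℝ E)
    |>.hasFDerivAt (x := fderiv ℝ F (t, y)) |>.comp_hasDerivAt t (hasDerivAt_slice hd2)
  exact h5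

/-- A smooth one-parameter family of metrics on the open set `Ω`. -/
structure MetricFamily (b : ℝ → E → Bil E) (Ω : Set E) : Prop where
  metric : ∀ t, MetricOn (b t) Ω
  smooth : ContDiffOn ℝ ∞ (fun p : ℝ × E => b p.1 p.2) (Set.univ ×ˢ Ω)

/-- The variation of the Christoffel symbols at time zero. -/
def chrVar (b : ℝ → E → Bil E) (y : E) : Bimap E :=
  fderiv ℝ (fun p : ℝ × E => chr (b p.1) p.2) (0, y) (1, 0)

namespace MetricFamily

variable {b : ℝ → E → Bil E} {Ω : Set E} (hb : MetricFamily b Ω)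
include hb

theorem isOpen : IsOpen Ω := (hb.metric 0).isOpen

theorem isOpen_prod : IsOpen (Set.univ ×ˢ Ω : Set (ℝ × E)) := isOpen_univ.prod hb.isOpen

theorem chr_contDiffOn :
    ContDiffOn ℝ ∞ (fun p : ℝ × E => chr (b p.1) p.2) (Set.univ ×ˢ Ω) := by
  have h1 : ContDiffOn ℝ ∞ (fun p : ℝ × E => chrOf (b p.1 p.2)
      (fderiv ℝ (fun p : ℝ × E => b p.1 p.2) p ∘L ContinuousLinearMap.inr ℝ ℝ E))
      (Set.univ ×ˢ Ω) :=
    ContDiffOn.chrOf hb.smooth ((contDiffOn_fderiv hb.isOpen_prod hb.smooth).clm_comp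
      contDiffOn_const) fun p hp => (hb.metric p.1).inv p.2 hp.2
  refine h1.congr fun p hp => ?_
  rw [chr]
  congr 1
  ext1 z
  exact fderiv_slice (F := fun p : ℝ × E => b p.1 p.2)
    (differentiableAt_of_contDiffOn hb.isOpen_prod hb.smooth hp) z

theorem hasDerivAt_chr {y : E} (hy : y ∈ Ω) :
    HasDerivAt (fun t => chr (b t) y) (chrVar b y) 0 :=
  hasDerivAt_slice (F := fun p : ℝ × E => chr (b p.1) p.2)
    (differentiableAt_of_contDiffOn hb.isOpen_prod hb.chr_contDiffOn ⟨trivial, hy⟩)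

theorem hasDerivAt_fderiv_chr {y : E} (hy : y ∈ Ω) :
    HasDerivAt (fun t => fderiv ℝ (chr (b t)) y) (fderiv ℝ (chrVar b) y) 0 :=
  hasDerivAt_fderiv_slice hb.isOpen hb.chr_contDiffOn 0 hy

theorem chrVar_contDiffOn : ContDiffOn ℝ ∞ (chrVar b) Ω := by
  have h := (contDiffOn_fderiv hb.isOpen_prod hb.chr_contDiffOn).clm_apply
    (contDiffOn_const (c := ((1 : ℝ), (0 : E))))
  exact h.comp (contDiff_prodMk_right (0 : ℝ)).contDiffOn fun y hy => ⟨trivial, hy⟩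

theorem chrVar_apply {y : E} (hy : y ∈ Ω) (u v : E) :
    HasDerivAt (fun t => chr (b t) y u v) (chrVar b y u v) 0 := by
  have h := ((hb.hasDerivAt_chr hy).clm_apply (hasDerivAt_const 0 u)).clm_apply
    (hasDerivAt_const 0 v)
  simpa using h

theorem chrVar_symm {y : E} (hy : y ∈ Ω) (u v : E) : chrVar b y u v = chrVar b y v u := by
  have h := hb.chrVar_apply hy u v
  simp_rw [(hb.metric _).chr_symm hy u v] at h
  exact h.unique (hb.chrVar_apply hy v u)

theorem hasDerivAt_ric {y : E} (hy : y ∈ Ω) (u v : E) :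
    HasDerivAt (fun t => ric (b t) y u v)
      (ricVar (chr (b 0) y) (chrVar b y) (fderiv ℝ (chrVar b) y) u v) 0 := by
  have hD : ∀ z u v, HasDerivAt (fun t => fderiv ℝ (chr (b t)) y z u v)
      (fderiv ℝ (chrVar b) y z u v) 0 := fun z u v => by
    simpa using (((hb.hasDerivAt_fderiv_chr hy).clm_apply (hasDerivAt_const 0 z)).clm_apply
      (hasDerivAt_const 0 u)).clm_apply (hasDerivAt_const 0 v)
  have hΓ : ∀ z u v, HasDerivAt (fun t => chr (b t) y z (chr (b t) y u v))
      (chrVar b y z (chr (b 0) y u v) + chr (b 0) y z (chrVar b y u v)) 0 := fun z u v => by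
    simpa using ((hb.hasDerivAt_chr hy).clm_apply (hasDerivAt_const 0 z)).clm_apply
      (hb.chrVar_apply hy u v)
  simp only [ric, ricOf_apply, ricVar_apply, tr_eq_sum, curvEnd_apply, curvVar_apply]
  refine HasDerivAt.fun_sum fun i _ => (stdForm E i).hasFDerivAt.comp_hasDerivAt 0 ?_
  have h := (((hD (stdVec E i) u v).sub (hD u (stdVec E i) v)).add (hΓ (stdVec E i) u v)).sub
    (hΓ u (stdVec E i) v)
  refine HasDerivAt.congr_deriv h ?_
  abel

/-- The variation of a connection is a tensor: the term d²φ in the transformation law does not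
depend on time and disappears on differentiation. The remaining operations in `varField` are
contractions with the metric. -/
theorem varField_natural {b' : ℝ → E → Bil E} {Ω' : Set E} (hb' : MetricFamily b' Ω') {φ : E → E}
    (h : ∀ t, IsometryOn (b t) (b' t) φ Ω Ω') {y : E} (hy : y ∈ Ω) :
    fderiv ℝ φ y (varField (b 0) (chrVar b) y) = varField (b' 0) (chrVar b') (φ y) := by
  have hy' := (h 0).maps hy
  set L := fderiv ℝ φ y with hL
  have hLi : L.IsInvertible := (h 0).inv y hy
  have hA : ∀ u v, L (chrVar b y u v) = chrVar b' (φ y) (L u) (L v) := by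
    intro u v
    have h1 := L.hasFDerivAt.comp_hasDerivAt 0 (hb.chrVar_apply hy u v)
    have h2 := (hb'.chrVar_apply hy' (L u) (L v)).add_const (fderiv ℝ (fderiv ℝ φ) y u v)
    refine h1.unique (h2.congr_of_eventuallyEq (Filter.Eventually.of_forall fun t => ?_))
    exact (h t).chr_natural hy u v
  have hS := inverse_natural hLi ((h 0).left.inv y hy) ((h 0).right.inv _ hy') ((h 0).compat y hy)
  have hS' : ∀ l : E →L[ℝ] ℝ, L ((b 0 y).inverse l) = (b' 0 (φ y)).inverse (l ∘L L.inverse) := by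
    intro l
    rw [← hS, ContinuousLinearMap.comp_assoc, hLi.inverse_comp_self]
    rfl
  have hα : trL E ∘L chrVar b y = (trL E ∘L chrVar b' (φ y)) ∘L L := by
    ext u
    exact tr_conj hLi fun z => hA u z
  have hc := sum_contract_comp (((ContinuousLinearMap.compL ℝ E E E).flip L) ∘L
    (chrVar b' (φ y) ∘L (b' 0 (φ y)).inverse)) L.inverse
  simp only [ContinuousLinearMap.comp_apply, ContinuousLinearMap.flip_apply,
    ContinuousLinearMap.compL_apply, hLi.self_apply_inverse] at hc
  simp only [varField, map_sub, map_sum, hA, hS', hc]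
  rw [hα, ContinuousLinearMap.comp_assoc, hLi.self_comp_inverse]
  rfl

end MetricFamily

theorem pairB_eq_sum {b : Bil E} (hb : b.IsInvertible) (hs : ∀ u v, b u v = b v u) {H : Bil E}
    (hH : ∀ u v, H u v = H v u) (β : Bil E) :
    pairB b H β = ∑ i, β (stdVec E i) (b.inverse (H (b.inverse (stdForm E i)))) := by
  rw [pairB, trB_eq_sum hb hs]
  refine Finset.sum_congr rfl fun i _ => ?_
  simp only [ContinuousLinearMap.comp_apply]
  rw [hH, inverse_symm hb hs]

theorem hasDerivAt_trB {b β : ℝ → Bil E} {H β' : Bil E} (hs : ∀ t u v, b t u v = b t v u)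
    (hi : ∀ t, (b t).IsInvertible) (hb : HasDerivAt b H 0)
    (hβ : ∀ u v, HasDerivAt (fun t => β t u v) (β' u v) 0) :
    HasDerivAt (fun t => trB (b t) (β t)) (- pairB (b 0) H (β 0) + trB (b 0) β') 0 := by
  have hH : ∀ u v, H u v = H v u := by
    intro u v
    have h : ∀ u v, HasDerivAt (fun t => b t u v) (H u v) 0 := fun u v => by
      simpa using (hb.clm_apply (hasDerivAt_const 0 u)).clm_apply (hasDerivAt_const 0 v)
    have h1 := h u v
    simp_rw [hs _ u v] at h1
    exact h1.unique (h v u)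
  have hS : HasDerivAt (fun t => (b t).inverse) (-((b 0).inverse ∘L H ∘L (b 0).inverse)) 0 := by
    have hd : DifferentiableAt ℝ (fun t => (b t).inverse) 0 :=
      ((contDiffAt_inverse_of_isInvertible (hi 0)).differentiableAt (by simp)).comp
        (0 : ℝ) hb.differentiableAt
    set S' := deriv (fun t => (b t).inverse) 0 with hS'
    have h1 := hb.clm_comp hd.hasDerivAt
    have h2 : (fun t => b t ∘L (b t).inverse) = fun _ => ContinuousLinearMap.id ℝ _ := by
      funext t
      exact (hi t).self_comp_inverse
    rw [h2] at h1
    have h3 := h1.unique (hasDerivAt_const (0 : ℝ) _)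
    have h4 : S' = -((b 0).inverse ∘L H ∘L (b 0).inverse) := by
      ext1 l
      have h5 := congrArg (fun f : (E →L[ℝ] ℝ) →L[ℝ] (E →L[ℝ] ℝ) => (b 0).inverse (f l)) h3
      simp only [ContinuousLinearMap.add_apply, ContinuousLinearMap.comp_apply, map_add,
        ContinuousLinearMap.zero_apply, map_zero] at h5
      have h6 := (hi 0).inverse_apply_self (S' l)
      rw [← hS', h6] at h5
      exact eq_neg_of_add_eq_zero_right h5
    rw [← h4]
    exact hd.hasDerivAt
  -- Expanding in the basis turns the trace into a sum of products of scalar entries, so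
  -- differentiability of β entry by entry is enough.
  have he : ∀ (S : (E →L[ℝ] ℝ) →L[ℝ] E) (γ : Bil E), ∑ i, γ (stdVec E i) (S (stdForm E i)) =
      ∑ i, ∑ j, stdForm E j (S (stdForm E i)) * γ (stdVec E i) (stdVec E j) := by
    intro S γ
    refine Finset.sum_congr rfl fun i _ => ?_
    conv_lhs => rw [← sum_coord_smul (S (stdForm E i))]
    simp only [map_sum, map_smul, smul_eq_mul]
  rw [pairB_eq_sum (hi 0) (hs 0) hH]
  simp_rw [fun t => trB_eq_sum (hi t) (hs t)]
  have e1 := he (-((b 0).inverse ∘L H ∘L (b 0).inverse)) (β 0)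
  simp only [ContinuousLinearMap.neg_apply, ContinuousLinearMap.comp_apply, map_neg] at e1
  rw [← Finset.sum_neg_distrib, e1, he]
  simp_rw [he]
  rw [← Finset.sum_add_distrib]
  simp_rw [← Finset.sum_add_distrib]
  refine HasDerivAt.fun_sum fun i _ => HasDerivAt.fun_sum fun j _ => ?_
  have h1 : HasDerivAt (fun t => stdForm E j ((b t).inverse (stdForm E i)))
      (stdForm E j (-((b 0).inverse (H ((b 0).inverse (stdForm E i)))))) 0 :=
    (stdForm E j).hasFDerivAt.comp_hasDerivAt 0
      (by simpa using hS.clm_apply (hasDerivAt_const 0 (stdForm E i)))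
  have h2 := h1.mul (hβ (stdVec E i) (stdVec E j))
  rw [map_neg] at h2
  exact h2

theorem MetricFamily.hasDerivAt_scal {b : ℝ → E → Bil E} {Ω : Set E} (hb : MetricFamily b Ω)
    {y : E} (hy : y ∈ Ω) {H : Bil E} (hH : HasDerivAt (fun t => b t y) H 0) :
    HasDerivAt (fun t => trB (b t y) (ric (b t) y))
      (- pairB (b 0 y) H (ric (b 0) y) + divg (b 0) (varField (b 0) (chrVar b)) y) 0 := by
  have h := hasDerivAt_trB (fun t => (hb.metric t).symm y hy) (fun t => (hb.metric t).inv y hy) hH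
    (fun u v => hb.hasDerivAt_ric hy u v)
  rw [trB_eq_sum ((hb.metric 0).inv y hy) ((hb.metric 0).symm y hy) (ricVar _ _ _),
    (hb.metric 0).sum_ricVar hb.chrVar_contDiffOn (fun x hx => hb.chrVar_symm hx) hy] at h
  exact h

end Families

/-! ### Gram determinants of vector fields that commute with a given field. -/

section KillingFields

/-- Jacobi's formula. The product rule in the Leibniz expansion differentiates one column at a time,
and Cramer's rule identifies the resulting determinants with the diagonal of adj(M) M'. -/
theorem hasDerivAt_det {ι : Type*} [Fintype ι] [DecidableEq ι] {M : ℝ → Matrix ι ι ℝ}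
    {M' : Matrix ι ι ℝ} {t : ℝ} (h : ∀ i j, HasDerivAt (fun s => M s i j) (M' i j) t) :
    HasDerivAt (fun s => (M s).det) (((M t).adjugate * M').trace) t := by
  have h1 : HasDerivAt (fun s => ∑ σ : Equiv.Perm ι, (Equiv.Perm.sign σ : ℝ) * ∏ i, M s (σ i) i)
      (∑ σ : Equiv.Perm ι, (Equiv.Perm.sign σ : ℝ) *
        ∑ i, (∏ j ∈ Finset.univ.erase i, M t (σ j) j) • M' (σ i) i) t :=
    HasDerivAt.fun_sum fun σ _ => (HasDerivAt.fun_finset_prod fun i _ => h (σ i) i).const_mul _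
  simp_rw [Matrix.det_apply']
  refine h1.congr_deriv ?_
  have h2 : ((M t).adjugate * M').trace =
      ∑ i, ((M t).updateCol i (fun k => M' k i)).det := by
    rw [Matrix.trace]
    refine Finset.sum_congr rfl fun i _ => ?_
    rw [← Matrix.cramer_apply, Matrix.cramer_eq_adjugate_mulVec]
    rfl
  rw [h2]
  simp_rw [Matrix.det_apply', Finset.mul_sum]
  rw [Finset.sum_comm]
  refine Finset.sum_congr rfl fun i _ => Finset.sum_congr rfl fun σ _ => ?_
  congr 1
  rw [← Finset.mul_prod_erase Finset.univ _ (Finset.mem_univ i), Matrix.updateCol_self, smul_eq_mul,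
    mul_comm]
  congr 1
  refine Finset.prod_congr rfl fun j hj => ?_
  rw [Matrix.updateCol_ne (Finset.ne_of_mem_erase hj)]

variable {E : Type*} [NormedAddCommGroup E] [NormedSpace ℝ E] [FiniteDimensional ℝ E]

/-- The Gram matrix of a family of vectors. -/
def gram {ι : Type*} (b : Bil E) (v : ι → E) : Matrix ι ι ℝ := Matrix.of fun i j => b (v i) (v j)

theorem linearIndependent_of_gram {ι : Type*} [Fintype ι] [DecidableEq ι] {b : Bil E} {v : ι → E}
    (h : (gram b v).det ≠ 0) : LinearIndependent ℝ v := by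
  rw [Fintype.linearIndependent_iff]
  intro c hc
  have h1 : Matrix.vecMul c (gram b v) = 0 := by
    funext j
    have h2 := congrArg (fun w => b w (v j)) hc
    simp only [map_sum, map_smul, ContinuousLinearMap.sum_apply, ContinuousLinearMap.smul_apply,
      map_zero, ContinuousLinearMap.zero_apply, smul_eq_mul] at h2
    simpa [Matrix.vecMul, dotProduct, gram] using h2
  have h3 := Matrix.eq_zero_of_vecMul_eq_zero h h1
  exact fun i => congrFun h3 i

/-- Since ∇ is torsion free and [X, Kᵢ] = 0, one has ∇_X Kᵢ = ∇_{Kᵢ} X. Differentiating the Gram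
determinant along X therefore gives 2 div X times the determinant, which is zero at a local maximum.
Only the commutation is used, not that the Kᵢ are Killing fields. -/
theorem MetricOn.divg_eq_zero_of_isLocalMax {b : E → Bil E} {Ω : Set E} (hb : MetricOn b Ω)
    {y : E} (hy : y ∈ Ω) {ι : Type*} [Fintype ι] [DecidableEq ι]
    (hι : Fintype.card ι = Module.finrank ℝ E) {X : E → E} {K : ι → E → E}
    (hK : ∀ i, DifferentiableAt ℝ (K i) y)
    (hcomm : ∀ i, fderiv ℝ (K i) y (X y) = fderiv ℝ X y (K i y))
    (hq : (gram (b y) (fun i => K i y)).det ≠ 0)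
    (hmax : IsLocalMax (fun x => (gram (b x) (fun i => K i x)).det) y) : divg b X y = 0 := by
  have hli := linearIndependent_of_gram hq
  set G := gram (b y) (fun i => K i y) with hG
  let B : Module.Basis ι ℝ E := Module.Basis.mk hli
    (hli.span_eq_top_of_card_eq_finrank' hι).ge
  have hB : ∀ i, B i = K i y := fun i => by simp [B]
  -- With N the matrix of ∇X in the frame Kᵢ, the Gram matrix G has derivative NᵀG + GN along X, and
  -- the trace of N is div X.
  set N := LinearMap.toMatrix B B (cov b X y : E →ₗ[ℝ] E) with hN
  have hNtr : N.trace = divg b X y := by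
    rw [divg, tr, LinearMap.trace_eq_matrix_trace ℝ B]
  have hcov : ∀ j, cov b X y (K j y) = ∑ k, N k j • K k y := by
    intro j
    have := B.sum_repr (cov b X y (K j y))
    rw [← this]
    refine Finset.sum_congr rfl fun k _ => ?_
    rw [hB, hN, LinearMap.toMatrix_apply, hB]
    simp
  have hM : ∀ i j, HasDerivAt (fun s : ℝ => gram (b (y + s • X y)) (fun i => K i (y + s • X y)) i j)
      ((N.transpose * G + G * N) i j) 0 := by
    intro i j
    have hd : DifferentiableAt ℝ (fun x => b x (K i x) (K j x)) y :=
      ((hb.differentiableAt hy).clm_apply (hK i)).clm_apply (hK j)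
    have hl : HasDerivAt (fun s : ℝ => y + s • X y) (X y) 0 := by
      simpa using ((hasDerivAt_id (0 : ℝ)).smul_const (X y)).const_add y
    have hd' : HasFDerivAt (fun x => b x (K i x) (K j x))
        (fderiv ℝ (fun x => b x (K i x) (K j x)) y) (y + (0 : ℝ) • X y) := by
      simpa using hd.hasFDerivAt
    refine (hd'.comp_hasDerivAt 0 hl).congr_deriv ?_
    rw [fderiv_apply_apply (hb.differentiableAt hy) (hK i) (hK j), hb.compat hy, hcomm, hcomm]
    have e : ∀ i, chr b y (X y) (K i y) = cov b X y (K i y) - fderiv ℝ X y (K i y) := fun i => by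
      rw [cov_apply, hb.chr_symm hy]
      abel
    rw [e, e, hcov, hcov]
    simp only [map_sub, map_sum, map_smul, ContinuousLinearMap.sub_apply,
      ContinuousLinearMap.sum_apply, ContinuousLinearMap.smul_apply, smul_eq_mul, Matrix.add_apply,
      Matrix.mul_apply, Matrix.transpose_apply, hG, gram, Matrix.of_apply]
    have e2 : ∑ x, N x j * b y (K i y) (K x y) = ∑ x, b y (K i y) (K x y) * N x j :=
      Finset.sum_congr rfl fun _ _ => mul_comm _ _
    rw [e2]
    ring
  have hdet := hasDerivAt_det hM
  have h0 : (0 : ℝ) • X y = 0 := zero_smul _ _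
  have hmax' : IsLocalMax
      (fun s : ℝ => (gram (b (y + s • X y)) (fun i => K i (y + s • X y))).det) 0 := by
    have hc : Filter.Tendsto (fun s : ℝ => y + s • X y) (𝓝 0) (𝓝 y) := by
      have : Continuous fun s : ℝ => y + s • X y := by fun_prop
      simpa using this.tendsto 0
    have := hc.eventually hmax
    simpa [IsLocalMax, IsMaxFilter] using this
  have h1 := hmax'.hasDerivAt_eq_zero hdet
  simp only [h0, add_zero] at h1
  rw [← hG, mul_add, Matrix.trace_add, ← mul_assoc, ← mul_assoc, Matrix.trace_mul_cycle,
    Matrix.mul_adjugate, Matrix.adjugate_mul, smul_mul_assoc, smul_mul_assoc, one_mul, one_mul,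
    Matrix.trace_smul, Matrix.trace_smul, Matrix.trace_transpose, hNtr, ← two_mul, smul_eq_mul] at h1
  have h2 : G.det * divg b X y = 0 := by linarith
  exact (mul_eq_zero.mp h2).resolve_left hq

end KillingFields

/-! ### Maps and tensor fields read in charts. -/

section Charts

variable {n : ℕ} {M : Type*} [TopologicalSpace M] [ChartedSpace (Model n) M]

/-- The derivative of the inverse of the chart around `x`. -/
def dsymm (x : M) (y : Model n) : Model n →L[ℝ] Model n :=
  mfderiv (𝓡 n) (𝓡 n) (extChartAt (𝓡 n) x).symm y

/-- The derivative of a self-map of `M`, as an endomorphism of the model space. -/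
def rawDeriv (f : M → M) (p : M) : Model n →L[ℝ] Model n := mfderiv (𝓡 n) (𝓡 n) f p

/-- The field of bilinear forms `B` in the chart around `x`. -/
def loc (B : TensorField02 (n := n) M) (x : M) (y : Model n) : Bil (Model n) :=
  pull (dsymm x y) (B ((extChartAt (𝓡 n) x).symm y))

/-- The map `f` in the charts around `x` and `x'`. -/
def trans (f : M → M) (x x' : M) (y : Model n) : Model n :=
  extChartAt (𝓡 n) x' (f ((extChartAt (𝓡 n) x).symm y))

/-- The domain of `trans`. -/
def transDom (f : M → M) (x x' : M) : Set (Model n) :=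
  (extChartAt (𝓡 n) x).target ∩ (fun y => f ((extChartAt (𝓡 n) x).symm y)) ⁻¹'
    (extChartAt (𝓡 n) x').source

variable [IsManifold (𝓡 n) ∞ M]

theorem dsymm_invertible (x : M) {y : Model n} (hy : y ∈ (extChartAt (𝓡 n) x).target) :
    (dsymm x y).IsInvertible := by
  have := isInvertible_mfderivWithin_extChartAt_symm (I := 𝓡 n) (x := x) hy
  rw [ModelWithCorners.range_eq_univ, mfderivWithin_univ] at this
  exact this

theorem mdifferentiableAt_symm (x : M) {y : Model n} (hy : y ∈ (extChartAt (𝓡 n) x).target) :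
    MDifferentiableAt (𝓡 n) (𝓡 n) (extChartAt (𝓡 n) x).symm y :=
  ((contMDiffOn_extChartAt_symm (n := ∞) x).contMDiffAt
    ((isOpen_extChartAt_target x).mem_nhds hy)).mdifferentiableAt (by simp)

variable {f : M → M} (hf : ContMDiff (𝓡 n) (𝓡 n) ∞ f)
include hf

theorem isOpen_transDom (x x' : M) : IsOpen (transDom (n := n) f x x') :=
  (hf.continuous.comp_continuousOn (continuousOn_extChartAt_symm x)).isOpen_inter_preimage
    (isOpen_extChartAt_target x) (isOpen_extChartAt_source x')

theorem trans_contDiffOn (x x' : M) :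
    ContDiffOn ℝ ∞ (trans (n := n) f x x') (transDom f x x') := by
  rw [← contMDiffOn_iff_contDiffOn]
  exact (contMDiffOn_extChartAt (n := ∞)).comp
    (hf.comp_contMDiffOn ((contMDiffOn_extChartAt_symm (n := ∞) x).mono Set.inter_subset_left))
    (fun y hy => by simpa [transDom] using hy.2)

theorem dsymm_trans (x x' : M) {y : Model n} (hy : y ∈ transDom f x x') :
    dsymm x' (trans f x x' y) ∘L fderiv ℝ (trans f x x') y =
      rawDeriv f ((extChartAt (𝓡 n) x).symm y) ∘L dsymm x y := by
  have hψ : MDifferentiableAt (𝓡 n) (𝓡 n) (trans (n := n) f x x') y :=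
    (differentiableAt_of_contDiffOn (isOpen_transDom hf x x') (trans_contDiffOn hf x x')
      hy).mdifferentiableAt
  have htar : trans f x x' y ∈ (extChartAt (𝓡 n) x').target :=
    (extChartAt (𝓡 n) x').map_source hy.2
  have h1 := mfderiv_comp y (mdifferentiableAt_symm x' htar) hψ
  have h2 := mfderiv_comp y ((hf.mdifferentiable (by simp)) _) (mdifferentiableAt_symm x hy.1)
  have h3 : (extChartAt (𝓡 n) x').symm ∘ trans f x x' =ᶠ[𝓝 y] f ∘ (extChartAt (𝓡 n) x).symm := by
    filter_upwards [(isOpen_transDom hf x x').mem_nhds hy] with z hz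
    exact (extChartAt (𝓡 n) x').left_inv hz.2
  have h4 := h3.mfderiv_eq (I := 𝓡 n) (I' := 𝓡 n)
  rw [mfderiv_eq_fderiv] at h1
  exact (h1.symm.trans h4).trans h2

end Charts

/-! ### Tensor fields preserved by a map. -/

section ChartsTensor

variable {n : ℕ} {M : Type*} [TopologicalSpace M] [ChartedSpace (Model n) M]
  [IsManifold (𝓡 n) ∞ M]

/-- `f` preserves the field of bilinear forms `B`. -/
def Preserves (f : M → M) (B : TensorField02 (n := n) M) : Prop :=
  ∀ (x : M) (v w : TangentSpace (𝓡 n) x),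
    B (f x) (mfderiv (𝓡 n) (𝓡 n) f x v) (mfderiv (𝓡 n) (𝓡 n) f x w) = B x v w

theorem loc_natural {f : M → M} (hf : ContMDiff (𝓡 n) (𝓡 n) ∞ f) {B : TensorField02 (n := n) M}
    (hB : Preserves f B) (x x' : M) {y : Model n} (hy : y ∈ transDom f x x') (u v : Model n) :
    loc B x y u v = loc B x' (trans f x x' y) (fderiv ℝ (trans f x x') y u)
      (fderiv ℝ (trans f x x') y v) := by
  have h := dsymm_trans hf x x' hy
  have h1 : ∀ u, dsymm x' (trans f x x' y) (fderiv ℝ (trans f x x') y u) =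
      rawDeriv f ((extChartAt (𝓡 n) x).symm y) (dsymm x y u) := fun u =>
    congrArg (fun L : Model n →L[ℝ] Model n => L u) h
  have h2 : (extChartAt (𝓡 n) x').symm (trans f x x' y) = f ((extChartAt (𝓡 n) x).symm y) :=
    (extChartAt (𝓡 n) x').left_inv hy.2
  let B' : M → Bil (Model n) := B
  change B' _ _ _ = B' ((extChartAt (𝓡 n) x').symm (trans f x x' y))
    (dsymm x' (trans f x x' y) (fderiv ℝ (trans f x x') y u))
    (dsymm x' (trans f x x' y) (fderiv ℝ (trans f x x') y v))
  rw [h2, h1, h1]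
  exact (hB _ _ _).symm

/-- With f = id, `trans` is a coordinate change, so statements about symmetries also yield
independence of the chart. -/
theorem preserves_id (B : TensorField02 (n := n) M) : Preserves id B := by
  intro x v w
  simp [mfderiv_id]

end ChartsTensor

/-! ### Smoothness of tensor fields in terms of chart representatives. -/

section SmoothTensor

variable {n : ℕ} {M : Type*} [TopologicalSpace M] [ChartedSpace (Model n) M]
  [IsManifold (𝓡 n) ∞ M]

/-- Identifies the bundle trivialization with the chart representative, so that smoothness of a
section becomes ordinary smoothness of `loc`. -/
theorem trivialization_eq_loc (B : TensorField02 (n := n) M) (x₀ : M) {x : M}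
    (hx : x ∈ (extChartAt (𝓡 n) x₀).source) :
    (trivializationAt (Model n →L[ℝ] Model n →L[ℝ] ℝ)
      (fun x : M => TangentSpace (𝓡 n) x →L[ℝ] TangentSpace (𝓡 n) x →L[ℝ] ℝ) x₀
        ⟨x, B x⟩).2 = loc B x₀ (extChartAt (𝓡 n) x₀ x) := by
  have hx' : x ∈ (chartAt (Model n) x₀).source := by rwa [extChartAt_source] at hx
  have hb : x ∈ (trivializationAt (Model n) (TangentSpace (𝓡 n) (M := M)) x₀).baseSet := by
    simpa using hx'
  ext u v
  have h1 := inCoordinates_apply_eq₂ (𝕜 := ℝ) (F₁ := Model n) (F₂ := Model n) (F₃ := ℝ)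
    (E₁ := TangentSpace (𝓡 n) (M := M)) (E₂ := TangentSpace (𝓡 n) (M := M))
    (E₃ := Bundle.Trivial M ℝ) (ϕ := B x) (v := u) (w := v) hb hb (by simp)
  have h2 : ∀ u, (trivializationAt (Model n) (TangentSpace (𝓡 n) (M := M)) x₀).symm x u =
      dsymm x₀ (extChartAt (𝓡 n) x₀ x) u := by
    intro u
    have h3 := TangentBundle.symmL_trivializationAt (I := 𝓡 n) hx'
    rw [ModelWithCorners.range_eq_univ, mfderivWithin_univ] at h3
    have h4 := congrArg (fun L : Model n →L[ℝ] Model n => L u) h3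
    exact ((trivializationAt (Model n) (TangentSpace (𝓡 n) (M := M)) x₀).symmL_apply
      (R := ℝ) hb u).symm.trans h4
  rw [h2, h2] at h1
  let B' : M → Bil (Model n) := B
  have h4 : loc B x₀ (extChartAt (𝓡 n) x₀ x) u v =
      B' x (dsymm x₀ (extChartAt (𝓡 n) x₀ x) u) (dsymm x₀ (extChartAt (𝓡 n) x₀ x) v) := by
    change B' _ (dsymm x₀ (extChartAt (𝓡 n) x₀ x) u) (dsymm x₀ (extChartAt (𝓡 n) x₀ x) v) = _
    rw [(extChartAt (𝓡 n) x₀).left_inv hx]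
  rw [h4]
  refine h1.trans ?_
  simp
  rfl

theorem IsSmoothTensor.loc_contDiffOn {B : TensorField02 (n := n) M} (hB : IsSmoothTensor B)
    (x₀ : M) : ContDiffOn ℝ ∞ (loc B x₀) (extChartAt (𝓡 n) x₀).target := by
  rw [← contMDiffOn_iff_contDiffOn]
  have h1 : ContMDiffOn (𝓡 n) 𝓘(ℝ, Bil (Model n)) ∞
      (fun x => loc B x₀ (extChartAt (𝓡 n) x₀ x)) (extChartAt (𝓡 n) x₀).source := by
    have h2 := ((trivializationAt (Model n →L[ℝ] Model n →L[ℝ] ℝ)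
      (fun x : M => TangentSpace (𝓡 n) x →L[ℝ] TangentSpace (𝓡 n) x →L[ℝ] ℝ)
      x₀).contMDiffOn_section_iff (IB := 𝓡 n) (n := ∞) (s := B)
      (isOpen_extChartAt_source (I := 𝓡 n) x₀) (by simp)).mp hB.contMDiffOn
    exact h2.congr fun x hx => (trivialization_eq_loc B x₀ hx).symm
  have h3 := h1.comp (contMDiffOn_extChartAt_symm (n := ∞) x₀)
    (fun y hy => (extChartAt (𝓡 n) x₀).map_target hy)
  refine h3.congr fun y hy => ?_
  change loc B x₀ y = loc B x₀ (extChartAt (𝓡 n) x₀ ((extChartAt (𝓡 n) x₀).symm y))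
  rw [(extChartAt (𝓡 n) x₀).right_inv hy]

theorem isSmoothTensor_of_loc {B : TensorField02 (n := n) M}
    (h : ∀ x₀ : M, ContDiffOn ℝ ∞ (loc B x₀) (extChartAt (𝓡 n) x₀).target) : IsSmoothTensor B := by
  intro x₀
  rw [Bundle.contMDiffAt_section]
  have h1 : ContMDiffOn (𝓡 n) 𝓘(ℝ, Bil (Model n)) ∞
      (fun x => loc B x₀ (extChartAt (𝓡 n) x₀ x)) (extChartAt (𝓡 n) x₀).source :=
    (contMDiffOn_iff_contDiffOn.mpr (h x₀)).comp
      (by rw [extChartAt_source]; exact contMDiffOn_extChartAt (n := ∞))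
      (fun x hx => (extChartAt (𝓡 n) x₀).map_source hx)
  have h2 := (isOpen_extChartAt_source (I := 𝓡 n) x₀).mem_nhds (mem_extChartAt_source x₀)
  refine (h1.contMDiffAt h2).congr_of_eventuallyEq ?_
  filter_upwards [h2] with x hx
  exact trivialization_eq_loc B x₀ hx

theorem isSmoothTensor_inner (g : RiemMetric (n := n) M) : IsSmoothTensor g.inner := g.contMDiff

theorem loc_symm {B : TensorField02 (n := n) M}
    (hB : ∀ (x : M) (v w : TangentSpace (𝓡 n) x), B x v w = B x w v) (x : M) (y u v : Model n) :
    loc B x y u v = loc B x y v u :=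
  hB ((extChartAt (𝓡 n) x).symm y) (dsymm x y u) (dsymm x y v)

theorem loc_pos {B : TensorField02 (n := n) M}
    (hB : ∀ (x : M) (v : TangentSpace (𝓡 n) x), v ≠ 0 → 0 < B x v v) (x : M) {y : Model n}
    (hy : y ∈ (extChartAt (𝓡 n) x).target) {u : Model n} (hu : u ≠ 0) : 0 < loc B x y u u := by
  have h : dsymm x y u ≠ 0 := fun h0 =>
    hu ((dsymm_invertible x hy).injective (by rw [map_zero]; exact h0))
  exact hB ((extChartAt (𝓡 n) x).symm y) (dsymm x y u) h

theorem metricOn_loc (g : RiemMetric (n := n) M) (x : M) :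
    MetricOn (loc g.inner x) (extChartAt (𝓡 n) x).target where
  isOpen := isOpen_extChartAt_target x
  smooth := (isSmoothTensor_inner g).loc_contDiffOn x
  symm y _ u v := loc_symm g.symm x y u v
  inv _ hy := isInvertible_of_pos fun _ hv => loc_pos g.pos x hy hv

theorem isometryOn_trans {f : M → M} (hf : ContMDiff (𝓡 n) (𝓡 n) ∞ f)
    {g : RiemMetric (n := n) M} (hg : Preserves f g.inner) (x x' : M) :
    IsometryOn (loc g.inner x) (loc g.inner x') (trans f x x') (transDom f x x')
      (extChartAt (𝓡 n) x').target where
  left :=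
    { isOpen := isOpen_transDom hf x x'
      smooth := (metricOn_loc g x).smooth.mono Set.inter_subset_left
      symm := fun y hy => (metricOn_loc g x).symm y hy.1
      inv := fun y hy => (metricOn_loc g x).inv y hy.1 }
  right := metricOn_loc g x'
  smooth := trans_contDiffOn hf x x'
  maps y hy := (extChartAt (𝓡 n) x').map_source hy.2
  inv y hy := by
    -- `f` is not assumed to be a diffeomorphism: a map preserving a positive definite form has
    -- injective derivative, hence an invertible one in equal dimensions.
    have hinj : Function.Injective (fderiv ℝ (trans f x x') y) := by
      rw [injective_iff_map_eq_zero]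
      intro u hu
      by_contra hne
      have h1 := loc_natural hf hg x x' hy u u
      rw [hu, map_zero] at h1
      exact absurd h1 (ne_of_gt (loc_pos g.pos x hy.1 hne))
    let e := LinearEquiv.ofInjectiveEndo (fderiv ℝ (trans f x x') y : Model n →ₗ[ℝ] Model n) hinj
    exact ⟨e.toContinuousLinearEquiv, by ext; rfl⟩
  compat y hy := loc_natural hf hg x x' hy

end SmoothTensor

/-! ### Agreement of the coordinate formulas with the coordinate-free ones. -/

section Bridge

variable {n : ℕ}

/-- The standard basis vectors of `ℝⁿ`. -/
abbrev eVec (i : Fin n) : Model n := EuclideanSpace.single i (1 : ℝ)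

/-- The coordinate functionals of `ℝⁿ`. -/
abbrev eForm (i : Fin n) : Model n →L[ℝ] ℝ := EuclideanSpace.proj i

theorem eForm_eVec (i j : Fin n) : eForm i (eVec j) = if i = j then 1 else 0 := by
  simp [eVec]

theorem sum_eForm_smul (v : Model n) : ∑ i, eForm i v • eVec i = v := by
  ext j
  simp [eVec, Pi.single_apply]

theorem sum_apply_smul_eForm (l : Model n →L[ℝ] ℝ) : ∑ i, l (eVec i) • eForm i = l := by
  ext v
  conv_rhs => rw [← sum_eForm_smul v]
  simp only [ContinuousLinearMap.sum_apply, ContinuousLinearMap.smul_apply, map_sum, map_smul,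
    smul_eq_mul]
  exact Finset.sum_congr rfl fun i _ => mul_comm _ _

theorem tr_eq_sum_coord (f : Model n →L[ℝ] Model n) : tr f = ∑ i, eForm i (f (eVec i)) := by
  rw [tr_eq_sum_basis (EuclideanSpace.basisFun (Fin n) ℝ).toBasis]
  simp

theorem inverse_gram {b : Bil (Model n)} (hb : b.IsInvertible) (hs : ∀ u v, b u v = b v u) :
    (Matrix.of fun i j => b (eVec i) (eVec j))⁻¹ =
      Matrix.of fun k l => eForm k (b.inverse (eForm l)) := by
  apply Matrix.inv_eq_right_inv
  ext i l
  simp only [Matrix.mul_apply, Matrix.of_apply]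
  have h : b (eVec i) (b.inverse (eForm l)) =
      ∑ k, b (eVec i) (eVec k) * eForm k (b.inverse (eForm l)) := by
    conv_lhs => rw [← sum_eForm_smul (b.inverse (eForm l))]
    simp only [map_sum, map_smul, smul_eq_mul]
    exact Finset.sum_congr rfl fun k _ => mul_comm _ _
  rw [← h, hs, hb.self_apply_inverse, eForm_eVec, Matrix.one_apply]
  simp only [eq_comm]

theorem trB_eq_sum_coord {b : Bil (Model n)} (hb : b.IsInvertible) (hs : ∀ u v, b u v = b v u)
    (β : Bil (Model n)) :
    trB b β = ∑ i, ∑ j, (Matrix.of fun i j => b (eVec i) (eVec j))⁻¹ i j * β (eVec i) (eVec j) := by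
  rw [trB, tr_eq_sum_coord, inverse_gram hb hs]
  refine Finset.sum_congr rfl fun i _ => ?_
  rw [ContinuousLinearMap.comp_apply]
  conv_lhs => rw [← sum_apply_smul_eForm (β (eVec i))]
  simp only [map_sum, map_smul, smul_eq_mul, Matrix.of_apply]
  exact Finset.sum_congr rfl fun k _ => mul_comm _ _

variable {M : Type*} [TopologicalSpace M] [ChartedSpace (Model n) M] [IsManifold (𝓡 n) ∞ M]

theorem metricCoeff_eq (g : RiemMetric (n := n) M) (x : M) (y : Model n) :
    metricCoeff g x y = Matrix.of fun i j => loc g.inner x y (eVec i) (eVec j) := rfl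

theorem partialDeriv_metricCoeff (g : RiemMetric (n := n) M) (x : M) {y : Model n}
    (hy : y ∈ (extChartAt (𝓡 n) x).target) (i j k : Fin n) :
    partialDeriv i (fun z => metricCoeff g x z j k) y =
      fderiv ℝ (loc g.inner x) y (eVec i) (eVec j) (eVec k) :=
  fderiv_apply_const₂ ((metricOn_loc g x).differentiableAt hy) _ _ _

theorem christoffel_eq (g : RiemMetric (n := n) M) (x : M) {y : Model n}
    (hy : y ∈ (extChartAt (𝓡 n) x).target) (k i j : Fin n) :
    christoffel g x k i j y = eForm k (chr (loc g.inner x) y (eVec i) (eVec j)) := by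
  have hb := metricOn_loc g x
  rw [christoffel, chr_apply]
  conv_rhs => rw [← sum_apply_smul_eForm (chrLow (fderiv ℝ (loc g.inner x) y) (eVec i) (eVec j))]
  simp only [partialDeriv_metricCoeff g x hy]
  rw [metricCoeff_eq, inverse_gram (hb.inv y hy) (hb.symm y hy)]
  simp only [map_sum, map_smul, smul_eq_mul, Matrix.of_apply, chrLow_apply]
  rw [Finset.mul_sum]
  exact Finset.sum_congr rfl fun l _ => by ring

theorem partialDeriv_christoffel (g : RiemMetric (n := n) M) (x : M) {y : Model n}
    (hy : y ∈ (extChartAt (𝓡 n) x).target) (m k i j : Fin n) :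
    partialDeriv m (christoffel g x k i j) y =
      eForm k (fderiv ℝ (chr (loc g.inner x)) y (eVec m) (eVec i) (eVec j)) := by
  have hb := metricOn_loc g x
  have h1 : christoffel g x k i j =ᶠ[𝓝 y]
      fun z => eForm k (chr (loc g.inner x) z (eVec i) (eVec j)) := by
    filter_upwards [hb.isOpen.mem_nhds hy] with z hz using christoffel_eq g x hz k i j
  have hd : DifferentiableAt ℝ (fun z => chr (loc g.inner x) z (eVec i) (eVec j)) y :=
    ((hb.chr_differentiableAt hy).clm_apply (differentiableAt_const _)).clm_apply
      (differentiableAt_const _)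
  rw [partialDeriv, h1.fderiv_eq, ← fderiv_apply_const₂ (hb.chr_differentiableAt hy)]
  have h2 := ((eForm k).hasFDerivAt.comp y hd.hasFDerivAt).fderiv
  exact congrArg (fun L : Model n →L[ℝ] ℝ => L (eVec m)) h2

theorem ricciCoeff_eq (g : RiemMetric (n := n) M) (x : M) {y : Model n}
    (hy : y ∈ (extChartAt (𝓡 n) x).target) (i j : Fin n) :
    ricciCoeff g x i j y = ric (loc g.inner x) y (eVec i) (eVec j) := by
  have hb := metricOn_loc g x
  have hmul : ∀ (k : Fin n) (u w : Model n), eForm k (chr (loc g.inner x) y u w) =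
      ∑ l, eForm k (chr (loc g.inner x) y u (eVec l)) * eForm l w := by
    intro k u w
    conv_lhs => rw [← sum_eForm_smul w]
    simp only [map_sum, map_smul, smul_eq_mul]
    exact Finset.sum_congr rfl fun l _ => mul_comm _ _
  -- The term ∂ⱼΓᵏᵢₖ in `ricciCoeff` matches `curvEnd` with `j` in the first slot, so the arguments
  -- of the Ricci form are exchanged first.
  rw [hb.ric_symm hy, ric, ricOf_apply, tr_eq_sum_coord, ricciCoeff]
  simp only [partialDeriv_christoffel g x hy, christoffel_eq g x hy, curvEnd_apply, map_sub, map_add]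
  rw [← Finset.sum_add_distrib]
  refine Finset.sum_congr rfl fun k _ => ?_
  rw [Finset.sum_sub_distrib, ← hmul, ← hmul, hb.fderiv_chr_symm hy (eVec k),
    hb.fderiv_chr_symm hy (eVec j), hb.chr_symm hy (eVec i), hb.chr_symm hy (eVec i)]
  ring

/-- The derivative of the chart around `x`. -/
def dchart (x p : M) : Model n →L[ℝ] Model n := mfderiv (𝓡 n) (𝓡 n) (extChartAt (𝓡 n) x) p

theorem dchart_dsymm (x : M) {y : Model n} (hy : y ∈ (extChartAt (𝓡 n) x).target) (u : Model n) :
    dchart x ((extChartAt (𝓡 n) x).symm y) (dsymm x y u) = u := by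
  have h := mfderiv_extChartAt_comp_mfderivWithin_extChartAt_symm (I := 𝓡 n) hy
  rw [ModelWithCorners.range_eq_univ, mfderivWithin_univ] at h
  exact congrArg (fun L : Model n →L[ℝ] Model n => L u) h

theorem dsymm_dchart (x : M) {p : M} (hp : p ∈ (extChartAt (𝓡 n) x).source) (u : Model n) :
    dsymm x (extChartAt (𝓡 n) x p) (dchart x p u) = u := by
  have h := mfderivWithin_extChartAt_symm_comp_mfderiv_extChartAt' (I := 𝓡 n) hp
  rw [ModelWithCorners.range_eq_univ, mfderivWithin_univ] at h
  exact congrArg (fun L : Model n →L[ℝ] Model n => L u) h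

theorem fderiv_trans {f : M → M} (hf : ContMDiff (𝓡 n) (𝓡 n) ∞ f) (x x' : M) {y : Model n}
    (hy : y ∈ transDom f x x') (u : Model n) :
    fderiv ℝ (trans f x x') y u = dchart x' (f ((extChartAt (𝓡 n) x).symm y))
      (rawDeriv f ((extChartAt (𝓡 n) x).symm y) (dsymm x y u)) := by
  have h := congrArg (fun L : Model n →L[ℝ] Model n => L u) (dsymm_trans hf x x' hy)
  simp only [ContinuousLinearMap.comp_apply] at h
  rw [← h]
  have h1 := dchart_dsymm x' (y := trans f x x' y) ((extChartAt (𝓡 n) x').map_source hy.2)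
    (fderiv ℝ (trans f x x') y u)
  rw [trans, (extChartAt (𝓡 n) x').left_inv hy.2] at h1
  exact h1.symm

/-- The Ricci curvature as a tensor field. -/
def ricT (g : RiemMetric (n := n) M) : TensorField02 (n := n) M := fun x =>
  pull (dchart x x) (ric (loc g.inner x) (extChartAt (𝓡 n) x x))

theorem ricci_eq (g : RiemMetric (n := n) M) (x : M) (v w : TangentSpace (𝓡 n) x) :
    ricci g x v w = ricT g x v w := by
  have hy := mem_extChartAt_target (I := 𝓡 n) x
  have h1 : ∀ (β : Bil (Model n)) (u u' : Model n), β u u' =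
      ∑ i, ∑ j, β (eVec i) (eVec j) * eForm i u * eForm j u' := by
    intro β u u'
    conv_lhs => rw [← sum_eForm_smul u, ← sum_eForm_smul u']
    simp only [map_sum, map_smul, ContinuousLinearMap.sum_apply, ContinuousLinearMap.smul_apply,
      smul_eq_mul, Finset.mul_sum]
    rw [Finset.sum_comm]
    exact Finset.sum_congr rfl fun i _ => Finset.sum_congr rfl fun j _ => by ring
  have h2 : ∀ v w : Model n, ricT g x v w = ∑ i, ∑ j,
      ric (loc g.inner x) (extChartAt (𝓡 n) x x) (eVec i) (eVec j) *
        eForm i (dchart x x v) * eForm j (dchart x x w) := fun v w =>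
    h1 (ric (loc g.inner x) (extChartAt (𝓡 n) x x)) (dchart x x v) (dchart x x w)
  refine Eq.trans ?_ (h2 v w).symm
  rw [ricci]
  simp only [ricciCoeff_eq g x hy]
  rfl

/-- `ricT` uses a different chart at every point. Naturality of `ric` under coordinate changes shows
that a single chart computes it on its whole domain, which is what makes it a smooth tensor field.
-/
theorem loc_ricT (g : RiemMetric (n := n) M) (x : M) {y : Model n}
    (hy : y ∈ (extChartAt (𝓡 n) x).target) : loc (ricT g) x y = ric (loc g.inner x) y := by
  set p := (extChartAt (𝓡 n) x).symm y with hp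
  have hm : y ∈ transDom (n := n) id x p := ⟨hy, mem_extChartAt_source (I := 𝓡 n) p⟩
  have hiso := isometryOn_trans contMDiff_id (preserves_id g.inner) x p
  have hd : ∀ u, fderiv ℝ (trans id x p) y u = dchart p p (dsymm x y u) := by
    intro u
    rw [fderiv_trans contMDiff_id x p hm]
    have : rawDeriv (n := n) (id : M → M) ((extChartAt (𝓡 n) x).symm y) =
        ContinuousLinearMap.id ℝ _ := mfderiv_id
    rw [this]
    rfl
  ext u v
  rw [hiso.ric_natural hm, hd, hd]
  rfl

theorem ricT_isSmooth (g : RiemMetric (n := n) M) : IsSmoothTensor (ricT g) :=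
  isSmoothTensor_of_loc fun x => (metricOn_loc g x).ric_contDiffOn.congr fun _ hy => loc_ricT g x hy

theorem ricT_symm (g : RiemMetric (n := n) M) (x : M) (v w : TangentSpace (𝓡 n) x) :
    ricT g x v w = ricT g x w v :=
  (metricOn_loc g x).ric_symm (mem_extChartAt_target (I := 𝓡 n) x) (dchart x x v) (dchart x x w)

theorem ricT_preserves {f : M → M} (hf : ContMDiff (𝓡 n) (𝓡 n) ∞ f) {g : RiemMetric (n := n) M}
    (hg : Preserves f g.inner) : Preserves f (ricT g) := by
  intro x v w
  have hx : (extChartAt (𝓡 n) x).symm (extChartAt (𝓡 n) x x) = x :=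
    extChartAt_to_inv (I := 𝓡 n) x
  have hm : extChartAt (𝓡 n) x x ∈ transDom (n := n) f x (f x) := by
    refine ⟨mem_extChartAt_target (I := 𝓡 n) x, ?_⟩
    change f ((extChartAt (𝓡 n) x).symm (extChartAt (𝓡 n) x x)) ∈
      (extChartAt (𝓡 n) (f x)).source
    rw [hx]
    exact mem_extChartAt_source (I := 𝓡 n) (f x)
  have hd : ∀ u, fderiv ℝ (trans f x (f x)) (extChartAt (𝓡 n) x x) (dchart x x u) =
      dchart (f x) (f x) (rawDeriv f x u) := by
    intro u
    rw [fderiv_trans hf x (f x) hm, hx, dsymm_dchart x (mem_extChartAt_source (I := 𝓡 n) x)]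
  have key : ∀ v w : Model n, ric (loc g.inner x) (extChartAt (𝓡 n) x x) (dchart x x v)
      (dchart x x w) = ric (loc g.inner (f x)) (extChartAt (𝓡 n) (f x) (f x))
        (dchart (f x) (f x) (rawDeriv f x v)) (dchart (f x) (f x) (rawDeriv f x w)) := by
    intro v w
    have h := (isometryOn_trans hf hg x (f x)).ric_natural hm (dchart x x v) (dchart x x w)
    rwa [hd, hd, trans, hx] at h
  exact (key v w).symm

theorem metricTrace_eq (g : RiemMetric (n := n) M) (B : TensorField02 (n := n) M) (x : M) :
    metricTrace g (fun z v w => B z v w) x =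
      trB (loc g.inner x (extChartAt (𝓡 n) x x)) (loc B x (extChartAt (𝓡 n) x x)) := by
  have hb := metricOn_loc g x
  have hy := mem_extChartAt_target (I := 𝓡 n) x
  rw [trB_eq_sum_coord (hb.inv _ hy) (hb.symm _ hy)]
  rfl

theorem scalarCurvature_eq (g : RiemMetric (n := n) M) (x : M) :
    scalarCurvature g x = trB (loc g.inner x (extChartAt (𝓡 n) x x))
      (ric (loc g.inner x) (extChartAt (𝓡 n) x x)) := by
  have h : ricci g = fun z v w => ricT g z v w := by
    funext z v w
    exact ricci_eq g z v w
  rw [scalarCurvature, h, metricTrace_eq, loc_ricT g x (mem_extChartAt_target (I := 𝓡 n) x)]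

end Bridge

/-! ### Open maps of maximal rank at a point are submersions there. -/

section ConstantRank

variable {X Y : Type*} [NormedAddCommGroup X] [NormedSpace ℝ X] [FiniteDimensional ℝ X]
  [NormedAddCommGroup Y] [NormedSpace ℝ Y] [FiniteDimensional ℝ Y]

theorem exists_projection (p : Submodule ℝ X) : ∃ P : X →L[ℝ] p, ∀ v : p, P v = v := by
  obtain ⟨P, hP⟩ := LinearMap.exists_leftInverse_of_injective p.subtype p.ker_subtype
  exact ⟨LinearMap.toContinuousLinearMap P, fun v => LinearMap.congr_fun hP v⟩

/-- A map of locally constant rank which is open at a point is a submersion there. -/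
theorem surjective_of_constant_rank {f : X → Y} {U : Set X} {s₀ : X} (hU : U ∈ 𝓝 s₀)
    (hf : ContDiffOn ℝ ∞ f U)
    (hrank : ∀ s ∈ U, Module.finrank ℝ (fderiv ℝ f s).range ≤
      Module.finrank ℝ (fderiv ℝ f s₀).range)
    (hopen : ∀ V ∈ 𝓝 s₀, f '' V ∈ 𝓝 (f s₀)) : Function.Surjective (fderiv ℝ f s₀) := by
  set A := fderiv ℝ f s₀ with hA
  obtain ⟨P, hP⟩ := exists_projection A.range
  obtain ⟨Q, hQ⟩ := exists_projection A.ker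
  have hfs : ContDiffAt ℝ ∞ f s₀ := hf.contDiffAt hU
  have hfd : ∀ᶠ s in 𝓝 s₀, s ∈ U ∧ DifferentiableAt ℝ f s := by
    filter_upwards [eventually_mem_nhds_iff.mpr hU] with s hs
    exact ⟨mem_of_mem_nhds hs, (hf.contDiffAt hs).differentiableAt (by simp)⟩
  have hPA : ∀ u, (P (A u) : Y) = A u := fun u => congrArg Subtype.val (hP ⟨A u, u, rfl⟩)
  -- Straightening coordinates: the derivative of Ψ at `s₀` is bijective, and in these coordinates
  -- `P ∘ f` is the first projection.
  set Ψ : X → A.range × A.ker := fun s => (P (f s), Q s) with hΨ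
  have hΨs : ContDiffAt ℝ ∞ Ψ s₀ := (P.contDiff.contDiffAt.comp s₀ hfs).prodMk Q.contDiff.contDiffAt
  have hinj : Function.Injective ((P ∘L A).prod Q) := by
    rw [injective_iff_map_eq_zero]
    intro u hu
    have h1 : P (A u) = 0 := congrArg Prod.fst hu
    have h2 : Q u = 0 := congrArg Prod.snd hu
    have h3 : A u = 0 := by rw [← hPA, h1]; rfl
    have h4 := hQ ⟨u, h3⟩
    rw [h2] at h4
    exact (congrArg Subtype.val h4).symm
  have hdim : Module.finrank ℝ X = Module.finrank ℝ (A.range × A.ker) := by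
    rw [Module.finrank_prod]
    exact (LinearMap.finrank_range_add_finrank_ker (A : X →ₗ[ℝ] Y)).symm
  let L : X ≃L[ℝ] (A.range × A.ker) := (LinearEquiv.ofInjectiveOfFinrankEq
    (((P ∘L A).prod Q : X →L[ℝ] A.range × A.ker) : X →ₗ[ℝ] _) hinj hdim).toContinuousLinearEquiv
  have hL : HasFDerivAt Ψ (L : X →L[ℝ] A.range × A.ker) s₀ := by
    have h := (P.hasFDerivAt.comp s₀ (hfs.differentiableAt (by simp)).hasFDerivAt).prodMk
      (Q.hasFDerivAt (x := s₀))
    exact h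
  set e := hΨs.toOpenPartialHomeomorph Ψ hL (by simp) with he
  have hes : s₀ ∈ e.source := hΨs.mem_toOpenPartialHomeomorph_source hL (by simp)
  have hecoe : ∀ s, e s = Ψ s := fun s => rfl
  have het : Ψ s₀ ∈ e.target := e.map_source hes
  have hsymm0 : e.symm (Ψ s₀) = s₀ := e.left_inv hes
  have hsymm : ContDiffAt ℝ ∞ e.symm (Ψ s₀) := hΨs.to_localInverse hL (by simp)
  have hcont : Filter.Tendsto e.symm (𝓝 (Ψ s₀)) (𝓝 s₀) := by
    have := hsymm.continuousAt.tendsto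
    rwa [hsymm0] at this
  have hsd : ∀ᶠ q in 𝓝 (Ψ s₀), DifferentiableAt ℝ e.symm q := by
    have h1 : ContDiffAt ℝ 1 e.symm (Ψ s₀) := hsymm.of_le (by simp)
    filter_upwards [h1.eventually (by simp)] with q hq using hq.differentiableAt (by simp)
  have hzero : ∀ᶠ q in 𝓝 (Ψ s₀), DifferentiableAt ℝ (fun q => f (e.symm q)) q ∧
      ∀ w, fderiv ℝ (fun q => f (e.symm q)) q (0, w) = 0 := by
    filter_upwards [hsd, hcont.eventually hfd, eventually_mem_nhds_iff.mpr
      (e.open_target.mem_nhds het)] with q hq1 hq2 hq3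
    obtain ⟨hqU, hqd⟩ := hq2
    refine ⟨hqd.comp q hq1, fun w => ?_⟩
    have hc : ∀ v, fderiv ℝ (fun q => f (e.symm q)) q v =
        fderiv ℝ f (e.symm q) (fderiv ℝ e.symm q v) := fun v => by
      rw [fderiv_comp' q hqd hq1]
      rfl
    have hPf : ∀ v, P (fderiv ℝ f (e.symm q) (fderiv ℝ e.symm q v)) = v.1 := by
      intro v
      have h1 : (fun q => P (f (e.symm q))) =ᶠ[𝓝 q] fun q => q.1 := by
        filter_upwards [hq3] with q' hq'
        exact congrArg Prod.fst (e.right_inv hq')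
      have h2 := Filter.EventuallyEq.fderiv_eq (𝕜 := ℝ) h1
      have h3 := (P.hasFDerivAt.comp q (hqd.comp q hq1).hasFDerivAt).fderiv
      have h4 : fderiv ℝ (fun q => P (f (e.symm q))) q v =
          P (fderiv ℝ (fun q => f (e.symm q)) q v) :=
        congrArg (fun T : (↥A.range × ↥A.ker) →L[ℝ] ↥A.range => T v) h3
      rw [← hc, ← h4, h2, fderiv_fst]
      rfl
    set D := fderiv ℝ f (e.symm q) with hD
    -- P maps the range of D onto that of A, and by the rank bound injectively. The image under D of
    -- a kernel direction is killed by P, so it is zero: locally `f` depends on the first coordinate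
    -- only.
    let R : D.range →ₗ[ℝ] A.range := (P : Y →ₗ[ℝ] A.range).domRestrict D.range
    have hRsurj : Function.Surjective R := by
      intro v
      exact ⟨⟨D (fderiv ℝ e.symm q (v, 0)), _, rfl⟩, hPf (v, 0)⟩
    have hRinj : Function.Injective R := by
      have h1 : Module.finrank ℝ D.range = Module.finrank ℝ A.range :=
        le_antisymm (hrank _ hqU) (LinearMap.finrank_le_finrank_of_surjective hRsurj)
      exact (LinearMap.injective_iff_surjective_of_finrank_eq_finrank h1).mpr hRsurj
    have h5 : R ⟨D (fderiv ℝ e.symm q (0, w)), _, rfl⟩ = R 0 := by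
      rw [map_zero]
      exact hPf (0, w)
    rw [hc]
    exact congrArg Subtype.val (hRinj h5)
  have hconst : ∀ᶠ w in 𝓝 (Q s₀), f (e.symm (P (f s₀), w)) = f s₀ := by
    obtain ⟨r, hr, hball⟩ := Metric.eventually_nhds_iff_ball.mp hzero
    filter_upwards [Metric.ball_mem_nhds (Q s₀) hr] with w hw
    have hmem : ∀ w' ∈ Metric.ball (Q s₀) r, (P (f s₀), w') ∈ Metric.ball (Ψ s₀) r := by
      intro w' hw'
      rw [Metric.mem_ball, Prod.dist_eq]
      exact max_lt (by simpa [hΨ] using hr) hw'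
    have hdw : ∀ w' ∈ Metric.ball (Q s₀) r, HasFDerivAt (fun w => f (e.symm (P (f s₀), w)))
        (0 : A.ker →L[ℝ] Y) w' := by
      intro w' hw'
      obtain ⟨h1, h2⟩ := hball _ (hmem w' hw')
      have h3 := h1.hasFDerivAt.comp w' (hasFDerivAt_prodMk_right (𝕜 := ℝ) (P (f s₀)) w')
      refine h3.congr_fderiv ?_
      ext u
      exact h2 u
    have h4 := (convex_ball (Q s₀) r).is_const_of_fderivWithin_eq_zero (𝕜 := ℝ)
      (fun w' hw' => (hdw w' hw').differentiableAt.differentiableWithinAt)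
      (fun w' hw' => by
        rw [fderivWithin_of_isOpen Metric.isOpen_ball hw', (hdw w' hw').fderiv])
      hw (Metric.mem_ball_self hr)
    exact h4.trans (congrArg f hsymm0)
  have hfib : ∀ᶠ s in 𝓝 s₀, P (f s) = P (f s₀) → f s = f s₀ := by
    filter_upwards [Q.continuous.continuousAt.eventually hconst, e.open_source.mem_nhds hes]
      with s hs1 hs2 hs3
    rw [← hs3] at hs1
    rw [← hs1]
    exact congrArg f (e.left_inv hs2).symm
  have himg := hopen _ hfib
  -- Near `s₀`, `f` equals `f s₀` wherever P ∘ f does. Openness puts some `f s₀ + t • k` with t ≠ 0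
  -- in the image, and P does not distinguish it from `f s₀`.
  have hker : ∀ k : Y, P k = 0 → k = 0 := by
    intro k hk
    have hc : Filter.Tendsto (fun t : ℝ => f s₀ + t • k) (𝓝[≠] 0) (𝓝 (f s₀)) := by
      have h1 : Continuous fun t : ℝ => f s₀ + t • k := by fun_prop
      have h2 := h1.tendsto 0
      simp only [zero_smul, add_zero] at h2
      exact h2.mono_left nhdsWithin_le_nhds
    obtain ⟨t, ⟨s, hs, hst⟩, ht⟩ := ((hc.eventually himg).and self_mem_nhdsWithin).exists
    have h3 : P (f s) = P (f s₀) := by rw [hst, map_add, map_smul, hk, smul_zero, add_zero]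
    have h4 := hs h3
    rw [hst] at h4
    have h5 : t • k = 0 := by simpa using h4
    exact (smul_eq_zero.mp h5).resolve_left ht
  intro y
  have h1 := hker (y - P y) (by rw [map_sub, hP, sub_self])
  obtain ⟨u, hu⟩ := (P y).2
  exact ⟨u, hu.trans (sub_eq_zero.mp h1).symm⟩

end ConstantRank

/-! ### The action in charts and its fundamental vector fields. -/

section Action

variable {EG : Type*} [NormedAddCommGroup EG] [NormedSpace ℝ EG] [FiniteDimensional ℝ EG]
  {G : Type*} [Group G] [TopologicalSpace G] [ChartedSpace EG G] [LieGroup 𝓘(ℝ, EG) ∞ G]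
  {H : Subgroup G} {n : ℕ} [ChartedSpace (Model n) (G ⧸ H)] [IsManifold (𝓡 n) ∞ (G ⧸ H)]

variable (EG n H) in
/-- The action of `G` on `G ⧸ H` is smooth. -/
def SmoothAction : Prop :=
  ContMDiff (𝓘(ℝ, EG).prod (𝓡 n)) (𝓡 n) ∞ (fun p : G × (G ⧸ H) => p.1 • p.2)

theorem SmoothAction.smul (h : SmoothAction EG H n) (a : G) :
    ContMDiff (𝓡 n) (𝓡 n) ∞ (fun z : G ⧸ H => a • z) :=
  ContMDiff.comp (g := fun p : G × (G ⧸ H) => p.1 • p.2) h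
    ((contMDiff_const (c := a)).prodMk contMDiff_id)

variable (EG G) in
/-- The chart of the group around the identity. -/
abbrev gChart : PartialEquiv G EG := extChartAt 𝓘(ℝ, EG) (1 : G)

variable (EG G) in
/-- The coordinates of the identity. -/
abbrev gOne : EG := gChart EG G 1

variable (EG) in
/-- The action of `G` in charts. -/
def locAct (x : G ⧸ H) (p : EG × Model n) : Model n :=
  extChartAt (𝓡 n) x ((gChart EG G).symm p.1 • (extChartAt (𝓡 n) x).symm p.2)

variable (EG) in
/-- The domain of `locAct`. -/
def locActDom (x : G ⧸ H) : Set (EG × Model n) :=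
  ((gChart EG G).target ×ˢ (extChartAt (𝓡 n) x).target) ∩
    (fun p : EG × Model n => (gChart EG G).symm p.1 • (extChartAt (𝓡 n) x).symm p.2) ⁻¹'
      (extChartAt (𝓡 n) x).source

theorem SmoothAction.contMDiffOn_aux (h : SmoothAction EG H n) (x : G ⧸ H) :
    ContMDiffOn 𝓘(ℝ, EG × Model n) (𝓡 n) ∞
      (fun p : EG × Model n => (gChart EG G).symm p.1 • (extChartAt (𝓡 n) x).symm p.2)
      ((gChart EG G).target ×ˢ (extChartAt (𝓡 n) x).target) := by
  have h1 : ContMDiffOn 𝓘(ℝ, EG × Model n) 𝓘(ℝ, EG) ∞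
      (fun p : EG × Model n => (gChart EG G).symm p.1)
      ((gChart EG G).target ×ˢ (extChartAt (𝓡 n) x).target) :=
    (contMDiffOn_extChartAt_symm (I := 𝓘(ℝ, EG)) (n := ∞) (1 : G)).comp
      (contDiff_fst.contMDiff.contMDiffOn) (fun p hp => hp.1)
  have h2 : ContMDiffOn 𝓘(ℝ, EG × Model n) (𝓡 n) ∞
      (fun p : EG × Model n => (extChartAt (𝓡 n) x).symm p.2)
      ((gChart EG G).target ×ˢ (extChartAt (𝓡 n) x).target) :=
    (contMDiffOn_extChartAt_symm (I := 𝓡 n) (n := ∞) x).comp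
      (contDiff_snd.contMDiff.contMDiffOn) (fun p hp => hp.2)
  exact ContMDiff.comp_contMDiffOn (g := fun p : G × (G ⧸ H) => p.1 • p.2) h (h1.prodMk h2)

theorem SmoothAction.isOpen_locActDom (h : SmoothAction EG H n) (x : G ⧸ H) :
    IsOpen (locActDom EG x : Set (EG × Model n)) :=
  (h.contMDiffOn_aux x).continuousOn.isOpen_inter_preimage
    ((isOpen_extChartAt_target (1 : G)).prod (isOpen_extChartAt_target x))
    (isOpen_extChartAt_source x)

theorem SmoothAction.locAct_contDiffOn (h : SmoothAction EG H n) (x : G ⧸ H) :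
    ContDiffOn ℝ ∞ (locAct EG x : EG × Model n → Model n) (locActDom EG x) := by
  rw [← contMDiffOn_iff_contDiffOn]
  have h1 : ContMDiffOn (𝓡 n) 𝓘(ℝ, Model n) ∞ (extChartAt (𝓡 n) x) (extChartAt (𝓡 n) x).source := by
    rw [extChartAt_source]
    exact contMDiffOn_extChartAt (n := ∞)
  exact h1.comp ((h.contMDiffOn_aux x).mono Set.inter_subset_left) (fun p hp => hp.2)

theorem gChart_symm_one : (gChart EG G).symm (gOne EG G) = 1 := extChartAt_to_inv (I := 𝓘(ℝ, EG)) (1 : G)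

theorem mem_locActDom (x : G ⧸ H) {y : Model n} (hy : y ∈ (extChartAt (𝓡 n) x).target) :
    (gOne EG G, y) ∈ (locActDom EG x : Set (EG × Model n)) := by
  refine ⟨⟨mem_extChartAt_target (I := 𝓘(ℝ, EG)) (1 : G), hy⟩, ?_⟩
  change (gChart EG G).symm (gOne EG G) • (extChartAt (𝓡 n) x).symm y ∈ (extChartAt (𝓡 n) x).source
  rw [gChart_symm_one, one_smul]
  exact (extChartAt (𝓡 n) x).map_target hy

theorem locAct_one (x : G ⧸ H) {y : Model n} (hy : y ∈ (extChartAt (𝓡 n) x).target) :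
    locAct EG x (gOne EG G, y) = y := by
  change extChartAt (𝓡 n) x ((gChart EG G).symm (gOne EG G) • (extChartAt (𝓡 n) x).symm y) = y
  rw [gChart_symm_one, one_smul, (extChartAt (𝓡 n) x).right_inv hy]

/-- The fundamental vector field of `ξ` in the chart around `x`. -/
def killing (x : G ⧸ H) (ξ : EG) (y : Model n) : Model n :=
  fderiv ℝ (locAct EG x) (gOne EG G, y) (ξ, 0)

theorem SmoothAction.killing_contDiffOn (h : SmoothAction EG H n) (x : G ⧸ H) (ξ : EG) :
    ContDiffOn ℝ ∞ (killing (n := n) x ξ) (extChartAt (𝓡 n) x).target := by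
  have h1 := (contDiffOn_fderiv (h.isOpen_locActDom x) (h.locAct_contDiffOn x)).clm_apply
    (contDiffOn_const (c := (ξ, (0 : Model n))))
  exact h1.comp (contDiff_prodMk_right (gOne EG G)).contDiffOn fun y hy => mem_locActDom x hy

theorem hasFDerivAt_left {S E Y : Type*} [NormedAddCommGroup S] [NormedSpace ℝ S]
    [NormedAddCommGroup E] [NormedSpace ℝ E] [NormedAddCommGroup Y] [NormedSpace ℝ Y]
    {F : S × E → Y} {s : S} {y : E} (hF : DifferentiableAt ℝ F (s, y)) :
    HasFDerivAt (fun s => F (s, y)) (fderiv ℝ F (s, y) ∘L ContinuousLinearMap.inl ℝ S E) s :=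
  HasFDerivAt.comp s hF.hasFDerivAt (hasFDerivAt_prodMk_left s y)

theorem hasFDerivAt_right {S E Y : Type*} [NormedAddCommGroup S] [NormedSpace ℝ S]
    [NormedAddCommGroup E] [NormedSpace ℝ E] [NormedAddCommGroup Y] [NormedSpace ℝ Y]
    {F : S × E → Y} {s : S} {y : E} (hF : DifferentiableAt ℝ F (s, y)) :
    HasFDerivAt (fun y => F (s, y)) (fderiv ℝ F (s, y) ∘L ContinuousLinearMap.inr ℝ S E) y :=
  HasFDerivAt.comp y hF.hasFDerivAt (hasFDerivAt_prodMk_right s y)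

/-- Differentiating the invariance of X under the maps F(s, ·) in the parameter at `s₀`, with
symmetry of the mixed second derivative, yields that X commutes with the generator of the family. -/
theorem fderiv_comm_of_equivariant {S E : Type*} [NormedAddCommGroup S] [NormedSpace ℝ S]
    [NormedAddCommGroup E] [NormedSpace ℝ E] {F : S × E → E} {D : Set (S × E)} (hD : IsOpen D)
    (hF : ContDiffOn ℝ ∞ F D) {s₀ : S} {y : E} (hm : (s₀, y) ∈ D) (hy : F (s₀, y) = y)
    {X : E → E} (hX : DifferentiableAt ℝ X y)
    (heq : ∀ᶠ s in 𝓝 s₀, X (F (s, y)) = fderiv ℝ F (s, y) (0, X y)) (ξ : S) :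
    fderiv ℝ (fun y => fderiv ℝ F (s₀, y) (ξ, 0)) y (X y) =
      fderiv ℝ X y (fderiv ℝ F (s₀, y) (ξ, 0)) := by
  have hd := differentiableAt_of_contDiffOn hD hF hm
  have hd2 := differentiableAt_of_contDiffOn hD (contDiffOn_fderiv hD hF) hm
  have hX' : HasFDerivAt X (fderiv ℝ X y) (F (s₀, y)) := by
    rw [hy]
    exact hX.hasFDerivAt
  have h1 := HasFDerivAt.comp s₀ hX' (hasFDerivAt_left hd)
  have h2 : HasFDerivAt (fun s => fderiv ℝ F (s, y) (0, X y))
      ((fderiv ℝ (fderiv ℝ F) (s₀, y) ∘L ContinuousLinearMap.inl ℝ S E).flip (0, X y)) s₀ := by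
    have := (hasFDerivAt_left hd2).clm_apply (hasFDerivAt_const ((0 : S), X y) s₀)
    simpa using this
  have h3 := h1.unique (h2.congr_of_eventuallyEq heq)
  have h4 := congrArg (fun T : S →L[ℝ] E => T ξ) h3
  have h5 : HasFDerivAt (fun y => fderiv ℝ F (s₀, y) (ξ, 0))
      ((fderiv ℝ (fderiv ℝ F) (s₀, y) ∘L ContinuousLinearMap.inr ℝ S E).flip (ξ, 0)) y := by
    have := (hasFDerivAt_right hd2).clm_apply (hasFDerivAt_const (ξ, (0 : E)) y)
    simpa using this
  rw [h5.fderiv]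
  have h6 := second_symm hD hF hm (0, X y) (ξ, 0)
  exact h6.trans h4.symm

theorem locAct_eq_trans (x : G ⧸ H) (s : EG) :
    (fun y => locAct EG x (s, y)) =
      trans (n := n) (fun z : G ⧸ H => (gChart EG G).symm s • z) x x := rfl

/-- A smooth vector field, given by its representatives in the charts, that is invariant. -/
structure InvariantField (X : G ⧸ H → Model n → Model n) : Prop where
  smooth : ∀ x, ContDiffOn ℝ ∞ (X x) (extChartAt (𝓡 n) x).target
  natural : ∀ (a : G) (x x' : G ⧸ H), ∀ y ∈ transDom (n := n) (fun z => a • z) x x',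
    fderiv ℝ (trans (fun z => a • z) x x') y (X x y) = X x' (trans (fun z => a • z) x x' y)

theorem SmoothAction.killing_comm (h : SmoothAction EG H n) {X : G ⧸ H → Model n → Model n}
    (hX : InvariantField X) (x : G ⧸ H) {y : Model n} (hy : y ∈ (extChartAt (𝓡 n) x).target)
    (ξ : EG) :
    fderiv ℝ (killing x ξ) y (X x y) = fderiv ℝ (X x) y (killing x ξ y) := by
  have ho := h.isOpen_locActDom x
  have hc := h.locAct_contDiffOn x
  have hm := mem_locActDom (EG := EG) x hy
  refine fderiv_comm_of_equivariant ho hc hm (locAct_one x hy)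
    (differentiableAt_of_contDiffOn (isOpen_extChartAt_target x) (hX.smooth x) hy) ?_ ξ
  have hcont : Filter.Tendsto (fun s : EG => (s, y)) (𝓝 (gOne EG G)) (𝓝 (gOne EG G, y)) :=
    (Continuous.prodMk_left y).tendsto _
  filter_upwards [hcont.eventually (ho.mem_nhds hm)] with s hs
  have h1 := hX.natural ((gChart EG G).symm s) x x y ⟨hs.1.2, hs.2⟩
  have h2 := (hasFDerivAt_right (differentiableAt_of_contDiffOn ho hc hs)).fderiv
  rw [locAct_eq_trans] at h2
  rw [h2] at h1
  exact h1.symm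

theorem SmoothAction.killing_natural (h : SmoothAction EG H n) (x x' : G ⧸ H) {y : Model n}
    (hy : y ∈ transDom (n := n) id x x') (ξ : EG) :
    fderiv ℝ (trans id x x') y (killing x ξ y) = killing x' ξ (trans id x x' y) := by
  have hid : ContMDiff (𝓡 n) (𝓡 n) ∞ (id : G ⧸ H → G ⧸ H) := contMDiff_id
  have hy' : trans id x x' y ∈ (extChartAt (𝓡 n) x').target :=
    (extChartAt (𝓡 n) x').map_source hy.2
  have hm := mem_locActDom (EG := EG) x hy.1
  have hm' := mem_locActDom (EG := EG) x' hy'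
  have hd := differentiableAt_of_contDiffOn (h.isOpen_locActDom x) (h.locAct_contDiffOn x) hm
  have hd' := differentiableAt_of_contDiffOn (h.isOpen_locActDom x') (h.locAct_contDiffOn x') hm'
  have hone := locAct_one (EG := EG) x hy.1
  have ht : HasFDerivAt (trans (n := n) (id : G ⧸ H → G ⧸ H) x x') (fderiv ℝ (trans id x x') y)
      (locAct EG x (gOne EG G, y)) := by
    rw [hone]
    exact (differentiableAt_of_contDiffOn (isOpen_transDom hid x x')
      (trans_contDiffOn hid x x') hy).hasFDerivAt
  have h1 := HasFDerivAt.comp (gOne EG G) ht (hasFDerivAt_left hd)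
  have h2 := hasFDerivAt_left hd'
  have heq : (trans (n := n) (id : G ⧸ H → G ⧸ H) x x') ∘ (fun s : EG => locAct EG x (s, y))
      =ᶠ[𝓝 (gOne EG G)] fun s => locAct EG x' (s, trans id x x' y) := by
    have hcont : Filter.Tendsto (fun s : EG => (s, y)) (𝓝 (gOne EG G)) (𝓝 (gOne EG G, y)) :=
      (Continuous.prodMk_left y).tendsto _
    filter_upwards [hcont.eventually ((h.isOpen_locActDom x).mem_nhds hm)] with s hs
    change extChartAt (𝓡 n) x' ((extChartAt (𝓡 n) x).symm (extChartAt (𝓡 n) x _)) =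
      extChartAt (𝓡 n) x' (_ • (extChartAt (𝓡 n) x').symm (extChartAt (𝓡 n) x' _))
    rw [(extChartAt (𝓡 n) x').left_inv hy.2, (extChartAt (𝓡 n) x).left_inv hs.2]
    rfl
  have h3 := (h1.congr_of_eventuallyEq heq.symm).unique h2
  exact congrArg (fun T : EG →L[ℝ] Model n => T ξ) h3

end Action

theorem det_gram_pos {E ι : Type*} [NormedAddCommGroup E] [NormedSpace ℝ E] [Fintype ι]
    [DecidableEq ι] {b : Bil E} (hs : ∀ u v, b u v = b v u) (hp : ∀ v, v ≠ 0 → 0 < b v v)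
    {v : ι → E} (hv : LinearIndependent ℝ v) : 0 < (gram b v).det := by
  refine (Matrix.PosDef.of_dotProduct_mulVec_pos ?_ ?_).det_pos
  · ext i j
    exact hs _ _
  · intro c hc
    have h1 : ∑ i, c i • v i ≠ 0 := fun h0 =>
      hc (funext (Fintype.linearIndependent_iff.mp hv c h0))
    have h2 := hp _ h1
    simp only [map_sum, map_smul, ContinuousLinearMap.sum_apply, ContinuousLinearMap.smul_apply,
      smul_eq_mul] at h2
    simp only [dotProduct, Matrix.mulVec, gram, Matrix.of_apply, star_trivial]
    refine h2.trans_eq ?_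
    simp only [Finset.mul_sum]
    rw [Finset.sum_comm]
    exact Finset.sum_congr rfl fun i _ => Finset.sum_congr rfl fun j _ => by ring

/-! ### The orbit map of the origin is a submersion. -/

section Transitive

variable {EG : Type*} [NormedAddCommGroup EG] [NormedSpace ℝ EG] [FiniteDimensional ℝ EG]
  {G : Type*} [Group G] [TopologicalSpace G] [ChartedSpace EG G] [LieGroup 𝓘(ℝ, EG) ∞ G]
  {H : Subgroup G} {n : ℕ} [ChartedSpace (Model n) (G ⧸ H)] [IsManifold (𝓡 n) ∞ (G ⧸ H)]

variable (H) in
/-- The coset of the identity. -/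
abbrev origin : G ⧸ H := ((1 : G) : G ⧸ H)

theorem smul_origin (a : G) : a • origin H = (a : G ⧸ H) := by
  rw [MulAction.Quotient.smul_coe, smul_eq_mul, mul_one]

variable (n H) in
/-- The coordinates of the coset of the identity. -/
abbrev oCoord : Model n := extChartAt (𝓡 n) (origin H) (origin H)

theorem oCoord_mem : oCoord H n ∈ (extChartAt (𝓡 n) (origin H)).target :=
  mem_extChartAt_target (I := 𝓡 n) (origin H)

theorem symm_oCoord : (extChartAt (𝓡 n) (origin H)).symm (oCoord H n) = origin H :=
  extChartAt_to_inv (I := 𝓡 n) (origin H)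

variable (EG n H) in
/-- The orbit map of the origin in charts. -/
def orbitMap (s : EG) : Model n := locAct EG (origin H) (s, oCoord H n)

theorem orbitMap_eq (s : EG) : orbitMap EG H n s =
    extChartAt (𝓡 n) (origin H) ((gChart EG G).symm s • origin H) := by
  rw [orbitMap, locAct, symm_oCoord]

theorem orbitMap_one : orbitMap EG H n (gOne EG G) = oCoord H n :=
  locAct_one (origin H) oCoord_mem

variable (EG n H) in
/-- The domain of `orbitMap`. -/
def orbitDom : Set EG := (fun s => (s, oCoord H n)) ⁻¹' (locActDom EG (origin H))

theorem SmoothAction.isOpen_orbitDom (h : SmoothAction EG H n) : IsOpen (orbitDom EG H n) :=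
  (h.isOpen_locActDom (origin H)).preimage (Continuous.prodMk_left _)

theorem SmoothAction.orbitMap_contDiffOn (h : SmoothAction EG H n) :
    ContDiffOn ℝ ∞ (orbitMap EG H n) (orbitDom EG H n) :=
  (h.locAct_contDiffOn (origin H)).comp (contDiff_prodMk_left _).contDiffOn fun _ hs => hs

theorem one_mem_orbitDom : gOne EG G ∈ orbitDom EG H n := mem_locActDom (origin H) oCoord_mem

/-- Up to charts the orbit map is the quotient map `G → G ⧸ H`, which is continuous and open. -/
theorem map_orbitMap_nhds : Filter.map (orbitMap EG H n) (𝓝 (gOne EG G)) = 𝓝 (oCoord H n) := by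
  have : IsTopologicalGroup G := topologicalGroup_of_lieGroup 𝓘(ℝ, EG) ∞
  have h1 : Filter.map (gChart EG G).symm (𝓝 (gOne EG G)) = 𝓝 1 := by
    have := map_extChartAt_symm_nhdsWithin_range (I := 𝓘(ℝ, EG)) (1 : G)
    rwa [ModelWithCorners.range_eq_univ, nhdsWithin_univ] at this
  have h2 : orbitMap EG H n = (extChartAt (𝓡 n) (origin H)) ∘ (QuotientGroup.mk : G → G ⧸ H) ∘
      (gChart EG G).symm := by
    funext s
    rw [orbitMap_eq, smul_origin]
    rfl
  rw [h2, ← Filter.map_map, ← Filter.map_map, h1, ← QuotientGroup.nhds_eq,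
    map_extChartAt_nhds_of_boundaryless]

theorem finrank_range_comp_le {X Y Z W : Type*} [NormedAddCommGroup X] [NormedSpace ℝ X]
    [NormedAddCommGroup Y] [NormedSpace ℝ Y] [NormedAddCommGroup Z] [NormedSpace ℝ Z]
    [NormedAddCommGroup W] [NormedSpace ℝ W] [FiniteDimensional ℝ Z] (A : X →L[ℝ] Y) (B : Y →L[ℝ] Z)
    (C : Z →L[ℝ] W) :
    Module.finrank ℝ (C ∘L B ∘L A).range ≤ Module.finrank ℝ B.range := by
  have h : (C ∘L B ∘L A).range ≤ Submodule.map (C : Z →ₗ[ℝ] W) B.range := by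
    rintro _ ⟨x, rfl⟩
    exact ⟨B (A x), ⟨A x, rfl⟩, rfl⟩
  have : FiniteDimensional ℝ (Submodule.map (C : Z →ₗ[ℝ] W) B.range) := inferInstance
  exact (Submodule.finrank_mono h).trans (Submodule.finrank_map_le _ _)

/-- By equivariance, near `s₁` the orbit map is left translation by `a⁻¹` in the group, then the
orbit map near the identity, then the action of `a`. Its derivative at `s₁` thus factors through the
one at the identity. -/
theorem SmoothAction.finrank_fderiv_orbitMap (h : SmoothAction EG H n) {s₁ : EG}
    (hs : s₁ ∈ orbitDom EG H n) :
    Module.finrank ℝ (fderiv ℝ (orbitMap EG H n) s₁).range ≤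
      Module.finrank ℝ (fderiv ℝ (orbitMap EG H n) (gOne EG G)).range := by
  have : IsTopologicalGroup G := topologicalGroup_of_lieGroup 𝓘(ℝ, EG) ∞
  set a := (gChart EG G).symm s₁ with ha
  have hs1 : s₁ ∈ (gChart EG G).target := hs.1.1
  have hao : a • origin H ∈ (extChartAt (𝓡 n) (origin H)).source := by
    have : a • (extChartAt (𝓡 n) (origin H)).symm (oCoord H n) ∈
      (extChartAt (𝓡 n) (origin H)).source := hs.2
    rwa [symm_oCoord] at this
  set σ : EG → EG := fun s => gChart EG G (a⁻¹ * (gChart EG G).symm s) with hσ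
  have hσ1 : σ s₁ = gOne EG G := by
    change gChart EG G (a⁻¹ * a) = _
    rw [inv_mul_cancel]
  have hsymm : ContMDiffAt 𝓘(ℝ, EG) 𝓘(ℝ, EG) ∞ (gChart EG G).symm s₁ :=
    (contMDiffOn_extChartAt_symm (I := 𝓘(ℝ, EG)) (n := ∞) (1 : G)).contMDiffAt
      ((isOpen_extChartAt_target (1 : G)).mem_nhds hs1)
  have hm : ContMDiffAt 𝓘(ℝ, EG) 𝓘(ℝ, EG) ∞ (fun s => a⁻¹ * (gChart EG G).symm s) s₁ :=
    (contMDiff_mul_left (I := 𝓘(ℝ, EG)) (n := ∞) (a := a⁻¹)).contMDiffAt.comp s₁ hsymm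
  have h1 : a⁻¹ * (gChart EG G).symm s₁ = 1 := inv_mul_cancel a
  have hσd : ContMDiffAt 𝓘(ℝ, EG) 𝓘(ℝ, EG) ∞ σ s₁ := by
    have h2 : ContMDiffAt 𝓘(ℝ, EG) 𝓘(ℝ, EG) ∞ (gChart EG G) (a⁻¹ * (gChart EG G).symm s₁) := by
      rw [h1]
      exact contMDiffAt_extChartAt
    exact h2.comp s₁ hm
  have hσd' : DifferentiableAt ℝ σ s₁ := (contMDiffAt_iff_contDiffAt.mp hσd).differentiableAt (by simp)
  have hfd : DifferentiableAt ℝ (orbitMap EG H n) (σ s₁) := by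
    rw [hσ1]
    exact differentiableAt_of_contDiffOn h.isOpen_orbitDom h.orbitMap_contDiffOn one_mem_orbitDom
  have htm : oCoord H n ∈ transDom (n := n) (fun z : G ⧸ H => a • z) (origin H) (origin H) := by
    refine ⟨oCoord_mem, ?_⟩
    change a • (extChartAt (𝓡 n) (origin H)).symm (oCoord H n) ∈ (extChartAt (𝓡 n) (origin H)).source
    rwa [symm_oCoord]
  have htd : DifferentiableAt ℝ (trans (n := n) (fun z : G ⧸ H => a • z) (origin H) (origin H))
      (orbitMap EG H n (σ s₁)) := by
    rw [hσ1, orbitMap_one]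
    exact differentiableAt_of_contDiffOn (isOpen_transDom (h.smul a) _ _)
      (trans_contDiffOn (h.smul a) _ _) htm
  have heq : orbitMap EG H n =ᶠ[𝓝 s₁] fun s =>
      trans (n := n) (fun z : G ⧸ H => a • z) (origin H) (origin H) (orbitMap EG H n (σ s)) := by
    have h3 : ∀ᶠ s in 𝓝 s₁, a⁻¹ * (gChart EG G).symm s ∈ (gChart EG G).source ∩
        QuotientGroup.mk ⁻¹' (extChartAt (𝓡 n) (origin H)).source := by
      refine hm.continuousAt.eventually ?_
      change ∀ᶠ y in 𝓝 (a⁻¹ * (gChart EG G).symm s₁), _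
      rw [h1]
      exact (((isOpen_extChartAt_source (I := 𝓘(ℝ, EG)) (1 : G)).inter
        ((isOpen_extChartAt_source (I := 𝓡 n) (origin H)).preimage
          QuotientGroup.continuous_mk)).mem_nhds
        ⟨mem_extChartAt_source (I := 𝓘(ℝ, EG)) (1 : G),
          mem_extChartAt_source (I := 𝓡 n) (origin H)⟩)
    filter_upwards [h3] with s hs3
    have h4 : (gChart EG G).symm (σ s) = a⁻¹ * (gChart EG G).symm s :=
      (gChart EG G).left_inv hs3.1
    have h6 : (a⁻¹ * (gChart EG G).symm s) • origin H ∈ (extChartAt (𝓡 n) (origin H)).source := by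
      rw [smul_origin]
      exact hs3.2
    rw [trans, orbitMap_eq, orbitMap_eq, h4, (extChartAt (𝓡 n) (origin H)).left_inv h6, smul_smul,
      mul_inv_cancel_left]
  have h5 : fderiv ℝ (orbitMap EG H n) s₁ = fderiv ℝ (trans (n := n) (fun z : G ⧸ H => a • z)
      (origin H) (origin H)) (orbitMap EG H n (σ s₁)) ∘L
        fderiv ℝ (orbitMap EG H n) (σ s₁) ∘L fderiv ℝ σ s₁ := by
    rw [heq.fderiv_eq]
    exact (htd.hasFDerivAt.comp s₁ (hfd.hasFDerivAt.comp s₁ hσd'.hasFDerivAt)).fderiv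
  rw [h5, ← hσ1]
  exact finrank_range_comp_le _ _ _

theorem SmoothAction.fderiv_orbitMap_surjective (h : SmoothAction EG H n) :
    Function.Surjective (fderiv ℝ (orbitMap EG H n) (gOne EG G)) :=
  surjective_of_constant_rank (h.isOpen_orbitDom.mem_nhds one_mem_orbitDom) h.orbitMap_contDiffOn
    (fun _ hs => h.finrank_fderiv_orbitMap hs) fun V hV => by
      rw [orbitMap_one, ← map_orbitMap_nhds (EG := EG)]
      exact Filter.image_mem_map hV

theorem SmoothAction.exists_killing_eq (h : SmoothAction EG H n) (u : Model n) :
    ∃ ξ : EG, killing (origin H) ξ (oCoord H n) = u := by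
  obtain ⟨ξ, hξ⟩ := h.fderiv_orbitMap_surjective u
  refine ⟨ξ, ?_⟩
  rw [← hξ]
  have h1 := (hasFDerivAt_left (differentiableAt_of_contDiffOn (h.isOpen_locActDom (origin H))
    (h.locAct_contDiffOn (origin H)) (mem_locActDom (EG := EG) (origin H)
      (oCoord_mem (H := H) (n := n))))).fderiv
  exact (congrArg (fun L : EG →L[ℝ] Model n => L ξ) h1).symm

end Transitive

/-! ### Invariant vector fields are divergence free. -/

section DivergenceZero

variable {EG : Type*} [NormedAddCommGroup EG] [NormedSpace ℝ EG] [FiniteDimensional ℝ EG]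
  {G : Type*} [Group G] [TopologicalSpace G] [ChartedSpace EG G] [LieGroup 𝓘(ℝ, EG) ∞ G]
  {H : Subgroup G} {n : ℕ} [ChartedSpace (Model n) (G ⧸ H)] [IsManifold (𝓡 n) ∞ (G ⧸ H)]

/-- The Gram determinant of a family of fundamental vector fields. -/
def killingGram (g : RiemMetric (n := n) (G ⧸ H)) (ξ : Fin n → EG) (x : G ⧸ H) (y : Model n) : ℝ :=
  (gram (loc g.inner x y) fun i => killing x (ξ i) y).det

/-- The Gram determinant is independent of the chart, so it is a function on `G ⧸ H` and can be
maximized globally. -/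
theorem SmoothAction.killingGram_eq (h : SmoothAction EG H n) (g : RiemMetric (n := n) (G ⧸ H))
    (ξ : Fin n → EG) (x : G ⧸ H) {y : Model n} (hy : y ∈ (extChartAt (𝓡 n) x).target) :
    killingGram g ξ x y = killingGram g ξ ((extChartAt (𝓡 n) x).symm y)
      (extChartAt (𝓡 n) ((extChartAt (𝓡 n) x).symm y) ((extChartAt (𝓡 n) x).symm y)) := by
  set p := (extChartAt (𝓡 n) x).symm y with hp
  have hm : y ∈ transDom (n := n) id x p := ⟨hy, mem_extChartAt_source (I := 𝓡 n) p⟩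
  rw [killingGram, killingGram]
  congr 1
  ext i j
  simp only [gram, Matrix.of_apply]
  rw [loc_natural contMDiff_id (preserves_id g.inner) x p hm, h.killing_natural x p hm,
    h.killing_natural x p hm]
  rfl

theorem SmoothAction.killingGram_continuousOn (h : SmoothAction EG H n)
    (g : RiemMetric (n := n) (G ⧸ H)) (ξ : Fin n → EG) (x : G ⧸ H) :
    ContinuousOn (killingGram g ξ x) (extChartAt (𝓡 n) x).target := by
  have h1 : ContinuousOn (fun y => gram (loc g.inner x y) fun i => killing x (ξ i) y)
      (extChartAt (𝓡 n) x).target := by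
    refine continuousOn_pi.mpr fun i => continuousOn_pi.mpr fun j => ?_
    exact (((metricOn_loc g x).smooth.continuousOn).clm_apply
      (h.killing_contDiffOn x (ξ i)).continuousOn).clm_apply
      (h.killing_contDiffOn x (ξ j)).continuousOn
  exact (continuous_id.matrix_det).comp_continuousOn h1

theorem SmoothAction.killingGram_center_continuous (h : SmoothAction EG H n)
    (g : RiemMetric (n := n) (G ⧸ H)) (ξ : Fin n → EG) :
    Continuous fun x => killingGram g ξ x (extChartAt (𝓡 n) x x) := by
  rw [continuous_iff_continuousAt]
  intro x
  have h1 : ContinuousAt (fun x' => killingGram g ξ x (extChartAt (𝓡 n) x x')) x :=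
    ContinuousAt.comp (g := killingGram g ξ x) (((h.killingGram_continuousOn g ξ x).continuousAt
      ((isOpen_extChartAt_target x).mem_nhds (mem_extChartAt_target (I := 𝓡 n) x))))
      (continuousAt_extChartAt (I := 𝓡 n) x)
  refine h1.congr ?_
  filter_upwards [(isOpen_extChartAt_source (I := 𝓡 n) x).mem_nhds
    (mem_extChartAt_source (I := 𝓡 n) x)] with x' hx'
  rw [h.killingGram_eq g ξ x ((extChartAt (𝓡 n) x).map_source hx'),
    (extChartAt (𝓡 n) x).left_inv hx']

theorem exists_smul_origin (x : G ⧸ H) : ∃ a : G, a • origin H = x := by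
  obtain ⟨a, rfl⟩ := QuotientGroup.mk_surjective x
  exact ⟨a, smul_origin a⟩

theorem oCoord_mem_transDom (a : G) :
    oCoord H n ∈ transDom (n := n) (fun z : G ⧸ H => a • z) (origin H) (a • origin H) := by
  refine ⟨oCoord_mem, ?_⟩
  change a • (extChartAt (𝓡 n) (origin H)).symm (oCoord H n) ∈
    (extChartAt (𝓡 n) (a • origin H)).source
  rw [symm_oCoord]
  exact mem_extChartAt_source (I := 𝓡 n) _

theorem trans_oCoord (a : G) :
    trans (n := n) (fun z : G ⧸ H => a • z) (origin H) (a • origin H) (oCoord H n) =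
      extChartAt (𝓡 n) (a • origin H) (a • origin H) := by
  rw [trans, symm_oCoord]

/-- An invariant vector field on a compact homogeneous space is divergence free. -/
theorem SmoothAction.divg_eq_zero [CompactSpace G] (h : SmoothAction EG H n)
    {g : RiemMetric (n := n) (G ⧸ H)} (hg : IsInvariant (n := n) (H := H) g.inner)
    {X : G ⧸ H → Model n → Model n} (hX : InvariantField X) :
    divg (loc g.inner (origin H)) (X (origin H)) (oCoord H n) = 0 := by
  -- Generators whose fields form the standard frame at the origin; this makes the Gram determinant
  -- positive there, and all the more at its maximum.
  choose ξ hξ using fun i : Fin n => h.exists_killing_eq (eVec i)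
  obtain ⟨x, -, hx⟩ := isCompact_univ.exists_isMaxOn (Set.univ_nonempty (α := G ⧸ H))
    (h.killingGram_center_continuous g ξ).continuousOn
  have hpos : 0 < killingGram g ξ (origin H) (oCoord H n) := by
    refine det_gram_pos ((metricOn_loc g (origin H)).symm _ oCoord_mem)
      (fun v hv => loc_pos g.pos (origin H) oCoord_mem hv) ?_
    simp_rw [hξ]
    have hb : (fun i : Fin n => eVec i) = (EuclideanSpace.basisFun (Fin n) ℝ).toBasis := by
      funext i
      simp
    rw [hb]
    exact (EuclideanSpace.basisFun (Fin n) ℝ).toBasis.linearIndependent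
  have hmx : 0 < killingGram g ξ x (extChartAt (𝓡 n) x x) :=
    hpos.trans_le (hx (Set.mem_univ (origin H)))
  have hy := mem_extChartAt_target (I := 𝓡 n) x
  have hzero : divg (loc g.inner x) (X x) (extChartAt (𝓡 n) x x) = 0 := by
    refine (metricOn_loc g x).divg_eq_zero_of_isLocalMax hy (ι := Fin n) (by simp)
      (K := fun i => killing x (ξ i))
      (fun i => differentiableAt_of_contDiffOn (isOpen_extChartAt_target x)
        (h.killing_contDiffOn x (ξ i)) hy) (fun i => h.killing_comm hX x hy (ξ i)) hmx.ne' ?_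
    filter_upwards [(isOpen_extChartAt_target (I := 𝓡 n) x).mem_nhds hy] with y hy'
    exact (h.killingGram_eq g ξ x hy').trans_le (hx (Set.mem_univ _))
  -- The maximum may lie anywhere; translation by `a` is an isometry preserving X and carries the
  -- conclusion back to the origin.
  obtain ⟨a, rfl⟩ := exists_smul_origin x
  have hiso := isometryOn_trans (h.smul a) (fun x v w => hg a x v w) (origin H) (a • origin H)
  rw [hiso.divg_natural ((hX.smooth (origin H)).mono Set.inter_subset_left)
    (hX.smooth (a • origin H)) (hX.natural a _ _) (oCoord_mem_transDom a), trans_oCoord]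
  exact hzero

end DivergenceZero

/-! ### The inner product on symmetric forms; stability of positivity. -/

section Pairing

variable {E : Type*} [NormedAddCommGroup E] [NormedSpace ℝ E] [FiniteDimensional ℝ E]

theorem pairB_comm (b β β' : Bil E) : pairB b β β' = pairB b β' β :=
  tr_comp_comm (b.inverse ∘L β) (b.inverse ∘L β')

theorem pairB_smul_right (b β : Bil E) (c : ℝ) (β' : Bil E) :
    pairB b β (c • β') = c * pairB b β β' := by
  simp [pairB, trB]

theorem pairB_sub_right (b β β₁ β₂ : Bil E) :
    pairB b β (β₁ - β₂) = pairB b β β₁ - pairB b β β₂ := by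
  simp [pairB, trB, ContinuousLinearMap.comp_sub]

theorem pairB_sub_left (b β₁ β₂ β : Bil E) :
    pairB b (β₁ - β₂) β = pairB b β₁ β - pairB b β₂ β := by
  rw [pairB_comm, pairB_sub_right, pairB_comm b β, pairB_comm b β]

theorem pairB_smul_left (b β : Bil E) (c : ℝ) (β' : Bil E) :
    pairB b (c • β) β' = c * pairB b β β' := by
  rw [pairB_comm, pairB_smul_right, pairB_comm]

theorem trB_zero (b : Bil E) : trB b 0 = 0 := by simp [trB, tr_eq_sum]

theorem trB_smul_left {b : Bil E} (hb : b.IsInvertible) {c : ℝ} (hc : c ≠ 0) (β : Bil E) :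
    trB (c • b) β = c⁻¹ * trB b β := by
  have hi : (c • b).IsInvertible := by
    obtain ⟨e, rfl⟩ := hb
    exact ⟨(ContinuousLinearEquiv.smulLeft (Units.mk0 c hc) : E ≃L[ℝ] E).trans e, by ext; simp⟩
  have h : (c • b).inverse = c⁻¹ • b.inverse := by
    ext1 l
    apply hi.injective
    rw [hi.self_apply_inverse, ContinuousLinearMap.smul_apply, ContinuousLinearMap.smul_apply,
      map_smul, hb.self_apply_inverse, smul_smul, mul_inv_cancel₀ hc, one_smul]
  rw [trB, h, ContinuousLinearMap.smul_comp, tr_smul]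
  rfl

/-- The endomorphism A = b⁻¹β is self-adjoint for `b`, so in a `b`-orthogonal basis tr A² = Σ b(Avᵢ,
Avᵢ) / b(vᵢ, vᵢ), a sum of nonnegative terms. -/
theorem eq_zero_of_pairB_self {b : Bil E} (hs : ∀ u v, b u v = b v u)
    (hp : ∀ v, v ≠ 0 → 0 < b v v) {β : Bil E} (hβ : ∀ u v, β u v = β v u)
    (h : pairB b β β = 0) : β = 0 := by
  have hb := isInvertible_of_pos hp
  set B : LinearMap.BilinForm ℝ E := LinearMap.mk₂ ℝ (fun u v => b u v) (by simp) (by simp)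
    (by simp) (by simp) with hB
  obtain ⟨v, hv⟩ := LinearMap.BilinForm.exists_orthogonal_basis (B := B) ⟨fun u v => hs u v⟩
  have hv' : ∀ i j, i ≠ j → b (v i) (v j) = 0 := fun i j hij => hv hij
  have hd : ∀ i, 0 < b (v i) (v i) := fun i => hp _ (v.ne_zero i)
  have hcoord : ∀ i w, v.coord i w = b (v i) w / b (v i) (v i) := by
    intro i w
    have h1 : b (v i) w = v.coord i w * b (v i) (v i) := by
      conv_lhs => rw [← v.sum_repr w]
      simp only [map_sum, map_smul, smul_eq_mul]
      rw [Finset.sum_eq_single i]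
      · rfl
      · intro j _ hj
        rw [hv' i j hj.symm, mul_zero]
      · simp
    rw [h1, mul_div_cancel_right₀ _ (hd i).ne']
  set A : E →L[ℝ] E := b.inverse ∘L β with hA
  have hbA : ∀ u w, b (A u) w = β u w := fun u w => by
    rw [hA, ContinuousLinearMap.comp_apply, hb.self_apply_inverse]
  have hsum : ∑ i, b (A (v i)) (A (v i)) / b (v i) (v i) = 0 := by
    rw [← h]
    have h2 : pairB b β β = tr (A ∘L A) := rfl
    rw [h2, tr_eq_sum_basis v]
    refine Finset.sum_congr rfl fun i _ => ?_
    rw [hcoord]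
    change b (A (v i)) (A (v i)) / _ = b (v i) (A (A (v i))) / _
    rw [hbA (v i), hs (v i) (A (A (v i))), hbA (A (v i)), hβ]
  have hnonneg : ∀ w, 0 ≤ b w w := fun w => by
    rcases eq_or_ne w 0 with rfl | hw
    · simp
    · exact (hp w hw).le
  have h3 := (Finset.sum_eq_zero_iff_of_nonneg fun i _ =>
    div_nonneg (hnonneg (A (v i))) (hd i).le).mp hsum
  have h4 : ∀ i, A (v i) = 0 := by
    intro i
    by_contra hne
    exact (div_pos (hp _ hne) (hd i)).ne' (h3 i (Finset.mem_univ i))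
  have h5 : (A : E →ₗ[ℝ] E) = 0 := v.ext h4
  ext u w
  rw [← hbA]
  have h6 : A u = 0 := LinearMap.congr_fun h5 u
  simp [h6]

theorem exists_coercive {b : Bil E} (hp : ∀ v, v ≠ 0 → 0 < b v v) :
    ∃ m : ℝ, 0 < m ∧ ∀ v, m * ‖v‖ ^ 2 ≤ b v v := by
  rcases subsingleton_or_nontrivial E with hE | hE
  · refine ⟨1, one_pos, fun v => ?_⟩
    rw [Subsingleton.elim v 0]
    simp
  obtain ⟨w, hw, hmin⟩ := (isCompact_sphere (0 : E) 1).exists_isMinOn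
    (NormedSpace.sphere_nonempty.mpr zero_le_one) (f := fun v => b v v)
    (by fun_prop)
  have hw0 : w ≠ 0 := by
    rintro rfl
    simp at hw
  refine ⟨b w w, hp w hw0, fun v => ?_⟩
  rcases eq_or_ne v 0 with rfl | hv
  · simp
  have hn : 0 < ‖v‖ := norm_pos_iff.mpr hv
  have h1 : b w w ≤ b (‖v‖⁻¹ • v) (‖v‖⁻¹ • v) := hmin (by
    simp [norm_smul, hn.ne'])
  simp only [map_smul, ContinuousLinearMap.smul_apply, smul_eq_mul] at h1
  calc b w w * ‖v‖ ^ 2 ≤ ‖v‖⁻¹ * (‖v‖⁻¹ * b v v) * ‖v‖ ^ 2 := by gcongr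
    _ = b v v := by field_simp

theorem eventually_pos_add_smul {b : Bil E} (hp : ∀ v, v ≠ 0 → 0 < b v v) (β : Bil E) :
    ∀ᶠ s : ℝ in 𝓝 0, ∀ v, v ≠ 0 → 0 < (b + s • β) v v := by
  obtain ⟨m, hm, hb⟩ := exists_coercive hp
  have hc : Filter.Tendsto (fun s : ℝ => |s| * ‖β‖) (𝓝 0) (𝓝 0) := by
    have : Continuous fun s : ℝ => |s| * ‖β‖ := by fun_prop
    simpa using this.tendsto 0
  filter_upwards [hc.eventually (gt_mem_nhds hm)] with s hs v hv
  have hn : 0 < ‖v‖ ^ 2 := by positivity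
  have h1 : |s * β v v| ≤ |s| * ‖β‖ * ‖v‖ ^ 2 := by
    rw [abs_mul, mul_assoc, pow_two, ← mul_assoc ‖β‖]
    gcongr
    exact β.le_opNorm₂ v v
  have h2 : |s| * ‖β‖ * ‖v‖ ^ 2 < m * ‖v‖ ^ 2 := by gcongr
  have h3 := neg_abs_le (s * β v v)
  have h4 := hb v
  simp only [ContinuousLinearMap.add_apply, ContinuousLinearMap.smul_apply, smul_eq_mul]
  linarith

theorem isVonNBounded_of_pos {b : Bil E} (hp : ∀ v, v ≠ 0 → 0 < b v v) :
    Bornology.IsVonNBounded ℝ {v : E | b v v < 1} := by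
  obtain ⟨m, hm, hb⟩ := exists_coercive hp
  refine (NormedSpace.isVonNBounded_of_isBounded ℝ (Metric.isBounded_closedBall
    (x := (0 : E)) (r := 1 + m⁻¹))).subset fun v hv => ?_
  have h1 : m * ‖v‖ ^ 2 < 1 := (hb v).trans_lt hv
  have h2 : ‖v‖ ^ 2 < m⁻¹ := by
    rw [← one_div, lt_div_iff₀ hm, mul_comm]
    exact h1
  rw [mem_closedBall_zero_iff]
  -- The radius `1 + m⁻¹` avoids a square root: 2‖v‖ ≤ 1 + ‖v‖² < 1 + m⁻¹.
  nlinarith [sq_nonneg (‖v‖ - 1)]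

theorem trB_contDiff {b : ℝ → Bil E} (hb : ContDiff ℝ ∞ b) (hi : ∀ t, (b t).IsInvertible)
    (β : Bil E) : ContDiff ℝ ∞ fun t => trB (b t) β := by
  have h1 : ContDiff ℝ ∞ fun t => (b t).inverse := contDiff_iff_contDiffAt.mpr fun t =>
    (contDiffAt_inverse_of_isInvertible (hi t)).comp t hb.contDiffAt
  exact (trL E).contDiff.comp (h1.clm_comp contDiff_const)

end Pairing

/-! ### Invariant tensors are determined by their values at the origin. -/

section Transport

variable {EG : Type*} [NormedAddCommGroup EG] [NormedSpace ℝ EG] [FiniteDimensional ℝ EG]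
  {G : Type*} [Group G] [TopologicalSpace G] [ChartedSpace EG G] [LieGroup 𝓘(ℝ, EG) ∞ G]
  {H : Subgroup G} {n : ℕ} [ChartedSpace (Model n) (G ⧸ H)] [IsManifold (𝓡 n) ∞ (G ⧸ H)]

/-- The field of bilinear forms `B` at the origin of `G ⧸ H`, in coordinates. -/
abbrev atOrigin (B : TensorField02 (n := n) (G ⧸ H)) : Bil (Model n) :=
  loc B (origin H) (oCoord H n)

/-- `L` is the derivative of a translation taking the origin to the given point, hence the same for
all invariant tensors; the metric `g` only serves to make it invertible. -/
theorem SmoothAction.exists_transport (h : SmoothAction EG H n) {g : RiemMetric (n := n) (G ⧸ H)}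
    (hg : IsInvariant (n := n) (H := H) g.inner) (x : G ⧸ H) {y : Model n}
    (hy : y ∈ (extChartAt (𝓡 n) x).target) : ∃ L : Model n →L[ℝ] Model n, L.IsInvertible ∧
      ∀ B : TensorField02 (n := n) (G ⧸ H), IsInvariant (n := n) (H := H) B →
        ∀ u v, atOrigin B u v = loc B x y (L u) (L v) := by
  obtain ⟨a, ha⟩ := exists_smul_origin ((extChartAt (𝓡 n) x).symm y)
  have hm : oCoord H n ∈ transDom (n := n) (fun z : G ⧸ H => a • z) (origin H) x := by
    refine ⟨oCoord_mem, ?_⟩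
    change a • (extChartAt (𝓡 n) (origin H)).symm (oCoord H n) ∈ (extChartAt (𝓡 n) x).source
    rw [symm_oCoord, ha]
    exact (extChartAt (𝓡 n) x).map_target hy
  have ht : trans (n := n) (fun z : G ⧸ H => a • z) (origin H) x (oCoord H n) = y := by
    rw [trans, symm_oCoord, ha, (extChartAt (𝓡 n) x).right_inv hy]
  refine ⟨fderiv ℝ (trans (fun z : G ⧸ H => a • z) (origin H) x) (oCoord H n),
    (isometryOn_trans (h.smul a) (fun x v w => hg a x v w) (origin H) x).inv _ hm,
    fun B hB u v => ?_⟩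
  have h1 := loc_natural (h.smul a) (B := B) (fun x v w => hB a x v w) (origin H) x hm u v
  rwa [ht] at h1

theorem apply_eq_loc (B : TensorField02 (n := n) (G ⧸ H)) (x : G ⧸ H) (v w : Model n) :
    B x v w = loc B x (extChartAt (𝓡 n) x x) (dchart x x v) (dchart x x w) := by
  have hx : (extChartAt (𝓡 n) x).symm (extChartAt (𝓡 n) x x) = x := extChartAt_to_inv (I := 𝓡 n) x
  let B' : G ⧸ H → Bil (Model n) := B
  change B' x v w = B' ((extChartAt (𝓡 n) x).symm (extChartAt (𝓡 n) x x))
    (dsymm x (extChartAt (𝓡 n) x x) (dchart x x v)) (dsymm x (extChartAt (𝓡 n) x x) (dchart x x w))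
  rw [hx, dsymm_dchart x (mem_extChartAt_source (I := 𝓡 n) x),
    dsymm_dchart x (mem_extChartAt_source (I := 𝓡 n) x)]

theorem SmoothAction.eq_of_atOrigin_eq (h : SmoothAction EG H n)
    {g : RiemMetric (n := n) (G ⧸ H)} (hg : IsInvariant (n := n) (H := H) g.inner)
    {B B' : TensorField02 (n := n) (G ⧸ H)} (hB : IsInvariant (n := n) (H := H) B)
    (hB' : IsInvariant (n := n) (H := H) B') {c : ℝ} (heq : atOrigin B = c • atOrigin B')
    (x : G ⧸ H) (v w : TangentSpace (𝓡 n) x) : B x v w = c * B' x v w := by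
  have key : ∀ v w : Model n, B x v w = c * B' x v w := by
    intro v w
    obtain ⟨L, hL, hLB⟩ := h.exists_transport hg x (mem_extChartAt_target (I := 𝓡 n) x)
    obtain ⟨v', hv'⟩ := hL.surjective (dchart x x v)
    obtain ⟨w', hw'⟩ := hL.surjective (dchart x x w)
    rw [apply_eq_loc B, apply_eq_loc B', ← hv', ← hw', ← hLB B hB, ← hLB B' hB', heq]
    rfl
  exact key v w

theorem SmoothAction.pos_of_atOrigin_pos (h : SmoothAction EG H n)
    {g : RiemMetric (n := n) (G ⧸ H)} (hg : IsInvariant (n := n) (H := H) g.inner)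
    {B : TensorField02 (n := n) (G ⧸ H)} (hB : IsInvariant (n := n) (H := H) B)
    (hpos : ∀ v, v ≠ 0 → 0 < atOrigin B v v) (x : G ⧸ H) (v : TangentSpace (𝓡 n) x) (hv : v ≠ 0) :
    0 < B x v v := by
  have key : ∀ v : Model n, v ≠ 0 → 0 < B x v v := by
    intro v hv
    obtain ⟨L, hL, hLB⟩ := h.exists_transport hg x (mem_extChartAt_target (I := 𝓡 n) x)
    obtain ⟨v', hv'⟩ := hL.surjective (dchart x x v)
    rw [apply_eq_loc B, ← hv', ← hLB B hB]
    refine hpos _ fun h0 => hv ?_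
    rw [h0, map_zero] at hv'
    rw [← dsymm_dchart x (mem_extChartAt_source (I := 𝓡 n) x) v, ← hv', map_zero]
  exact key v hv

theorem SmoothAction.metricTrace_eq_atOrigin (h : SmoothAction EG H n)
    {g : RiemMetric (n := n) (G ⧸ H)} (hg : IsInvariant (n := n) (H := H) g.inner)
    {B : TensorField02 (n := n) (G ⧸ H)} (hB : IsInvariant (n := n) (H := H) B) (x : G ⧸ H) :
    metricTrace g (fun z v w => B z v w) x = trB (atOrigin (H := H) g.inner) (atOrigin B) := by
  have hy := mem_extChartAt_target (I := 𝓡 n) x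
  obtain ⟨L, hL, hLB⟩ := h.exists_transport hg x hy
  rw [metricTrace_eq]
  exact (trB_natural hL ((metricOn_loc g (origin H)).inv _ oCoord_mem) ((metricOn_loc g x).inv _ hy)
    (hLB _ hg) (hLB _ hB)).symm

variable {M : Type*} [TopologicalSpace M] [ChartedSpace (Model n) M] [IsManifold (𝓡 n) ∞ M]

/-- A smooth positive definite symmetric tensor field, as a Riemannian metric. -/
def mkMetric (B : TensorField02 (n := n) M) (hs : IsSmoothTensor B)
    (hsymm : ∀ (x : M) (v w : TangentSpace (𝓡 n) x), B x v w = B x w v)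
    (hpos : ∀ (x : M) (v : TangentSpace (𝓡 n) x), v ≠ 0 → 0 < B x v v) : RiemMetric (n := n) M where
  inner := B
  symm := hsymm
  pos := hpos
  isVonNBounded x := isVonNBounded_of_pos (E := Model n) (b := B x) (hpos x)
  contMDiff := hs

theorem riemMetric_ext {g g' : RiemMetric (n := n) M}
    (h : ∀ (x : M) (v w : TangentSpace (𝓡 n) x), g.inner x v w = g'.inner x v w) : g = g' := by
  have h1 : g.inner = g'.inner := by
    funext x
    ext v w
    exact h x v w
  cases g
  cases g'
  cases h1
  rfl

end Transport

/-! ### Curves of invariant metrics and first variation formulas. -/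

section Curves

/-- Values of the curve itself can be chosen as a basis of its span, and the coordinates extend to
linear functionals on V. -/
theorem exists_smooth_coefficients {V : Type*} [NormedAddCommGroup V] [NormedSpace ℝ V]
    [FiniteDimensional ℝ V] {β : ℝ → V} (hβ : ContDiff ℝ ∞ β) :
    ∃ (k : ℕ) (t : Fin k → ℝ) (c : Fin k → ℝ → ℝ), (∀ i, ContDiff ℝ ∞ (c i)) ∧
      ∀ s, β s = ∑ i, c i s • β (t i) := by
  obtain ⟨f, hf, hspan, hli⟩ := Submodule.exists_fun_fin_finrank_span_eq ℝ (Set.range β)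
  choose t ht using hf
  have hmem : ∀ s, β s ∈ Submodule.span ℝ (Set.range f) := fun s => by
    rw [hspan]
    exact Submodule.subset_span ⟨s, rfl⟩
  let B := Module.Basis.span hli
  choose ℓ hℓ using fun i => LinearMap.exists_extend (B.coord i)
  refine ⟨_, t, fun i s => ℓ i (β s),
    fun i => (LinearMap.toContinuousLinearMap (ℓ i)).contDiff.comp hβ, fun s => ?_⟩
  have h1 := congrArg Subtype.val (B.sum_repr ⟨β s, hmem s⟩)
  simp only [AddSubmonoidClass.coe_finset_sum, SetLike.val_smul] at h1
  refine h1.symm.trans (Finset.sum_congr rfl fun i _ => ?_)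
  have h2 : ((B i : _) : V) = f i := by
    simp only [B, Module.Basis.span_apply]
  have h3 : ℓ i (β s) = B.repr ⟨β s, hmem s⟩ i :=
    LinearMap.congr_fun (hℓ i) ⟨β s, hmem s⟩
  change _ = ℓ i (β s) • β (t i)
  rw [h2, ht, h3]

variable {EG : Type*} [NormedAddCommGroup EG] [NormedSpace ℝ EG] [FiniteDimensional ℝ EG]
  {G : Type*} [Group G] [TopologicalSpace G] [ChartedSpace EG G] [LieGroup 𝓘(ℝ, EG) ∞ G]
  {H : Subgroup G} {n : ℕ} [ChartedSpace (Model n) (G ⧸ H)] [IsManifold (𝓡 n) ∞ (G ⧸ H)]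
  {γ : ℝ → RiemMetric (n := n) (G ⧸ H)}

theorem IsSmoothCurve.atOrigin_contDiff (hγ : IsSmoothCurve γ) :
    ContDiff ℝ ∞ fun t => atOrigin (γ t).inner :=
  contDiff_clm_apply_iff.mpr fun u => contDiff_clm_apply_iff.mpr fun v =>
    hγ ((extChartAt (𝓡 n) (origin H)).symm (oCoord H n)) (dsymm (origin H) (oCoord H n) u)
      (dsymm (origin H) (oCoord H n) v)

variable (h : SmoothAction EG H n) (hγ : IsSmoothCurve γ)
  (hinv : ∀ t, IsInvariant (n := n) (H := H) (γ t).inner)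
include h hγ hinv

/-- `IsSmoothCurve` gives smoothness in time at each fixed point only. By invariance, the expansion
of the curve at the origin in finitely many of its own values holds at every point with the same
coefficients, so the family is jointly smooth. -/
theorem SmoothAction.metricFamily (x : G ⧸ H) :
    MetricFamily (fun t => loc (γ t).inner x) (extChartAt (𝓡 n) x).target where
  metric t := metricOn_loc (γ t) x
  smooth := by
    obtain ⟨k, t, c, hc, hsum⟩ := exists_smooth_coefficients hγ.atOrigin_contDiff
    have h1 : ContDiffOn ℝ ∞ (fun p : ℝ × Model n => ∑ i, c i p.1 • loc (γ (t i)).inner x p.2)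
        (Set.univ ×ˢ (extChartAt (𝓡 n) x).target) := by
      refine ContDiffOn.sum fun i _ => ?_
      exact ((hc i).comp contDiff_fst).contDiffOn.smul
        ((metricOn_loc (γ (t i)) x).smooth.comp contDiff_snd.contDiffOn fun p hp => hp.2)
    refine h1.congr fun p hp => ?_
    obtain ⟨L, hL, hLB⟩ := h.exists_transport (hinv 0) x hp.2
    ext u v
    obtain ⟨u', rfl⟩ := hL.surjective u
    obtain ⟨v', rfl⟩ := hL.surjective v
    simp only [ContinuousLinearMap.sum_apply, ContinuousLinearMap.smul_apply, ← hLB _ (hinv _)]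
    rw [hsum p.1]
    simp only [ContinuousLinearMap.sum_apply, ContinuousLinearMap.smul_apply]

theorem SmoothAction.invariantField :
    InvariantField (H := H) (n := n) fun x =>
      varField (loc (γ 0).inner x) (chrVar fun t => loc (γ t).inner x) where
  smooth x := (metricOn_loc (γ 0) x).varField_contDiffOn (h.metricFamily hγ hinv x).chrVar_contDiffOn
  natural a x x' y hy := by
    have hiso := fun t => isometryOn_trans (h.smul a) (fun x v w => hinv t a x v w) x x'
    have hb : MetricFamily (fun t => loc (γ t).inner x) (transDom (n := n) (fun z => a • z) x x') :=
      { metric := fun t => (hiso t).left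
        smooth := (h.metricFamily hγ hinv x).smooth.mono
          (Set.prod_mono subset_rfl Set.inter_subset_left) }
    exact hb.varField_natural (h.metricFamily hγ hinv x') hiso hy

/-- First variation of the scalar curvature along a curve of invariant metrics. -/
theorem SmoothAction.hasDerivAt_scalarFunctional [CompactSpace G] :
    HasDerivAt (fun t => scalarFunctional (γ t))
      (-pairB (atOrigin (γ 0).inner) (deriv (fun t => atOrigin (γ t).inner) 0)
        (atOrigin (ricT (γ 0)))) 0 := by
  have hH : HasDerivAt (fun t => atOrigin (γ t).inner)
      (deriv (fun t => atOrigin (γ t).inner) 0) 0 :=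
    (hγ.atOrigin_contDiff.differentiable (by simp) 0).hasDerivAt
  have h1 := (h.metricFamily hγ hinv (origin H)).hasDerivAt_scal oCoord_mem hH
  rw [h.divg_eq_zero (hinv 0) (h.invariantField hγ hinv), add_zero] at h1
  simp_rw [scalarFunctional, scalarCurvature_eq]
  rw [atOrigin, atOrigin, loc_ricT (γ 0) (origin H) oCoord_mem]
  exact h1

/-- First variation of the trace of an invariant tensor along a curve of invariant metrics. -/
theorem SmoothAction.hasDerivAt_trace (T : TensorField02 (n := n) (G ⧸ H)) :
    HasDerivAt (fun t => trB (atOrigin (γ t).inner) (atOrigin T))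
      (-pairB (atOrigin (γ 0).inner) (deriv (fun t => atOrigin (γ t).inner) 0)
        (atOrigin T)) 0 := by
  have hH : HasDerivAt (fun t => atOrigin (γ t).inner)
      (deriv (fun t => atOrigin (γ t).inner) 0) 0 :=
    (hγ.atOrigin_contDiff.differentiable (by simp) 0).hasDerivAt
  have h1 := hasDerivAt_trB (β := fun _ => atOrigin T) (β' := 0)
    (fun t => (metricOn_loc (γ t) (origin H)).symm _ oCoord_mem)
    (fun t => (metricOn_loc (γ t) (origin H)).inv _ oCoord_mem) hH
    (fun u v => hasDerivAt_const 0 _)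
  rwa [trB_zero, add_zero] at h1

end Curves

/-! ### Critical points of scalar curvature under the trace constraint. -/

section Critical

variable {EG : Type*} [NormedAddCommGroup EG] [NormedSpace ℝ EG] [FiniteDimensional ℝ EG]
  {G : Type*} [Group G] [TopologicalSpace G] [ChartedSpace EG G] [LieGroup 𝓘(ℝ, EG) ∞ G]
  {H : Subgroup G} {n : ℕ} [ChartedSpace (Model n) (G ⧸ H)] [IsManifold (𝓡 n) ∞ (G ⧸ H)]

theorem unitTrace_atOrigin (h : SmoothAction EG H n) {T : TensorField02 (n := n) (G ⧸ H)}
    (hT : IsInvariant (n := n) (H := H) T) {g : RiemMetric (n := n) (G ⧸ H)}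
    (hg : g ∈ unitTraceMetrics T) : trB (atOrigin (H := H) g.inner) (atOrigin T) = 1 := by
  rw [← h.metricTrace_eq_atOrigin hg.1 hT (origin H)]
  exact hg.2 _

theorem loc_eq_smul {M : Type*} [TopologicalSpace M] [ChartedSpace (Model n) M]
    {A B : TensorField02 (n := n) M} {c : ℝ}
    (h : ∀ (x : M) (v w : TangentSpace (𝓡 n) x), A x v w = c * B x v w) (x : M) (y : Model n) :
    loc A x y = c • loc B x y := by
  ext u v
  exact h ((extChartAt (𝓡 n) x).symm y) (dsymm x y u) (dsymm x y v)

/-- The linear combination `c • (A + s • B)` of tensor fields. -/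
def combine {M : Type*} [TopologicalSpace M] [ChartedSpace (Model n) M]
    (A B : TensorField02 (n := n) M) (c s : ℝ) : TensorField02 (n := n) M :=
  fun x => c • (A x + s • B x)

section Combine

variable {M : Type*} [TopologicalSpace M] [ChartedSpace (Model n) M]
  (A B : TensorField02 (n := n) M) (c s : ℝ)

theorem combine_apply (x : M) (v w : TangentSpace (𝓡 n) x) :
    combine A B c s x v w = c * (A x v w + s * B x v w) := rfl

theorem loc_combine (x : M) (y : Model n) :
    loc (combine A B c s) x y = c • (loc A x y + s • loc B x y) := rfl

end Combine

theorem IsInvariant.combine {A B : TensorField02 (n := n) (G ⧸ H)}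
    (hA : IsInvariant (n := n) (H := H) A) (hB : IsInvariant (n := n) (H := H) B) (c s : ℝ) :
    IsInvariant (n := n) (H := H) (combine A B c s) := by
  intro a x v w
  rw [combine_apply, combine_apply, hA, hB]

theorem IsSmoothTensor.combine {M : Type*} [TopologicalSpace M] [ChartedSpace (Model n) M]
    [IsManifold (𝓡 n) ∞ M] {A B : TensorField02 (n := n) M} (hA : IsSmoothTensor A)
    (hB : IsSmoothTensor B) (c s : ℝ) : IsSmoothTensor (combine A B c s) :=
  isSmoothTensor_of_loc fun x =>
    ((hA.loc_contDiffOn x).add ((hB.loc_contDiffOn x).const_smul s)).const_smul c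

/-- A curve in `𝓜_T` through `g` in the direction of an invariant symmetric tensor orthogonal
to `T`. -/
theorem SmoothAction.exists_curve (h : SmoothAction EG H n) {T : TensorField02 (n := n) (G ⧸ H)}
    (hT : IsInvariant (n := n) (H := H) T) {g : RiemMetric (n := n) (G ⧸ H)}
    (hg : g ∈ unitTraceMetrics T) {B : TensorField02 (n := n) (G ⧸ H)}
    (hB : IsInvariant (n := n) (H := H) B) (hBs : IsSmoothTensor B)
    (hsymm : ∀ (x : G ⧸ H) (v w : TangentSpace (𝓡 n) x), B x v w = B x w v)
    (hort : pairB (atOrigin (H := H) g.inner) (atOrigin B) (atOrigin T) = 0) :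
    ∃ (ε : ℝ) (γ : ℝ → RiemMetric (n := n) (G ⧸ H)), ε ≠ 0 ∧ IsSmoothCurve γ ∧
      (∀ t, γ t ∈ unitTraceMetrics T) ∧ γ 0 = g ∧
      deriv (fun t => atOrigin (H := H) (γ t).inner) 0 = ε • atOrigin B := by
  set b := atOrigin (H := H) g.inner with hb
  set β := atOrigin B with hβ
  set τ := atOrigin T with hτ
  have hbpos : ∀ v, v ≠ 0 → 0 < b v v := fun v hv => loc_pos g.pos (origin H) oCoord_mem hv
  have hbinv := isInvertible_of_pos hbpos
  have htr1 : trB b τ = 1 := unitTrace_atOrigin h hT hg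
  have hcont : ContinuousAt (fun s : ℝ => trB (b + s • β) τ) 0 := by
    have h0 : b + (0 : ℝ) • β = b := by rw [zero_smul, add_zero]
    have h1 : ContinuousAt (ContinuousLinearMap.inverse : Bil (Model n) → _) (b + (0 : ℝ) • β) := by
      rw [h0]
      exact (contDiffAt_inverse_of_isInvertible hbinv).continuousAt
    have h2 : ContinuousAt (fun s : ℝ => b + s • β) 0 := by fun_prop
    have h3 : ContinuousAt (fun s : ℝ => (b + s • β).inverse) 0 :=
      ContinuousAt.comp (f := fun s : ℝ => b + s • β) h1 h2
    exact (trL (Model n)).continuous.continuousAt.comp (h3.clm_comp continuousAt_const)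
  have htrpos : ∀ᶠ s : ℝ in 𝓝 0, 0 < trB (b + s • β) τ := by
    refine hcont.eventually (lt_mem_nhds ?_)
    simp only [zero_smul, add_zero, htr1]
    exact one_pos
  obtain ⟨δ, hδ, hball⟩ := Metric.eventually_nhds_iff.mp
    ((eventually_pos_add_smul hbpos β).and htrpos)
  set ε := δ / 2 with hε
  have hε0 : 0 < ε := half_pos hδ
  have hsin : ∀ t : ℝ, dist (ε * Real.sin t) 0 < δ := by
    intro t
    rw [dist_zero_right, Real.norm_eq_abs, abs_mul, abs_of_pos hε0]
    calc ε * |Real.sin t| ≤ ε * 1 := by gcongr; exact Real.abs_sin_le_one t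
      _ < δ := by rw [mul_one]; exact half_lt_self hδ
  -- Critical points are tested on curves defined on all of ℝ; the sine keeps the parameter within
  -- the δ-ball, where positivity holds, and has nonzero velocity ε at time zero.
  set B₀ : ℝ → Bil (Model n) := fun t => b + (ε * Real.sin t) • β with hB₀
  have hB₀pos : ∀ t v, v ≠ 0 → 0 < B₀ t v v := fun t => (hball (hsin t)).1
  have hB₀inv : ∀ t, (B₀ t).IsInvertible := fun t => isInvertible_of_pos (hB₀pos t)
  -- Scaling the metric by F divides the trace of T by F, so F · B₀ satisfies the constraint
  -- exactly.
  set F : ℝ → ℝ := fun t => trB (B₀ t) τ with hF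
  have hFpos : ∀ t, 0 < F t := fun t => (hball (hsin t)).2
  have hsinc : ContDiff ℝ ∞ fun t => ε * Real.sin t := contDiff_const.mul Real.contDiff_sin
  have hB₀c : ContDiff ℝ ∞ B₀ := contDiff_const.add (hsinc.smul contDiff_const)
  have hFc : ContDiff ℝ ∞ F := trB_contDiff hB₀c hB₀inv τ
  have hB₀0 : B₀ 0 = b := by simp [hB₀]
  have hF0 : F 0 = 1 := by rw [hF]; simp only [hB₀0]; exact htr1
  set C : ℝ → TensorField02 (n := n) (G ⧸ H) :=
    fun t => combine g.inner B (F t) (ε * Real.sin t) with hC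
  have hCinv : ∀ t, IsInvariant (n := n) (H := H) (C t) := fun t => IsInvariant.combine hg.1 hB _ _
  have hC0 : ∀ t, atOrigin (C t) = F t • B₀ t := fun t => loc_combine _ _ _ _ _ _
  have hCpos : ∀ t v, v ≠ 0 → 0 < atOrigin (C t) v v := by
    intro t v hv
    rw [hC0]
    exact mul_pos (hFpos t) (hB₀pos t v hv)
  refine ⟨ε, fun t => mkMetric (C t) ((isSmoothTensor_inner g).combine hBs _ _)
    (fun x v w => by rw [combine_apply, combine_apply, g.symm, hsymm])
    (h.pos_of_atOrigin_pos hg.1 (hCinv t) (hCpos t)), hε0.ne', ?_, fun t => ⟨hCinv t, fun x => ?_⟩,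
    ?_, ?_⟩
  · intro x v w
    exact hFc.mul (contDiff_const.add (hsinc.mul contDiff_const))
  · rw [h.metricTrace_eq_atOrigin (hCinv t) hT x]
    change trB (atOrigin (C t)) τ = 1
    rw [hC0, trB_smul_left (hB₀inv t) (hFpos t).ne']
    exact inv_mul_cancel₀ (hFpos t).ne'
  · refine riemMetric_ext fun x v w => ?_
    change C 0 x v w = _
    rw [hC]
    simp only [combine_apply]
    rw [hF0, Real.sin_zero]
    ring
  · change deriv (fun t => atOrigin (C t)) 0 = ε • β
    simp_rw [hC0]
    have hdB : HasDerivAt B₀ (ε • β) 0 := by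
      have h1 := ((Real.hasDerivAt_sin 0).const_mul ε).smul_const β
      rw [Real.cos_zero, mul_one] at h1
      exact h1.const_add b
    -- Orthogonality of B and T makes the rescaling stationary at time zero, so it does not change
    -- the velocity.
    have hdF : HasDerivAt F 0 0 := by
      have hsy : ∀ t u v, B₀ t u v = B₀ t v u := by
        intro t u v
        simp only [hB₀, ContinuousLinearMap.add_apply, ContinuousLinearMap.smul_apply]
        rw [hb, hβ, atOrigin, atOrigin, loc_symm g.symm, loc_symm hsymm]
      have h1 := hasDerivAt_trB (β := fun _ => τ) (β' := 0) hsy hB₀inv hdB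
        (fun u v => hasDerivAt_const 0 _)
      rwa [trB_zero, add_zero, hB₀0, pairB_smul_left, hort, mul_zero, neg_zero] at h1
    have h2 := (hdF.smul hdB).deriv
    rw [zero_smul, hF0, one_smul, add_zero] at h2
    exact h2

theorem SmoothAction.ricci_eq_iff [CompactSpace G] (h : SmoothAction EG H n)
    {T : TensorField02 (n := n) (G ⧸ H)} (hTs : IsSmoothTensor T)
    (hsymm : ∀ (x : G ⧸ H) (v w : TangentSpace (𝓡 n) x), T x v w = T x w v)
    (hT : IsInvariant (n := n) (H := H) T) {g : RiemMetric (n := n) (G ⧸ H)}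
    (hg : g ∈ unitTraceMetrics T) :
    (∃ c : ℝ, ∀ (x : G ⧸ H) (v w : TangentSpace (𝓡 n) x), ricci g x v w = c * T x v w) ↔
      IsCriticalPointOn scalarFunctional (unitTraceMetrics T) g := by
  have hR : IsInvariant (n := n) (H := H) (ricT g) :=
    fun a x v w => ricT_preserves (h.smul a) (fun x v w => hg.1 a x v w) x v w
  constructor
  · rintro ⟨c, hc⟩
    refine ⟨hg, fun γ hγ hγT hγ0 => ?_⟩
    subst hγ0
    have h1 := h.hasDerivAt_scalarFunctional hγ fun t => (hγT t).1
    have h2 := h.hasDerivAt_trace hγ (fun t => (hγT t).1) T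
    simp_rw [fun t => unitTrace_atOrigin h hT (hγT t)] at h2
    -- The trace is constantly 1 along the curve, so its velocity is orthogonal to T.
    have h3 := h2.unique (hasDerivAt_const (0 : ℝ) (1 : ℝ))
    have h4 : atOrigin (ricT (γ 0)) = c • atOrigin T := by
      exact loc_eq_smul (fun x v w => (ricci_eq (γ 0) x v w).symm.trans (hc x v w)) _ _
    rw [h4, pairB_smul_right, ← mul_neg, h3, mul_zero] at h1
    exact h1
  · rintro ⟨-, hcrit⟩
    have hbs : ∀ u v, atOrigin (H := H) g.inner u v = atOrigin (H := H) g.inner v u :=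
      (metricOn_loc g (origin H)).symm _ oCoord_mem
    have hbpos : ∀ v, v ≠ 0 → 0 < atOrigin (H := H) g.inner v v :=
      fun v hv => loc_pos g.pos (origin H) oCoord_mem hv
    set b := atOrigin (H := H) g.inner with hb
    set τ := atOrigin T with hτ
    set ρ := atOrigin (ricT g) with hρ
    have hττ : pairB b τ τ ≠ 0 := by
      intro h0
      have h1 := unitTrace_atOrigin h hT hg
      have h2 : τ = 0 := eq_zero_of_pairB_self hbs hbpos (loc_symm hsymm _ _) h0
      rw [← hτ, h2, trB_zero] at h1
      exact zero_ne_one h1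
    -- The coefficient of the orthogonal projection of Ric g onto the line spanned by T.
    set c := pairB b ρ τ / pairB b τ τ with hc
    have hB0 : atOrigin (combine (ricT g) T 1 (-c)) = ρ - c • τ := by
      rw [atOrigin, loc_combine, one_smul, neg_smul, ← sub_eq_add_neg]
    have hBsymm : ∀ (x : G ⧸ H) (v w : TangentSpace (𝓡 n) x),
        combine (ricT g) T 1 (-c) x v w = combine (ricT g) T 1 (-c) x w v := fun x v w => by
      rw [combine_apply, combine_apply, ricT_symm, hsymm]
    have hort : pairB b (ρ - c • τ) τ = 0 := by
      rw [pairB_sub_left, pairB_smul_left, hc, div_mul_cancel₀ _ hττ, sub_self]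
    obtain ⟨ε, γ, hε, hγ, hγT, hγ0, hderiv⟩ := h.exists_curve hT hg (hR.combine hT 1 (-c))
      ((ricT_isSmooth g).combine hTs 1 (-c)) hBsymm (by rw [hB0]; exact hort)
    have h1 := h.hasDerivAt_scalarFunctional hγ fun t => (hγT t).1
    rw [hderiv, hB0, hγ0] at h1
    have h2 := h1.unique (hcrit γ hγ hγT hγ0)
    rw [pairB_smul_left, neg_eq_zero] at h2
    have h3 : pairB b (ρ - c • τ) ρ = 0 := (mul_eq_zero.mp h2).resolve_left hε
    -- Criticality makes the difference orthogonal to Ric g, and the choice of c makes it orthogonal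
    -- to T.
    have h4 : pairB b (ρ - c • τ) (ρ - c • τ) = 0 := by
      rw [pairB_sub_right, pairB_smul_right, h3, hort, mul_zero, sub_zero]
    have h5 : ρ - c • τ = 0 := by
      refine eq_zero_of_pairB_self hbs hbpos ?_ h4
      rw [← hB0]
      exact loc_symm hBsymm _ _
    refine ⟨c, fun x v w => ?_⟩
    rw [ricci_eq]
    exact h.eq_of_atOrigin_eq hg.1 hR hT (sub_eq_zero.mp h5) x v w

end Critical

end HomogeneousRicci

end

/-- `G` is a compact connected Lie group and `H` a closed connected subgroup. The manifold structure
on the coset space `G ⧸ H` (with its quotient topology) is the one for which the action of `G` is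
smooth; by the homogeneous space construction theorem it exists and is unique. -/
theorem mainTheorem9
    {EG : Type*} [NormedAddCommGroup EG] [NormedSpace ℝ EG] [FiniteDimensional ℝ EG]
    {G : Type*} [Group G] [TopologicalSpace G] [ChartedSpace EG G] [LieGroup 𝓘(ℝ, EG) ∞ G]
    [T2Space G] [CompactSpace G] [ConnectedSpace G]
    (H : Subgroup G) (hH_closed : IsClosed (H : Set G)) (hH_conn : IsConnected (H : Set G))
    (n : ℕ) (hn : 3 ≤ n)
    [ChartedSpace (HomogeneousRicci.Model n) (G ⧸ H)] [IsManifold (𝓡 n) ∞ (G ⧸ H)]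
    (h_smooth : ContMDiff (𝓘(ℝ, EG).prod (𝓡 n)) (𝓡 n) ∞
      (fun p : G × (G ⧸ H) => p.1 • p.2))
    (h_eff : FaithfulSMul G (G ⧸ H))
    (T : HomogeneousRicci.TensorField02 (n := n) (G ⧸ H))
    (hT_smooth : HomogeneousRicci.IsSmoothTensor T)
    (hT_symm : ∀ (x : G ⧸ H) (v w : TangentSpace (𝓡 n) x), T x v w = T x w v)
    (hT_inv : HomogeneousRicci.IsInvariant T)
    (g : HomogeneousRicci.RiemMetric (n := n) (G ⧸ H))
    (hg : g ∈ HomogeneousRicci.unitTraceMetrics T) :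
    (∃ c : ℝ, ∀ (x : G ⧸ H) (v w : TangentSpace (𝓡 n) x),
        HomogeneousRicci.ricci g x v w = c * T x v w) ↔
      HomogeneousRicci.IsCriticalPointOn HomogeneousRicci.scalarFunctional
        (HomogeneousRicci.unitTraceMetrics T) g :=
  HomogeneousRicci.SmoothAction.ricci_eq_iff h_smooth hT_smooth hT_symm hT_inv hg
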